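/- Let $\lambda_i,\mu_i$ ($i=1,\dots,k$) be real algebraic numbers with $|\lambda_i|,|\mu_i|>1$ such that for every $i$: (1) $\lambda_i,\mu_i$ are multiplicatively independent, i.e. $\lambda_i^m\ne\mu_i^n$ for all $(m,n)\in\mathbb Z^2\setminus\{(0,0)\}$; (2) the multiplicative semigroup $S_i=\langle\lambda_i,\mu_i\rangle$ is hyperbolic: for every prime $p$ (including $p=\infty$, with $\overline{\mathbb Q}_\infty=\mathbb C$), if some field embedding $\theta:\mathbb Q(S_i)\to\overline{\mathbb Q}_p$ satisfies $\theta(S_i)\nsubseteq\{|z|_p\le 1\}$, then every field embedding $\theta:\mathbb Q(S_i)\to\overline{\mathbb Q}_p$ satisfies $\theta(S_i)\nsubseteq\{|z|_p=1\}$; (3) $\mathbb Q(\lambda_i^l,\mu_i^l)=\mathbb Q(\lambda_i,\mu_i)$ for all integers $l\ge1$. Put $K_i=\mathbb Q(\lambda_i,\mu_i)$, $r_i=[K_i:\mathbb Q]$, and fix a $\mathbb Z$-basis $\beta_1,\dots,\beta_{r_i}$ of the ring of integers of $K_i$. For $\alpha\in K_i$ let $M(\alpha)=(a_{jl})\in\mathrm{Mat}_{r_i}(\mathbb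 Q)$ be given by $\alpha\beta_j=\sum_l a_{jl}\beta_l$. Let $A_i=M(\lambda_i)$, $B_i=M(\mu_i)$, and let $a_i$ be the least positive integer such that $A_i,B_i\in\mathrm{Mat}_{r_i}(\mathbb Z[1/a_i])$. For positive integers $a,r$ let $$\Omega_a^r=\Big(\mathbb R^r\times\prod_{p\mid a}\mathbb Q_p^r\Big)\Big/\,\mathbb Z[1/a]^r ,$$ where $p$ runs over the primes dividing $a$ and $\mathbb Z[1/a]^r$ is embedded by $z\mapsto(z,-z,\dots,-z)$; matrices in $\mathrm{Mat}_r(\mathbb Z[1/a])$ act on $\Omega_a^r$ diagonally. Let $$\Omega=\prod_{i=1}^k\Omega_{a_i}^{r_i},\qquad \Sigma=\{(A_1^nB_1^m,\dots,A_k^nB_k^m):m,n\in\mathbb N\},$$ where $\Sigma$, the commutative semigroup generated by $(A_1,\dots,A_k)$ and $(B_1,\dots,B_k)$, acts on $\Omega$ componentwise. Then every non-empty closed subset $F\subseteq\Omega$ with $\Sigma F\subseteq F$ contains a torsion element of the group $\Omega$. -/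

import Mathlib

open Module

/-- A pair of real numbers is multiplicatively independent if `x ^ m ≠ y ^ n` for all pairs of
integers `(m, n) ≠ (0, 0)`. -/
def MultIndep (x y : ℝ) : Prop :=
  ∀ m n : ℤ, (m, n) ≠ (0, 0) → x ^ m ≠ y ^ n

/-- Hyperbolicity of a semigroup `S` of real algebraic numbers. For every place `p` of `ℚ`:
if some field embedding of `ℚ(S)` into the algebraic closure of `ℚ_p` (which is `ℂ` for
`p = ∞`) does not map `S` into `{|z|_p ≤ 1}`, then no field embedding maps `S` into
`{|z|_p = 1}`. The norm of `PadicAlgCl p` is the unique extension of the `p`-adic norm. -/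
def IsHyperbolic (S : Subsemigroup ℝ) : Prop :=
  ((∃ θ : IntermediateField.adjoin ℚ (S : Set ℝ) →+* ℂ,
      ∃ s : IntermediateField.adjoin ℚ (S : Set ℝ), (s : ℝ) ∈ S ∧ ¬ ‖θ s‖ ≤ 1) →
    ∀ θ : IntermediateField.adjoin ℚ (S : Set ℝ) →+* ℂ,
      ∃ s : IntermediateField.adjoin ℚ (S : Set ℝ), (s : ℝ) ∈ S ∧ ‖θ s‖ ≠ 1) ∧
  ∀ (p : ℕ) [Fact p.Prime],
    (∃ θ : IntermediateField.adjoin ℚ (S : Set ℝ) →+* PadicAlgCl p,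
      ∃ s : IntermediateField.adjoin ℚ (S : Set ℝ), (s : ℝ) ∈ S ∧ ¬ ‖θ s‖ ≤ 1) →
    ∀ θ : IntermediateField.adjoin ℚ (S : Set ℝ) →+* PadicAlgCl p,
      ∃ s : IntermediateField.adjoin ℚ (S : Set ℝ), (s : ℝ) ∈ S ∧ ‖θ s‖ ≠ 1

/-- The subring `ℤ[1/a]` of `ℚ`. -/
def zInv (a : ℕ) : Subring ℚ := Subring.closure {(a : ℚ)⁻¹}

section Solenoid

instance primeFactorFact (a : ℕ) (p : a.primeFactors) : Fact (p : ℕ).Prime :=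
  ⟨Nat.prime_of_mem_primeFactors p.2⟩

/-- `ℝ^r × ∏_{p ∣ a} ℚ_p^r`, with the product topology. -/
abbrev PreSolenoid (a r : ℕ) : Type :=
  (Fin r → ℝ) × (∀ p : a.primeFactors, Fin r → ℚ_[(p : ℕ)])

/-- The embedding `z ↦ (z, -z, …, -z)` of `ℤ[1/a]^r` into `ℝ^r × ∏_{p ∣ a} ℚ_p^r`. -/
noncomputable def solenoidEmb (a r : ℕ) : (Fin r → zInv a) →+ PreSolenoid a r where
  toFun z := (fun j => ((z j : ℚ) : ℝ), fun p j => -((z j : ℚ) : ℚ_[(p : ℕ)]))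
  map_zero' := by ext <;> simp
  map_add' z w := by ext <;> simp [add_comm]

/-- The solenoid `Ω_a^r = (ℝ^r × ∏_{p ∣ a} ℚ_p^r) / ℤ[1/a]^r`, with the quotient topology. -/
abbrev Solenoid (a r : ℕ) : Type := PreSolenoid a r ⧸ (solenoidEmb a r).range

/-- The diagonal action of a matrix over `ℤ[1/a]` on `ℝ^r × ∏_{p ∣ a} ℚ_p^r`. -/
noncomputable def preAct {a r : ℕ} (M : Matrix (Fin r) (Fin r) (zInv a)) :
    PreSolenoid a r →+ PreSolenoid a r where
  toFun x := ((M.map fun q => ((q : ℚ) : ℝ)).mulVec x.1,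
    fun p => (M.map fun q => ((q : ℚ) : ℚ_[(p : ℕ)])).mulVec (x.2 p))
  map_zero' := by ext <;> simp
  map_add' x y := by ext <;> simp [Matrix.mulVec_add]

theorem preAct_solenoidEmb {a r : ℕ} (M : Matrix (Fin r) (Fin r) (zInv a))
    (z : Fin r → zInv a) : preAct M (solenoidEmb a r z) = solenoidEmb a r (M.mulVec z) := by
  ext <;> simp [preAct, solenoidEmb, Matrix.mulVec, dotProduct]

/-- The action of a matrix over `ℤ[1/a]` on the solenoid `Ω_a^r`. -/
noncomputable def solenoidAct {a r : ℕ} (M : Matrix (Fin r) (Fin r) (zInv a)) :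
    Solenoid a r →+ Solenoid a r :=
  QuotientAddGroup.map _ _ (preAct M) (by
    rintro _ ⟨z, rfl⟩
    exact ⟨M.mulVec z, (preAct_solenoidEmb M z).symm⟩)

end Solenoid

section MultiplicationMatrix

/-- A `ℚ`-basis of `K` is an integral basis if its `ℤ`-span is the ring of algebraic integers
of `K`, that is, if it is a `ℤ`-basis of this ring. -/
def IsIntegralBasis {K : Type*} [Field K] [Algebra ℚ K] {r : ℕ} (b : Basis (Fin r) ℚ K) : Prop :=
  ∀ x : K, IsIntegral ℤ x ↔ x ∈ Submodule.span ℤ (Set.range b)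

/-- The matrix `M(α) = (a_{jl})` determined by `α * b_j = ∑_l a_{jl} b_l`. -/
noncomputable def multMatrix {K : Type*} [Field K] [Algebra ℚ K] {r : ℕ} (b : Basis (Fin r) ℚ K)
    (α : K) : Matrix (Fin r) (Fin r) ℚ :=
  Matrix.of fun j l => b.repr (α * b j) l

theorem multMatrix_spec {K : Type*} [Field K] [Algebra ℚ K] {r : ℕ} (b : Basis (Fin r) ℚ K)
    (α : K) (j : Fin r) : α * b j = ∑ l, multMatrix b α j l • b l :=
  (b.sum_repr (α * b j)).symm

/-- The positive integers `a` such that `A` and `B` have all their entries in `ℤ[1/a]`. -/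
def denominators {r : ℕ} (A B : Matrix (Fin r) (Fin r) ℚ) : Set ℕ :=
  {a | 0 < a ∧ ∀ j l, A j l ∈ zInv a ∧ B j l ∈ zInv a}

theorem mem_zInv_of_dvd (q : ℚ) (a : ℕ) (ha : 0 < a) (h : q.den ∣ a) : q ∈ zInv a := by
  obtain ⟨c, rfl⟩ := h
  have hc : (c : ℚ) ≠ 0 := by
    rintro h0
    have : c = 0 := by exact_mod_cast h0
    simp [this] at ha
  have hd : (q.den : ℚ) ≠ 0 := by exact_mod_cast q.den_nz
  have key : q = ((q.num * c : ℤ) : ℚ) * (((q.den * c : ℕ) : ℚ))⁻¹ := by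
    conv_lhs => rw [← Rat.num_div_den q]
    push_cast
    field_simp
  have hmem : (((q.den * c : ℕ) : ℚ))⁻¹ ∈ zInv (q.den * c) := Subring.subset_closure rfl
  have := Subring.mul_mem _ (intCast_mem (zInv (q.den * c)) (q.num * c)) hmem
  rwa [← key] at this

theorem denominators_nonempty {r : ℕ} (A B : Matrix (Fin r) (Fin r) ℚ) :
    (denominators A B).Nonempty := by
  have hpos : 0 < ∏ x : Fin r × Fin r, (A x.1 x.2).den * (B x.1 x.2).den :=
    Finset.prod_pos fun x _ => Nat.mul_pos (Rat.den_pos _) (Rat.den_pos _)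
  refine ⟨_, hpos, fun j l => ?_⟩
  have h := Finset.dvd_prod_of_mem
    (fun x : Fin r × Fin r => (A x.1 x.2).den * (B x.1 x.2).den) (Finset.mem_univ (j, l))
  exact ⟨mem_zInv_of_dvd _ _ hpos ((Dvd.intro _ rfl).trans h),
    mem_zInv_of_dvd _ _ hpos ((Dvd.intro_left _ rfl).trans h)⟩

/-- The least positive integer `a` such that `A` and `B` have all their entries in `ℤ[1/a]`. -/
noncomputable def leastDen {r : ℕ} (A B : Matrix (Fin r) (Fin r) ℚ) : ℕ :=
  sInf (denominators A B)

theorem leastDen_mem {r : ℕ} (A B : Matrix (Fin r) (Fin r) ℚ) :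
    leastDen A B ∈ denominators A B :=
  Nat.sInf_mem (denominators_nonempty A B)

end MultiplicationMatrix

section Pairs

/-- The field `ℚ(x, y)`, for real numbers `x` and `y`. -/
noncomputable abbrev pairField (x y : ℝ) : IntermediateField ℚ ℝ := IntermediateField.adjoin ℚ {x, y}

/-- `x` as an element of `ℚ(x, y)`. -/
noncomputable def pairFst (x y : ℝ) : pairField x y :=
  ⟨x, IntermediateField.subset_adjoin ℚ _ (Set.mem_insert x {y})⟩

/-- `y` as an element of `ℚ(x, y)`. -/
noncomputable def pairSnd (x y : ℝ) : pairField x y :=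
  ⟨y, IntermediateField.subset_adjoin ℚ _ (Set.mem_insert_of_mem x rfl)⟩

variable {x y : ℝ} {r : ℕ}

/-- The least `a` such that `M(x)` and `M(y)` have entries in `ℤ[1/a]`. -/
noncomputable def pairDen (b : Basis (Fin r) ℚ (pairField x y)) : ℕ :=
  leastDen (multMatrix b (pairFst x y)) (multMatrix b (pairSnd x y))

/-- `M(x)` as a matrix over `ℤ[1/a]`. -/
noncomputable def matFst (b : Basis (Fin r) ℚ (pairField x y)) :
    Matrix (Fin r) (Fin r) (zInv (pairDen b)) :=
  Matrix.of fun j l => ⟨multMatrix b (pairFst x y) j l, ((leastDen_mem _ _).2 j l).1⟩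

/-- `M(y)` as a matrix over `ℤ[1/a]`. -/
noncomputable def matSnd (b : Basis (Fin r) ℚ (pairField x y)) :
    Matrix (Fin r) (Fin r) (zInv (pairDen b)) :=
  Matrix.of fun j l => ⟨multMatrix b (pairSnd x y) j l, ((leastDen_mem _ _).2 j l).2⟩

end Pairs

section Product

variable {k : ℕ} {lam mu : Fin k → ℝ} {r : Fin k → ℕ}

/-- The compact abelian group `Ω = ∏_i Ω_{a_i}^{r_i}`. -/
abbrev Omega (b : ∀ i, Basis (Fin (r i)) ℚ (pairField (lam i) (mu i))) : Type :=
  ∀ i, Solenoid (pairDen (b i)) (r i)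

/-- The semigroup `Σ = {(A_1^n B_1^m, …, A_k^n B_k^m) : m, n ∈ ℕ}` of self-maps of `Ω`, where
`A_i = M(λ_i)` and `B_i = M(μ_i)`. The identity, which is included here, preserves every set. -/
def SigmaAct (b : ∀ i, Basis (Fin (r i)) ℚ (pairField (lam i) (mu i))) :
    Set (Omega b → Omega b) :=
  {D | ∃ n m : ℕ, D = fun ω i => solenoidAct (matFst (b i) ^ n * matSnd (b i) ^ m) (ω i)}

end Product

/-! Reduction to one solenoid. The statement is proved for all powers `A ^ u`, `B ^ u` at once,
because this form passes to products. The projection of `F` to one factor contains a torsion point;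
torsion points are preperiodic, so the point can be moved along the orbit until it is periodic, and
the fibre of `F` over it is closed and invariant under further powers. Induction on the number of
factors finishes (`exists_forall_isOfFinAddOrder`).

One solenoid. The field `K = ℚ(λ, μ)` acts on `V = ℝ^r × ∏ ℚ_p^r`, and over `ℂ` and the algebraic
closures of the `ℚ_p` this action is diagonal, `α` scaling a coordinate by `|θ(α)|` for an embedding
`θ`. By minimality of `a`, every `p ∣ a` carries an embedding that is not integral on the pair; so
hyperbolicity applies at all places of `V`, and no coordinate is preserved in size by both `s = λ ^
u` and `t = μ ^ u`. Suppose that a closed invariant non-empty `E` contains no torsion.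

The differences fill the solenoid (`exists_sub_eq_of_no_torsion`). By compactness, two points on an
orbit in `E` differ by an arbitrarily small vector `d`. If neither `s` nor `t` expanded a coordinate
of `d`, the orbit would converge to a fixed point of a power of `st`, which is torsion. So `E - E`
contains small vectors with an expanded coordinate; blowing these up and passing to limits twice
yields `y ≠ 0` whose whole orbit `s ^ j t ^ k y` lies over `E - E`, and on whose coordinates `|t| =
|s| ^ c` with one exponent `c` (up to exchanging `s` and `t`). As `s` and `t` are multiplicatively
independent, there are `η = s ^ j t ^ k ≠ 1` close to `1` on these coordinates. From `q η ^ J y = q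
y + q (η ^ J - 1) y ≈ q y + J q (η - 1) y` one obtains `w ≠ 0`, living at one place of `ℚ` only,
such that `E - E` contains translates of the `ℕ[1/p]`-multiples of each `κ w`, `κ = s ^ i t ^ j`
(`exists_hasCosets`). Condition (3) and Gallai's theorem provide `κ` for which finitely many given
characters are non-trivial on suitable `κ w / p ^ v`, and a criterion of Weyl type
(`eq_univ_of_progressions`) gives `E - E = Ω`.

From differences to `E` (`exists_isOfFinAddOrder_mem`). If `τ` is fixed by the pair, then `τ = e -
e'` with `e, e' ∈ E`, so `E ∩ (E - τ)` is non-empty, and it is again closed, invariant and free of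
torsion. By iteration, `E` contains a translate of any finite set of such `τ`. For a large prime `N`
the `N`-torsion points are fixed by powers of the pair, and they detect finitely many given
characters; by Weyl's criterion again `E = Ω`, which contains the torsion point `0`. -/

open Filter Topology

/-! ### Vector spaces with diagonalised field action: limits of expanded vectors -/

/-- A family of absolute values `a i` of `K` and of seminorms `n i` on a `K`-module `V`, such that
`n i (α • x) = a i α * n i x` and such that the seminorms `n i` together define the topology. -/
structure CoordSystem (K V ι : Type*) [Field K] [NormedAddCommGroup V] [Module K V]
    [Fintype ι] where
  a : ι → AbsoluteValue K ℝ
  n : ι → AddGroupSeminorm V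
  n_smul : ∀ i α x, n i (α • x) = a i α * n i x
  C : ℝ
  C_pos : 0 < C
  n_le : ∀ i x, n i x ≤ C * ‖x‖
  le_n : ∀ x, ‖x‖ ≤ C * ∑ i, n i x

namespace CoordSystem

variable {K V ι : Type*} [Field K] [NormedAddCommGroup V] [Module K V] [Fintype ι]
  (S : CoordSystem K V ι)

theorem continuous_n (i : ι) : Continuous (S.n i) := by
  rw [Metric.continuous_iff]
  intro x ε hε
  refine ⟨ε / S.C, div_pos hε S.C_pos, fun y hy => ?_⟩
  rw [dist_eq_norm] at hy
  rw [Real.dist_eq]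
  calc |S.n i y - S.n i x| ≤ S.n i (y - x) := abs_sub_map_le_sub (S.n i) y x
    _ ≤ S.C * ‖y - x‖ := S.n_le _ _
    _ < S.C * (ε / S.C) := by have := S.C_pos; gcongr
    _ = ε := by have := S.C_pos; field_simp

theorem eq_zero_of_n {x : V} (h : ∀ i, S.n i x = 0) : x = 0 := by
  have := S.le_n x
  simp only [h, Finset.sum_const_zero, mul_zero] at this
  exact norm_le_zero_iff.1 this

theorem exists_n_ne_zero {x : V} (h : x ≠ 0) : ∃ i, S.n i x ≠ 0 := by
  by_contra! h'
  exact h (S.eq_zero_of_n h')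

theorem n_nonneg (i : ι) (x : V) : 0 ≤ S.n i x := apply_nonneg _ _

theorem n_pos {i : ι} {x : V} (h : S.n i x ≠ 0) : 0 < S.n i x :=
  lt_of_le_of_ne (S.n_nonneg i x) (Ne.symm h)

theorem norm_le_of_n_le {x : V} {B : ℝ} (h : ∀ i, S.n i x ≤ B) :
    ‖x‖ ≤ S.C * (Fintype.card ι * B) := by
  refine (S.le_n x).trans ?_
  have := S.C_pos
  gcongr
  refine (Finset.sum_le_sum fun i _ => h i).trans ?_
  simp

theorem tendsto_zero {β : Type*} {l : Filter β} {x : β → V}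
    (h : ∀ i, Tendsto (fun k => S.n i (x k)) l (𝓝 0)) : Tendsto x l (𝓝 0) := by
  have h1 : Tendsto (fun k => S.C * ∑ i, S.n i (x k)) l (𝓝 0) := by
    have := (tendsto_finsetSum Finset.univ fun i _ => h i).const_mul S.C
    simpa using this
  exact squeeze_zero_norm (fun k => S.le_n _) h1

theorem exists_subseq [ProperSpace V] {x : ℕ → V} {B : ℝ} (h : ∀ i k, S.n i (x k) ≤ B) :
    ∃ (y : V) (φ : ℕ → ℕ), StrictMono φ ∧ Tendsto (x ∘ φ) atTop (𝓝 y) := by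
  obtain ⟨y, -, φ, hφ, hy⟩ := tendsto_subseq_of_bounded
    (Metric.isBounded_closedBall (x := (0 : V)) (r := S.C * (Fintype.card ι * B)))
    (x := x) (fun k => by simpa using S.norm_le_of_n_le fun i => h i k)
  exact ⟨y, φ, hφ, hy⟩

theorem n_zpow (i : ι) (s t : K) (j k : ℤ) (x : V) :
    S.n i ((s ^ j * t ^ k) • x) = S.a i s ^ j * S.a i t ^ k * S.n i x := by
  rw [S.n_smul, map_mul, map_zpow₀, map_zpow₀]

theorem tendsto_n_ne_zero {β : Type*} {l : Filter β} [l.NeBot] {x : β → V} {y : V} {i : ι}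
    (h : Tendsto x l (𝓝 y)) {c : ℝ} (hc : 0 < c) (hn : ∀ᶠ k in l, c ≤ S.n i (x k)) :
    S.n i y ≠ 0 := by
  have := ge_of_tendsto (((S.continuous_n i).tendsto y).comp h) hn
  exact (hc.trans_le this).ne'

variable [ContinuousConstSMul K V]

/-- Expanding small vectors by the powers of `s` until they leave the unit ball. -/
theorem exists_limit_of_expanding [ProperSpace V] {D : Set V} (hD : IsClosed D) {s t : K}
    (hs0 : s ≠ 0) (hs : ∀ x ∈ D, s • x ∈ D) (ht : ∀ x ∈ D, t • x ∈ D)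
    (h : ∀ ε > 0, ∃ d ∈ D, ‖d‖ < ε ∧ ∃ i, S.n i d ≠ 0 ∧ 1 < S.a i s) :
    ∃ y : V, y ≠ 0 ∧ (∀ i, S.n i y ≠ 0 → 1 < S.a i s) ∧
      ∀ (j : ℤ) (m : ℕ), (s ^ j * t ^ m) • y ∈ D := by
  classical
  set U : Finset ι := Finset.univ.filter fun i => 1 < S.a i s with hU
  set N : V → ℝ := fun x => ∑ i ∈ U, S.n i x with hN
  have hNc : Continuous N := continuous_finsetSum _ fun i _ => S.continuous_n i
  have hN0 : N 0 = 0 := by simp [hN]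
  have hspow : ∀ (m : ℕ) x, x ∈ D → s ^ m • x ∈ D := by
    intro m
    induction m with
    | zero => intro x hx; simpa using hx
    | succ m ih => intro x hx; rw [pow_succ, mul_smul]; exact ih _ (hs _ hx)
  have htpow : ∀ (m : ℕ) x, x ∈ D → t ^ m • x ∈ D := by
    intro m
    induction m with
    | zero => intro x hx; simpa using hx
    | succ m ih => intro x hx; rw [pow_succ, mul_smul]; exact ih _ (ht _ hx)
  -- The images under `s ^ 0, …, s ^ k` stay in `N < 1`, so the exit time `m k` below exceeds `k`.
  -- This makes negative powers of `s` available in the limit.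
  have key : ∀ k : ℕ, ∃ d ∈ D, ‖d‖ < 1 / (k + 1 : ℝ) ∧ (∃ i, S.n i d ≠ 0 ∧ 1 < S.a i s) ∧
      ∀ j ∈ Finset.range (k + 1), N (s ^ j • d) < 1 := by
    intro k
    have hop : ∀ᶠ x in 𝓝 (0 : V), ∀ j ∈ Finset.range (k + 1), N (s ^ j • x) < 1 := by
      rw [Finset.eventually_all]
      intro j _
      have : Tendsto (fun x : V => N (s ^ j • x)) (𝓝 0) (𝓝 0) := by
        have := (hNc.comp (continuous_const_smul (s ^ j))).tendsto (0 : V)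
        simpa [hN0, Function.comp_def] using this
      exact this.eventually_lt_const one_pos
    obtain ⟨ε, hε, hball⟩ := Metric.eventually_nhds_iff.1 hop
    obtain ⟨d, hd, hdε, hi⟩ := h (min ε (1 / (k + 1 : ℝ))) (lt_min hε (by positivity))
    exact ⟨d, hd, hdε.trans_le (min_le_right _ _), hi,
      hball (by simpa using hdε.trans_le (min_le_left _ _))⟩
  choose d hdD hdn hdi hdN using key
  have hexit : ∀ k, ∃ m, 1 ≤ N (s ^ m • d k) := by
    intro k
    obtain ⟨i, hi, hi1⟩ := hdi k
    have hpos := S.n_pos hi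
    obtain ⟨m, hm⟩ := ((tendsto_pow_atTop_atTop_of_one_lt hi1).eventually_ge_atTop
      (1 / S.n i (d k))).exists
    refine ⟨m, ?_⟩
    have : 1 ≤ S.n i (s ^ m • d k) := by
      rw [S.n_smul, map_pow]
      rwa [div_le_iff₀ hpos] at hm
    refine this.trans ?_
    exact Finset.single_le_sum (f := fun i => S.n i (s ^ m • d k)) (fun i _ => S.n_nonneg _ _)
      (by simp [hU, hi1])
  let m : ℕ → ℕ := fun k => Nat.find (hexit k)
  have hm1 : ∀ k, 1 ≤ N (s ^ m k • d k) := fun k => Nat.find_spec (hexit k)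
  have hmk : ∀ k, k < m k := by
    intro k
    by_contra! hle
    exact absurd (hm1 k) (not_le.2 (hdN k (m k) (by simpa using Nat.lt_succ_of_le hle)))
  have hm2 : ∀ k, N (s ^ (m k - 1) • d k) < 1 := by
    intro k
    have := Nat.find_min (hexit k) (m := m k - 1) (Nat.sub_lt (by have := hmk k; omega) one_pos)
    exact not_le.1 this
  have hdn' : ∀ k, ‖d k‖ ≤ 1 := fun k => (hdn k).le.trans (by
    rw [div_le_one (by positivity)]; linarith [(Nat.cast_nonneg k : (0:ℝ) ≤ k)])
  have hnotU : ∀ i, ¬ 1 < S.a i s → ∀ k, S.n i (s ^ m k • d k) ≤ S.C * (1 / (k + 1 : ℝ)) := by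
    intro i hi k
    rw [S.n_smul, map_pow]
    calc S.a i s ^ m k * S.n i (d k) ≤ 1 * S.n i (d k) := by
          have := S.n_nonneg i (d k)
          gcongr
          exact pow_le_one₀ (apply_nonneg _ _) (not_lt.1 hi)
      _ ≤ S.C * (1 / (k + 1 : ℝ)) := by
          rw [one_mul]
          refine (S.n_le _ _).trans ?_
          have := S.C_pos
          gcongr
          exact (hdn k).le
  have hB : ∀ i k, S.n i (s ^ m k • d k) ≤ S.C + ∑ i, S.a i s := by
    intro i k
    have hsum : 0 ≤ ∑ i, S.a i s := Finset.sum_nonneg fun i _ => apply_nonneg _ _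
    by_cases hi : 1 < S.a i s
    · have e : s ^ m k = s * s ^ (m k - 1) := by
        rw [← pow_succ', Nat.sub_add_cancel (by have := hmk k; omega)]
      rw [e, mul_smul, S.n_smul]
      have h1 : S.n i (s ^ (m k - 1) • d k) ≤ 1 :=
        (Finset.single_le_sum (f := fun i => S.n i (s ^ (m k - 1) • d k))
          (fun i _ => S.n_nonneg _ _) (by simp [hU, hi])).trans (hm2 k).le
      have h2 : S.a i s ≤ ∑ i, S.a i s :=
        Finset.single_le_sum (f := fun i => S.a i s) (fun i _ => apply_nonneg _ _)
          (Finset.mem_univ i)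
      have := S.C_pos
      nlinarith [apply_nonneg (S.a i) s]
    · refine (hnotU i hi k).trans ?_
      have : 1 / (k + 1 : ℝ) ≤ 1 := by
        rw [div_le_one (by positivity)]; linarith [(Nat.cast_nonneg k : (0:ℝ) ≤ k)]
      nlinarith [S.C_pos]
  obtain ⟨y, φ, hφ, hy⟩ := S.exists_subseq hB
  refine ⟨y, ?_, ?_, ?_⟩
  · rintro rfl
    have := ge_of_tendsto ((hNc.tendsto _).comp hy) (Eventually.of_forall fun k => hm1 (φ k))
    rw [hN0] at this
    linarith
  · intro i hi
    by_contra hi1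
    have h1 : Tendsto (fun k => S.n i (s ^ m (φ k) • d (φ k))) atTop (𝓝 (S.n i y)) :=
      ((S.continuous_n i).tendsto y).comp hy
    have h2 : Tendsto (fun k => S.C * (1 / ((φ k : ℕ) + 1 : ℝ))) atTop (𝓝 0) := by
      have := (tendsto_one_div_add_atTop_nhds_zero_nat (𝕜 := ℝ)).comp hφ.tendsto_atTop
      simpa using this.const_mul S.C
    exact hi (le_antisymm (le_of_tendsto_of_tendsto' h1 h2 fun k => hnotU i hi1 (φ k))
      (S.n_nonneg _ _))
  · intro j l
    refine hD.mem_of_tendsto ((continuous_const_smul (s ^ j * t ^ l)).tendsto y |>.comp hy) ?_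
    -- Since `m (φ k) > k ≥ |j|`, the exponent `j + m (φ k)` is a natural number and forward
    -- invariance of `D` is enough.
    filter_upwards [eventually_ge_atTop j.natAbs] with k hk
    have h1 : k ≤ φ k := hφ.id_le k
    have h2 := hmk (φ k)
    obtain ⟨q, hq⟩ : ∃ q : ℕ, (q : ℤ) = j + m (φ k) := ⟨(j + m (φ k)).toNat, by omega⟩
    have : (s ^ j * t ^ l) • s ^ m (φ k) • d (φ k) = t ^ l • s ^ q • d (φ k) := by
      rw [smul_smul, smul_smul]
      congr 1
      rw [← zpow_natCast s q, hq, zpow_add₀ hs0, zpow_natCast]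
      ring
    simp only [Function.comp]
    rw [this]
    exact htpow _ _ (hspow _ _ (hdD _))

/-- As `y = x ^ c`, the product is `x` to the power of the fractional part of `m * c`. -/
theorem zpow_floor_bounds {x y c : ℝ} (hx : 1 < x) (hy : 0 < y)
    (hc : Real.log y = c * Real.log x) (m : ℤ) :
    1 ≤ x ^ (-⌊m * c⌋) * y ^ m ∧ x ^ (-⌊m * c⌋) * y ^ m ≤ x := by
  have hx0 : 0 < x := one_pos.trans hx
  have hl := Real.log_pos hx
  have e : x ^ (-⌊m * c⌋) * y ^ m = Real.exp (Int.fract (m * c) * Real.log x) := by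
    rw [← Real.exp_log (show 0 < x ^ (-⌊m * c⌋) * y ^ m by positivity),
      Real.log_mul (by positivity) (by positivity), Real.log_zpow, Real.log_zpow, hc, Int.fract]
    push_cast
    ring_nf
  rw [e]
  constructor
  · exact Real.one_le_exp (mul_nonneg (Int.fract_nonneg _) hl.le)
  · calc _ ≤ Real.exp (1 * Real.log x) := by
          gcongr
          exact (Int.fract_lt_one _).le
      _ = x := by rw [one_mul, Real.exp_log hx0]

/-- Moving along the line where the coordinates of largest slope stay bounded. -/
theorem exists_limit_of_slope [ProperSpace V] {D : Set V} (hD : IsClosed D) {s t : K}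
    (hs0 : s ≠ 0) (ht0 : t ≠ 0) {y : V} (hy0 : y ≠ 0) (hys : ∀ i, S.n i y ≠ 0 → 1 < S.a i s)
    (hyD : ∀ (j : ℤ) (m : ℕ), (s ^ j * t ^ m) • y ∈ D) :
    ∃ z : V, z ≠ 0 ∧ ∃ c : ℝ, (∀ i, S.n i z ≠ 0 → 1 < S.a i s ∧
      Real.log (S.a i t) = c * Real.log (S.a i s)) ∧
      ∀ j k : ℤ, (s ^ j * t ^ k) • z ∈ D := by
  classical
  have hat : ∀ i, 0 < S.a i t := fun i => (S.a i).pos ht0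
  set sl : ι → ℝ := fun i => Real.log (S.a i t) / Real.log (S.a i s) with hsl
  obtain ⟨i1, hi1⟩ := S.exists_n_ne_zero hy0
  obtain ⟨i0, hi0, hmax⟩ := Finset.exists_max_image
    (Finset.univ.filter fun i => S.n i y ≠ 0) sl ⟨i1, by simpa using hi1⟩
  simp only [Finset.mem_filter, Finset.mem_univ, true_and] at hi0 hmax
  set c := sl i0 with hc
  have hlog : ∀ i, S.n i y ≠ 0 → Real.log (S.a i t) = sl i * Real.log (S.a i s) := by
    intro i hi
    have := Real.log_pos (hys i hi)
    simp only [hsl]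
    field_simp
  -- The power of `s` cancels the growth of `t ^ m` at the largest slope `c`: coordinates of slope
  -- `c` stay bounded above and below, those of smaller slope decay exponentially.
  let w : ℕ → V := fun m => (s ^ (-⌊((m : ℤ) : ℝ) * c⌋) * t ^ (m : ℤ)) • y
  have hwn : ∀ i m, S.n i (w m) =
      S.a i s ^ (-⌊((m : ℤ) : ℝ) * c⌋) * S.a i t ^ (m : ℤ) * S.n i y :=
    fun i m => S.n_zpow _ _ _ _ _ _
  have hle : ∀ i, S.n i y ≠ 0 → ∀ m : ℕ, S.n i (w m) ≤
      Real.exp (Real.log (S.a i s) + m * ((sl i - c) * Real.log (S.a i s))) * S.n i y := by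
    intro i hi m
    have h1 := hys i hi
    have h0 : 0 < S.a i s := one_pos.trans h1
    have hl := Real.log_pos h1
    rw [hwn]
    have := S.n_nonneg i y
    have := hat i
    gcongr
    rw [← Real.exp_log (show 0 < S.a i s ^ (-⌊((m : ℤ) : ℝ) * c⌋) * S.a i t ^ (m : ℤ) by
      positivity)]
    gcongr
    rw [Real.log_mul (by positivity) (by positivity), Real.log_zpow, Real.log_zpow, hlog i hi]
    have hf := Int.lt_floor_add_one (((m : ℤ) : ℝ) * c)
    push_cast at hf ⊢
    nlinarith
  have hbd : ∀ i m, S.n i (w m) ≤ ∑ i, Real.exp (Real.log (S.a i s)) * S.n i y := by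
    intro i m
    have hnn : ∀ j ∈ Finset.univ, 0 ≤ Real.exp (Real.log (S.a j s)) * S.n j y :=
      fun j _ => mul_nonneg (Real.exp_pos _).le (S.n_nonneg _ _)
    by_cases hi : S.n i y = 0
    · rw [hwn, hi, mul_zero]; exact Finset.sum_nonneg hnn
    · refine le_trans ((hle i hi m).trans ?_) (Finset.single_le_sum hnn (Finset.mem_univ i))
      have := S.n_nonneg i y
      gcongr
      have h1 := Real.log_pos (hys i hi)
      have h2 := hmax i hi
      have h3 : ((m : ℕ) : ℝ) * ((sl i - c) * Real.log (S.a i s)) ≤ 0 :=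
        mul_nonpos_of_nonneg_of_nonpos (Nat.cast_nonneg _)
          (mul_nonpos_of_nonpos_of_nonneg (by linarith) h1.le)
      linarith
  obtain ⟨z, φ, hφ, hz⟩ := S.exists_subseq hbd
  have hzn : ∀ i, Tendsto (fun k => S.n i (w (φ k))) atTop (𝓝 (S.n i z)) :=
    fun i => ((S.continuous_n i).tendsto z).comp hz
  have hz0 : S.n i0 z ≠ 0 := by
    refine S.tendsto_n_ne_zero hz (S.n_pos hi0) (Eventually.of_forall fun k => ?_)
    simp only [Function.comp]
    rw [hwn]
    have := (zpow_floor_bounds (hys i0 hi0) (hat i0) (hlog i0 hi0) (φ k)).1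
    have h2 := S.n_nonneg i0 y
    nlinarith
  have hsupp : ∀ i, S.n i z ≠ 0 → S.n i y ≠ 0 ∧ sl i = c := by
    intro i hi
    have hiy : S.n i y ≠ 0 := by
      intro h0
      have : ∀ k, S.n i (w (φ k)) = 0 := fun k => by rw [hwn, h0, mul_zero]
      have h3 := hzn i
      simp only [this] at h3
      exact hi (tendsto_nhds_unique h3 tendsto_const_nhds)
    refine ⟨hiy, ?_⟩
    by_contra hne
    have hlt : sl i - c < 0 := sub_neg.2 (lt_of_le_of_ne (hmax i hiy) hne)
    have hl := Real.log_pos (hys i hiy)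
    have h4 : Tendsto (fun k : ℕ => Real.exp (Real.log (S.a i s) +
        (φ k : ℕ) * ((sl i - c) * Real.log (S.a i s))) * S.n i y) atTop (𝓝 0) := by
      have h5 : Tendsto (fun k : ℕ => Real.log (S.a i s) +
        (φ k : ℕ) * ((sl i - c) * Real.log (S.a i s))) atTop atBot := by
        refine tendsto_atBot_add_const_left _ _ ?_
        refine Tendsto.atTop_mul_const_of_neg (mul_neg_of_neg_of_pos hlt hl) ?_
        exact tendsto_natCast_atTop_atTop.comp hφ.tendsto_atTop
      simpa using (Real.tendsto_exp_atBot.comp h5).mul_const (S.n i y)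
    exact hi (le_antisymm (le_of_tendsto_of_tendsto' (hzn i) h4 fun k => hle i hiy (φ k))
      (S.n_nonneg _ _))
  refine ⟨z, fun h => hz0 (by rw [h]; exact map_zero _), c, ?_, ?_⟩
  · intro i hi
    obtain ⟨h1, h2⟩ := hsupp i hi
    exact ⟨hys i h1, by rw [hlog i h1, h2]⟩
  · intro j k
    refine hD.mem_of_tendsto ((continuous_const_smul (s ^ j * t ^ k)).tendsto z |>.comp hz) ?_
    filter_upwards [eventually_ge_atTop k.natAbs] with l hl
    have h1 : l ≤ φ l := hφ.id_le l
    obtain ⟨q, hq⟩ : ∃ q : ℕ, (q : ℤ) = k + φ l := ⟨(k + φ l).toNat, by omega⟩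
    simp only [Function.comp, w]
    rw [smul_smul]
    have : s ^ j * t ^ k * (s ^ (-⌊((φ l : ℤ) : ℝ) * c⌋) * t ^ (φ l : ℤ)) =
        s ^ (j + -⌊((φ l : ℤ) : ℝ) * c⌋) * t ^ q := by
      rw [← zpow_natCast t q, hq, zpow_add₀ hs0, zpow_add₀ ht0]
      ring
    rw [this]
    exact hyD _ _

/-- On the coordinates of `z` the elements `s ^ (-⌊m c⌋) * t ^ m` have absolute values between `1`
and `a i s`. So their multiples of `z` have a convergent subsequence, and quotients of successive
terms of it approach `1`; these differ from `1` because the exponent of `t` is positive. -/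
theorem exists_zpow_near_one [ProperSpace V] {s t : K}
    (hs0 : s ≠ 0) (ht0 : t ≠ 0) (hst : ∀ j k : ℤ, s ^ j * t ^ k = 1 → k = 0) {z : V} {c : ℝ}
    (hz : ∀ i, S.n i z ≠ 0 → 1 < S.a i s ∧ Real.log (S.a i t) = c * Real.log (S.a i s))
    {ε : ℝ} (hε : 0 < ε) :
    ∃ j k : ℤ, s ^ j * t ^ k ≠ 1 ∧ ∀ i, S.n i z ≠ 0 → S.a i (s ^ j * t ^ k - 1) < ε := by
  classical
  have hat : ∀ i, 0 < S.a i t := fun i => (S.a i).pos ht0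
  let α : ℕ → K := fun m => s ^ (-⌊((m : ℤ) : ℝ) * c⌋) * t ^ (m : ℤ)
  have hα : ∀ i m, S.n i z ≠ 0 → 1 ≤ S.a i (α m) ∧ S.a i (α m) ≤ S.a i s := by
    intro i m hi
    simp only [α, map_mul, map_zpow₀]
    exact zpow_floor_bounds (hz i hi).1 (hat i) (hz i hi).2 m
  have hbd : ∀ i m, S.n i (α m • z) ≤ ∑ i, S.a i s * S.n i z := by
    intro i m
    have hnn : ∀ j ∈ Finset.univ, 0 ≤ S.a j s * S.n j z :=
      fun j _ => mul_nonneg (apply_nonneg _ _) (S.n_nonneg _ _)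
    rw [S.n_smul]
    by_cases hi : S.n i z = 0
    · rw [hi, mul_zero]; exact Finset.sum_nonneg hnn
    · refine le_trans ?_ (Finset.single_le_sum hnn (Finset.mem_univ i))
      have := S.n_nonneg i z
      gcongr
      exact (hα i m hi).2
  obtain ⟨y, φ, hφ, hy⟩ := S.exists_subseq hbd
  have hdiff : Tendsto (fun l => α (φ (l + 1)) • z - α (φ l) • z) atTop (𝓝 0) := by
    simpa using (hy.comp (tendsto_add_atTop_nat 1)).sub hy
  have hev : ∀ᶠ l in atTop, ∀ i, S.n i z ≠ 0 →
      S.n i (α (φ (l + 1)) • z - α (φ l) • z) < ε * S.n i z := by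
    rw [eventually_all]
    intro i
    by_cases hi : S.n i z = 0
    · simp [hi]
    · have h1 : Tendsto (fun l => S.n i (α (φ (l + 1)) • z - α (φ l) • z)) atTop (𝓝 0) := by
        have h0 : S.n i 0 = 0 := map_zero _
        have := ((S.continuous_n i).tendsto 0).comp hdiff
        rwa [h0] at this
      filter_upwards [h1.eventually_lt_const (mul_pos hε (S.n_pos hi))] with l hl _ using hl
  obtain ⟨l, hl⟩ := hev.exists
  have hlt : φ l < φ (l + 1) := hφ (Nat.lt_succ_self l)
  have hα0 : ∀ m, α m ≠ 0 := fun m => mul_ne_zero (zpow_ne_zero _ hs0) (zpow_ne_zero _ ht0)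
  have hquot : s ^ (-⌊((φ (l + 1) : ℤ) : ℝ) * c⌋ + ⌊((φ l : ℤ) : ℝ) * c⌋) *
      t ^ ((φ (l + 1) : ℤ) - φ l) = α (φ (l + 1)) / α (φ l) := by
    simp only [α]
    rw [zpow_add₀ hs0, zpow_sub₀ ht0, zpow_neg s ⌊((φ l : ℤ) : ℝ) * c⌋]
    have := zpow_ne_zero ⌊((φ l : ℤ) : ℝ) * c⌋ hs0
    have := zpow_ne_zero (φ l : ℤ) ht0
    field_simp
  refine ⟨-⌊((φ (l + 1) : ℤ) : ℝ) * c⌋ + ⌊((φ l : ℤ) : ℝ) * c⌋, (φ (l + 1) : ℤ) - φ l, ?_, ?_⟩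
  · intro h1
    have := hst _ _ h1
    omega
  · intro i hi
    rw [hquot]
    have e : α (φ (l + 1)) / α (φ l) - 1 = (α (φ (l + 1)) - α (φ l)) / α (φ l) := by
      have := hα0 (φ l)
      field_simp
    have h1 := hl i hi
    rw [← sub_smul, S.n_smul] at h1
    have h2 := lt_of_mul_lt_mul_right h1 (S.n_nonneg i z)
    rw [e, map_div₀]
    exact (div_le_self (apply_nonneg _ _) (hα i _ hi).1).trans_lt h2

end CoordSystem

/-! ### Dynamics on a compact quotient -/

section QuotientDynamics

variable {K V : Type*} [Field K] [NormedAddCommGroup V] [Module K V] {G : AddSubgroup V}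

/-- In a compact quotient `V ⧸ G`, some difference of two members of a sequence has a small lift. -/
theorem exists_small_difference [CompactSpace (V ⧸ G)] (x : ℕ → V ⧸ G) {ε : ℝ} (hε : 0 < ε) :
    ∃ (i j : ℕ) (d : V), i < j ∧ ‖d‖ < ε ∧ x j = x i + (d : V ⧸ G) := by
  obtain ⟨y, hy⟩ := exists_clusterPt_of_compactSpace (map x atTop)
  obtain ⟨Y, rfl⟩ := QuotientAddGroup.mk_surjective y
  have hO : (QuotientAddGroup.mk '' Metric.ball Y (ε / 2) : Set (V ⧸ G)) ∈
      𝓝 (Y : V ⧸ G) :=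
    QuotientAddGroup.isOpenMap_coe.image_mem_nhds (Metric.ball_mem_nhds _ (half_pos hε))
  have hfr : ∃ᶠ n in atTop, x n ∈ (QuotientAddGroup.mk '' Metric.ball Y (ε / 2) : Set (V ⧸ G)) :=
    (mapClusterPt_iff_frequently.1 hy) _ hO
  obtain ⟨i, -, a, ha, hai⟩ := (frequently_atTop.1 hfr) 0
  obtain ⟨j, hj, b, hb, hbj⟩ := (frequently_atTop.1 hfr) (i + 1)
  refine ⟨i, j, b - a, by omega, ?_, ?_⟩
  · rw [Metric.mem_ball, dist_eq_norm] at ha hb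
    calc ‖b - a‖ = ‖(b - Y) - (a - Y)‖ := by congr 1; abel
      _ ≤ ‖b - Y‖ + ‖a - Y‖ := norm_sub_le _ _
      _ < ε := by linarith
  · rw [← hai, ← hbj, ← QuotientAddGroup.mk_add, add_sub_cancel]

theorem iterate_quotient {f : V ⧸ G →+ V ⧸ G} {s : K}
    (hf : ∀ x : V, f (x : V ⧸ G) = ((s • x : V) : V ⧸ G)) (n : ℕ) (x : V) :
    f^[n] (x : V ⧸ G) = ((s ^ n • x : V) : V ⧸ G) := by
  induction n with
  | zero => simp
  | succ n ih => rw [Function.iterate_succ_apply', ih, hf, smul_smul, pow_succ']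

/-- The vector `(h - 1) • x` lies in `G`, and by `hG` multiplication by `(h - 1)⁻¹` maps `G` into
`G` up to a bounded denominator. -/
theorem isOfFinAddOrder_of_fixed
    (hG : ∀ κ : K, ∃ m : ℕ, 0 < m ∧ ∀ γ ∈ G, m • κ • γ ∈ G) {h : K} (h1 : h ≠ 1) {x : V}
    (hx : ((h • x : V) : V ⧸ G) = x) : IsOfFinAddOrder (x : V ⧸ G) := by
  have hmem : (h - 1) • x ∈ G := by
    rw [sub_smul, one_smul, ← QuotientAddGroup.eq_zero_iff, QuotientAddGroup.mk_sub, hx, sub_self]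
  obtain ⟨m, hm, hmG⟩ := hG (h - 1)⁻¹
  have := hmG _ hmem
  rw [smul_smul, inv_mul_cancel₀ (sub_ne_zero.2 h1), one_smul] at this
  refine isOfFinAddOrder_iff_nsmul_eq_zero.2 ⟨m, hm, ?_⟩
  rw [← QuotientAddGroup.mk_nsmul]
  exact (QuotientAddGroup.eq_zero_iff _).2 this

/-- Two iterates differ by a vector `d` so small that `m • d`, an element of `G`, must vanish by
discreteness. -/
theorem exists_iterate_eq_of_isOfFinAddOrder [CharZero K] [CompactSpace (V ⧸ G)]
    (hdisc : ∃ ε > 0, ∀ γ ∈ G, ‖γ‖ < ε → γ = 0) (f : V ⧸ G →+ V ⧸ G) {x : V ⧸ G}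
    (hx : IsOfFinAddOrder x) : ∃ i j : ℕ, i < j ∧ f^[j] x = f^[i] x := by
  obtain ⟨ε, hε, hdisc⟩ := hdisc
  obtain ⟨m, hm, hmx⟩ := isOfFinAddOrder_iff_nsmul_eq_zero.1 hx
  have hm' : (0 : ℝ) < m := by exact_mod_cast hm
  have hit : ∀ i, m • f^[i] x = 0 := by
    intro i
    induction i with
    | zero => exact hmx
    | succ i ih => rw [Function.iterate_succ_apply', ← map_nsmul, ih, map_zero]
  obtain ⟨i, j, d, hij, hd, h⟩ := exists_small_difference (fun n => f^[n] x) (div_pos hε hm')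
  refine ⟨i, j, hij, ?_⟩
  have h0 : ((m • d : V) : V ⧸ G) = 0 := by
    have := congrArg (fun y => m • y) h
    simp only [nsmul_add, hit, zero_add] at this
    rw [QuotientAddGroup.mk_nsmul, ← this]
  have h1 : m • d = 0 := by
    refine hdisc _ ((QuotientAddGroup.eq_zero_iff _).1 h0) ?_
    calc ‖m • d‖ ≤ m * ‖d‖ := norm_nsmul_le
      _ < m * (ε / m) := by gcongr
      _ = ε := by field_simp
  have hd0 : d = 0 := by
    rw [← Nat.cast_smul_eq_nsmul K, smul_eq_zero] at h1
    exact h1.resolve_left (by exact_mod_cast hm.ne')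
  simpa [hd0] using h

variable {ι : Type*} [Fintype ι] (S : CoordSystem K V ι) [ContinuousConstSMul K V]

/-- If neither `s` nor `t` expands the small difference `d` of two points of an `st`-orbit,
hyperbolicity makes `q = (st) ^ (k + 1)` contract it strictly. Then the `q`-orbit converges to a
fixed point of `q`, a torsion point of `E`. -/
theorem exists_expanding_difference [CompactSpace (V ⧸ G)]
    (hG : ∀ κ : K, ∃ m : ℕ, 0 < m ∧ ∀ γ ∈ G, m • κ • γ ∈ G) {s t : K}
    (hst : ∀ j k : ℤ, s ^ j * t ^ k = 1 → j = 0 ∧ k = 0)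
    (hhyp : ∀ i, S.a i s ≠ 1 ∨ S.a i t ≠ 1) {f g : V ⧸ G →+ V ⧸ G}
    (hf : ∀ x : V, f (x : V ⧸ G) = ((s • x : V) : V ⧸ G))
    (hg : ∀ x : V, g (x : V ⧸ G) = ((t • x : V) : V ⧸ G)) {E : Set (V ⧸ G)} (hE : IsClosed E)
    (hne : E.Nonempty) (hfE : Set.MapsTo f E E) (hgE : Set.MapsTo g E E)
    (htors : ∀ x ∈ E, ¬ IsOfFinAddOrder x) {ε : ℝ} (hε : 0 < ε) :
    ∃ d : V, (∃ x ∈ E, ∃ y ∈ E, (d : V ⧸ G) = x - y) ∧ ‖d‖ < ε ∧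
      ∃ i, S.n i d ≠ 0 ∧ (1 < S.a i s ∨ 1 < S.a i t) := by
  obtain ⟨x, hx⟩ := hne
  set F : V ⧸ G →+ V ⧸ G := f.comp g with hF
  have hFq : ∀ x : V, F (x : V ⧸ G) = (((s * t) • x : V) : V ⧸ G) := by
    intro x
    simp only [hF, AddMonoidHom.comp_apply, hg, hf, smul_smul]
  have hFE : Set.MapsTo F E E := fun y hy => hfE (hgE hy)
  obtain ⟨i, j, d, hij, hd, h⟩ := exists_small_difference (fun n => F^[n] x) hε
  refine ⟨d, ⟨F^[j] x, hFE.iterate j hx, F^[i] x, hFE.iterate i hx, by simp [h]⟩, hd, ?_⟩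
  by_contra! hcon
  obtain ⟨k, rfl⟩ := Nat.exists_eq_add_of_lt hij
  set y := F^[i] x with hy
  have hyE : y ∈ E := hFE.iterate i hx
  set q : K := (s * t) ^ (k + 1) with hq
  have hq1 : q ≠ 1 := by
    intro h1
    have := (hst (k + 1 : ℕ) (k + 1 : ℕ) (by rw [zpow_natCast, zpow_natCast, ← mul_pow]; exact h1)).1
    omega
  obtain ⟨Y, hY⟩ := QuotientAddGroup.mk_surjective y
  have hyd : ((q • Y : V) : V ⧸ G) = y + d := by
    rw [← iterate_quotient hFq, hY, hy, ← Function.iterate_add_apply]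
    rw [show k + 1 + i = i + k + 1 by ring]
    exact h
  have h1q : (1 - q) ≠ 0 := sub_ne_zero.2 (Ne.symm hq1)
  -- Formally `d' = d + q d + q² d + ⋯`. From `q • Y = Y + d` modulo `G` it follows that `Y + d'` is
  -- fixed by `q`, and that `q ^ n • Y = Y + d' - q ^ n • d'` modulo `G`.
  set d' : V := (1 - q)⁻¹ • d with hd'
  have hdd : d + q • d' = d' := by
    have : (1 - q) • d' = d := by rw [hd', smul_smul, mul_inv_cancel₀ h1q, one_smul]
    rw [sub_smul, one_smul] at this
    nth_rewrite 1 [← this]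
    abel
  have hfix : ((q • (Y + d') : V) : V ⧸ G) = ((Y + d' : V) : V ⧸ G) := by
    rw [smul_add, QuotientAddGroup.mk_add, hyd, QuotientAddGroup.mk_add, hY]
    nth_rewrite 2 [← hdd]
    rw [QuotientAddGroup.mk_add]
    abel
  refine htors ((Y + d' : V) : V ⧸ G) ?_ (isOfFinAddOrder_of_fixed hG hq1 hfix)
  have hlim : Tendsto (fun n : ℕ => q ^ n • d') atTop (𝓝 0) := by
    refine S.tendsto_zero fun i => ?_
    by_cases hi : S.n i d = 0
    · have : ∀ n : ℕ, S.n i (q ^ n • d') = 0 := fun n => by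
        rw [hd', S.n_smul, S.n_smul, hi, mul_zero, mul_zero]
      simp [this]
    · obtain ⟨h1, h2⟩ := hcon i hi
      have hlt : S.a i q < 1 := by
        rw [hq, map_pow, map_mul]
        refine pow_lt_one₀ (mul_nonneg (apply_nonneg _ _) (apply_nonneg _ _)) ?_ (by omega)
        have n1 := apply_nonneg (S.a i) s
        have n2 := apply_nonneg (S.a i) t
        rcases hhyp i with h3 | h3
        · exact mul_lt_one_of_nonneg_of_lt_one_left n1 (lt_of_le_of_ne h1 h3) h2
        · rw [mul_comm]
          exact mul_lt_one_of_nonneg_of_lt_one_left n2 (lt_of_le_of_ne h2 h3) h1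
      have := (tendsto_pow_atTop_nhds_zero_of_lt_one (apply_nonneg (S.a i) q) hlt).mul_const
        (S.n i d')
      simpa [S.n_smul, map_pow] using this
  have hmem : ∀ n : ℕ, ((Y + d' - q ^ n • d' : V) : V ⧸ G) ∈ E := by
    intro n
    have : ((Y + d' - q ^ n • d' : V) : V ⧸ G) = ((q ^ n • Y : V) : V ⧸ G) := by
      have e : ((q ^ n • (Y + d') : V) : V ⧸ G) = ((Y + d' : V) : V ⧸ G) := by
        induction n with
        | zero => simp
        | succ n ih =>
          have h3 : F^[k + 1] ((q ^ n • (Y + d') : V) : V ⧸ G) =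
              F^[k + 1] ((Y + d' : V) : V ⧸ G) := by rw [ih]
          rw [iterate_quotient hFq, iterate_quotient hFq, ← hq, smul_smul, ← pow_succ'] at h3
          rw [h3, hfix]
      rw [QuotientAddGroup.mk_sub, ← e, smul_add, QuotientAddGroup.mk_add]
      abel
    rw [this, hq, ← pow_mul, ← iterate_quotient hFq, hY]
    exact hFE.iterate _ hyE
  refine hE.mem_of_tendsto (f := fun n : ℕ => ((Y + d' - q ^ n • d' : V) : V ⧸ G))
    (b := atTop) ?_ (Eventually.of_forall hmem)
  have h4 : Tendsto (fun n : ℕ => Y + d' - q ^ n • d') atTop (𝓝 (Y + d')) := by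
    simpa using (tendsto_const_nhds (x := Y + d')).sub hlim
  exact (QuotientAddGroup.continuous_mk.tendsto _).comp h4

/-- The first reduction: the preimage of a closed invariant set with small vectors that are expanded
contains the full orbit of a non-zero vector, all whose coordinates are expanded at proportional
rates. -/
theorem exists_proportional_orbit [ProperSpace V] {D : Set V} (hD : IsClosed D) {s t : K}
    (hs0 : s ≠ 0) (ht0 : t ≠ 0) (hs : ∀ x ∈ D, s • x ∈ D) (ht : ∀ x ∈ D, t • x ∈ D)
    (hst : ∀ j k : ℤ, s ^ j * t ^ k = 1 → j = 0 ∧ k = 0)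
    (h : ∀ ε > 0, ∃ d ∈ D, ‖d‖ < ε ∧ ∃ i, S.n i d ≠ 0 ∧ (1 < S.a i s ∨ 1 < S.a i t)) :
    ∃ (y : V) (s' : K), y ≠ 0 ∧ (∃ j k : ℤ, s' = s ^ j * t ^ k) ∧
      (∀ i, S.n i y ≠ 0 → 1 < S.a i s') ∧ (∀ j k : ℤ, (s ^ j * t ^ k) • y ∈ D) ∧
      ∀ ε > 0, ∃ j k : ℤ, s ^ j * t ^ k ≠ 1 ∧
        ∀ i, S.n i y ≠ 0 → S.a i (s ^ j * t ^ k - 1) < ε := by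
  have hor : (∀ ε > 0, ∃ d ∈ D, ‖d‖ < ε ∧ ∃ i, S.n i d ≠ 0 ∧ 1 < S.a i s) ∨
      (∀ ε > 0, ∃ d ∈ D, ‖d‖ < ε ∧ ∃ i, S.n i d ≠ 0 ∧ 1 < S.a i t) := by
    by_contra! hcon
    obtain ⟨⟨ε1, h1, h1'⟩, ε2, h2, h2'⟩ := hcon
    obtain ⟨d, hd, hdε, i, hi, hi1 | hi1⟩ := h (min ε1 ε2) (lt_min h1 h2)
    · exact absurd hi1 (not_lt.2 (h1' d hd (hdε.trans_le (min_le_left _ _)) i hi))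
    · exact absurd hi1 (not_lt.2 (h2' d hd (hdε.trans_le (min_le_right _ _)) i hi))
  rcases hor with h' | h'
  · obtain ⟨y, hy0, hys, hyD⟩ := S.exists_limit_of_expanding hD hs0 hs ht h'
    obtain ⟨z, hz0, c, hzc, hzD⟩ := S.exists_limit_of_slope hD hs0 ht0 hy0 hys hyD
    refine ⟨z, s, hz0, ⟨1, 0, by simp⟩, fun i hi => (hzc i hi).1, hzD, fun ε hε => ?_⟩
    exact S.exists_zpow_near_one hs0 ht0 (fun j k h => (hst j k h).2) hzc hε
  · obtain ⟨y, hy0, hys, hyD⟩ := S.exists_limit_of_expanding hD ht0 ht hs h'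
    obtain ⟨z, hz0, c, hzc, hzD⟩ := S.exists_limit_of_slope hD ht0 hs0 hy0 hys hyD
    refine ⟨z, t, hz0, ⟨0, 1, by simp⟩, fun i hi => (hzc i hi).1, fun j k => ?_, fun ε hε => ?_⟩
    · rw [mul_comm]; exact hzD k j
    · obtain ⟨j, k, hjk⟩ := S.exists_zpow_near_one ht0 hs0
        (fun j k h => (hst k j (by rwa [mul_comm])).1) hzc hε
      refine ⟨k, j, ?_⟩
      rw [mul_comm]
      exact hjk

end QuotientDynamics

/-! ### Error of the linear approximation of `(1 + u) ^ J` -/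

section AbsoluteValueEstimates

variable {K : Type*} [Field K]

theorem AbsoluteValue.natCast_le (a : AbsoluteValue K ℝ) (n : ℕ) : a (n : K) ≤ n := by
  induction n with
  | zero => simp
  | succ n ih =>
    push_cast
    refine (a.add_le _ _).trans ?_
    rw [map_one]
    linarith

/-- As a polynomial in `u` the left side has natural numbers as coefficients, so it is majorised by
its value at `a u`. -/
theorem AbsoluteValue.one_add_pow_sub_le (a : AbsoluteValue K ℝ) (u : K) (J : ℕ) :
    a ((1 + u) ^ J - 1 - J * u) ≤ (1 + a u) ^ J - 1 - J * a u := by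
  induction J with
  | zero => simp
  | succ J ih =>
    have e : (1 + u) ^ (J + 1) - 1 - ((J + 1 : ℕ) : K) * u =
        ((1 + u) ^ J - 1 - J * u) * (1 + u) + (J : K) * (u * u) := by
      push_cast; ring
    have hJ : a (J : K) ≤ J := a.natCast_le J
    have h1 : a (1 + u) ≤ 1 + a u := (a.add_le _ _).trans (by rw [map_one])
    have hu := apply_nonneg a u
    rw [e]
    calc _ ≤ a ((1 + u) ^ J - 1 - J * u) * a (1 + u) + a (J : K) * (a u * a u) := by
          refine (a.add_le _ _).trans ?_
          simp only [map_mul, le_refl]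
      _ ≤ ((1 + a u) ^ J - 1 - J * a u) * (1 + a u) + J * (a u * a u) := by
          have := apply_nonneg a ((1 + u) ^ J - 1 - J * u)
          have := apply_nonneg a (1 + u)
          gcongr
          linarith
      _ = _ := by push_cast; ring

theorem AbsoluteValue.one_add_pow_sub_le_sq (a : AbsoluteValue K ℝ) {u : K} {J : ℕ}
    (h : J * a u ≤ 1) : a ((1 + u) ^ J - 1 - J * u) ≤ (J * a u) * (J * a u) := by
  refine (a.one_add_pow_sub_le u J).trans ?_
  have hu := apply_nonneg a u
  have h1 : (1 + a u) ^ J ≤ Real.exp (J * a u) := by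
    rw [Real.exp_nat_mul]
    gcongr
    linarith [Real.add_one_le_exp (a u)]
  have h0 : 0 ≤ J * a u := by positivity
  have h2 := Real.abs_exp_sub_one_sub_id_le (x := J * a u) (by rw [abs_le]; constructor <;> linarith)
  have h3 := (abs_le.1 h2).2
  nlinarith

theorem AbsoluteValue.sum_le_of_nonarch (a : AbsoluteValue K ℝ)
    (hna : ∀ x y, a (x + y) ≤ max (a x) (a y)) {β : Type*} (s : Finset β) (f : β → K) {B : ℝ}
    (hB : 0 ≤ B) (h : ∀ i ∈ s, a (f i) ≤ B) : a (∑ i ∈ s, f i) ≤ B := by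
  classical
  induction s using Finset.induction_on with
  | empty => simpa using hB
  | insert i s hi ih =>
    rw [Finset.sum_insert hi]
    refine (hna _ _).trans (max_le (h i (Finset.mem_insert_self _ _)) (ih fun j hj => ?_))
    exact h j (Finset.mem_insert_of_mem hj)

/-- The point is the factor `a J` on the right, which makes the error small relative to `J * u`
however large `J` is. It comes from `(k + 2) * J.choose (k + 2) = J * (J - 1).choose (k + 1)`; the
loss `k + 2` is absorbed by the powers of `a u ≤ 1 / 2`. -/
theorem AbsoluteValue.one_add_pow_sub_le_of_nonarch [CharZero K] (a : AbsoluteValue K ℝ)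
    (hna : ∀ x y, a (x + y) ≤ max (a x) (a y)) (h1 : ∀ m : ℕ, a m ≤ 1)
    (hinv : ∀ m : ℕ, 0 < m → 1 ≤ m * a m) {u : K} (hu : a u ≤ 1 / 2) (J : ℕ) :
    a ((1 + u) ^ J - 1 - J * u) ≤ 2 * a u * (a J * a u) := by
  have hu0 := apply_nonneg a u
  have hJ0 := apply_nonneg a (J : K)
  rcases Nat.eq_zero_or_pos J with rfl | hJ
  · simp
  obtain ⟨n, rfl⟩ := Nat.exists_eq_succ_of_ne_zero hJ.ne'
  have hexp : (1 + u) ^ (n + 1) - 1 - ((n + 1 : ℕ) : K) * u =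
      ∑ k ∈ Finset.range n, u ^ (k + 2) * ((n + 1).choose (k + 2) : ℕ) := by
    rw [add_comm 1 u, add_pow, Finset.sum_range_succ', Finset.sum_range_succ']
    simp
    ring
  rw [Nat.succ_eq_add_one, hexp]
  refine a.sum_le_of_nonarch hna _ _ (by positivity) fun k _ => ?_
  have hch : a ((n + 1).choose (k + 2) : ℕ) ≤ a ((n + 1 : ℕ) : K) * (k + 2 : ℕ) := by
    have e := Nat.add_one_mul_choose_eq n (k + 1)
    have e' : a ((n + 1 : ℕ) : K) * a (n.choose (k + 1) : ℕ) =
        a ((n + 1).choose (k + 2) : ℕ) * a ((k + 2 : ℕ) : K) := by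
      rw [← map_mul, ← map_mul, ← Nat.cast_mul, ← Nat.cast_mul, e]
    have h2 := hinv (k + 2) (by omega)
    have h3 := h1 (n.choose (k + 1))
    have h4 := apply_nonneg a (((n + 1).choose (k + 2) : ℕ) : K)
    calc a ((n + 1).choose (k + 2) : ℕ)
        ≤ a ((n + 1).choose (k + 2) : ℕ) * ((k + 2 : ℕ) * a ((k + 2 : ℕ) : K)) :=
          le_mul_of_one_le_right h4 h2
      _ = a ((n + 1 : ℕ) : K) * a (n.choose (k + 1) : ℕ) * (k + 2 : ℕ) := by rw [e']; ring
      _ ≤ a ((n + 1 : ℕ) : K) * 1 * (k + 2 : ℕ) := by gcongr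
      _ = _ := by ring
  have hpow : a u ^ k * (k + 2 : ℕ) ≤ 2 := by
    calc a u ^ k * (k + 2 : ℕ) ≤ (1 / 2) ^ k * (2 * 2 ^ k) := by
          gcongr
          have : k + 2 ≤ 2 * 2 ^ k := by
            clear * -
            induction k with
            | zero => norm_num
            | succ k ih => rw [pow_succ]; omega
          exact_mod_cast this
      _ = 2 := by rw [one_div, inv_pow]; field_simp
  rw [map_mul, map_pow]
  calc a u ^ (k + 2) * a ((n + 1).choose (k + 2) : ℕ)
      ≤ a u ^ (k + 2) * (a ((n + 1 : ℕ) : K) * (k + 2 : ℕ)) := by gcongr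
    _ = (a u ^ k * (k + 2 : ℕ)) * (a u * (a ((n + 1 : ℕ) : K) * a u)) := by ring
    _ ≤ 2 * (a u * (a ((n + 1 : ℕ) : K) * a u)) := by gcongr
    _ = _ := by ring

end AbsoluteValueEstimates

/-! ### Adelic coordinates and translates of `ℕ[1/p]`-multiples in closed sets -/

/-- A coordinate system all of whose absolute values restrict to standard absolute values of `ℚ`:
the usual one if `kind i = none`, the `p`-adic one if `kind i = some p`. -/
structure AdelicCoordSystem (K V ι : Type*) [Field K] [NormedAddCommGroup V] [Module K V]
    [Fintype ι] extends CoordSystem K V ι where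
  kind : ι → Option ℕ
  arch : ∀ i, kind i = none → ∀ m : ℕ, a i m = m
  nonarch : ∀ i p, kind i = some p → ∀ x y, a i (x + y) ≤ max (a i x) (a i y)
  prime : ∀ i p, kind i = some p → p.Prime
  a_prime : ∀ i p, kind i = some p → a i p = (p : ℝ)⁻¹
  a_coprime : ∀ i p, kind i = some p → ∀ m : ℕ, p.Coprime m → a i m = 1

namespace AdelicCoordSystem

variable {K V ι : Type*} [Field K] [NormedAddCommGroup V] [Module K V]
  [Fintype ι] (S : AdelicCoordSystem K V ι)

theorem a_natCast_bounds {i : ι} {p : ℕ} (h : S.kind i = some p) {m : ℕ} (hm : 0 < m) :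
    S.a i m ≤ 1 ∧ 1 ≤ m * S.a i m := by
  have hp := S.prime i p h
  have hp0 : (0 : ℝ) < p := by exact_mod_cast hp.pos
  have hp1 : (1 : ℝ) ≤ p := by exact_mod_cast hp.one_le
  obtain ⟨v, m', hm', rfl⟩ := Nat.exists_eq_pow_mul_and_not_dvd hm.ne' p hp.ne_one
  have hm0 : 0 < m' := Nat.pos_of_ne_zero (by rintro rfl; simp at hm')
  have e : S.a i ((p ^ v * m' : ℕ) : K) = ((p : ℝ) ^ v)⁻¹ := by
    rw [Nat.cast_mul, Nat.cast_pow, map_mul, map_pow, S.a_prime i p h,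
      S.a_coprime i p h m' ((hp.coprime_iff_not_dvd).2 hm'), mul_one, inv_pow]
  rw [e]
  constructor
  · exact inv_le_one_of_one_le₀ (one_le_pow₀ hp1)
  · push_cast
    have : (1 : ℝ) ≤ m' := by exact_mod_cast hm0
    field_simp
    exact this

theorem a_natCast_le_one {i : ι} {p : ℕ} (h : S.kind i = some p) (m : ℕ) : S.a i m ≤ 1 := by
  rcases Nat.eq_zero_or_pos m with rfl | hm
  · simp
  · exact (S.a_natCast_bounds h hm).1

variable [CharZero K] [ContinuousConstSMul K V]

/-- Linearising `x ^ J` near `x = 1` at a place where `q n` is large. -/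
theorem tendsto_linearisation {y w : V} {q η : ℕ → K} {J : ℕ → ℕ}
    (hη : ∀ i, S.n i y ≠ 0 → Tendsto (fun n => S.a i (η n - 1)) atTop (𝓝 0))
    (hq : ∀ i, S.kind i = none → S.n i y ≠ 0 → Tendsto (fun n => S.a i (q n)) atTop atTop)
    (hw : Tendsto (fun n => ((J n : K) * (q n * (η n - 1))) • y) atTop (𝓝 w)) :
    Tendsto (fun n => (q n * (η n ^ J n - 1)) • y) atTop (𝓝 w) := by
  have herr : Tendsto (fun n => (q n * (η n ^ J n - 1 - J n * (η n - 1))) • y) atTop (𝓝 0) := by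
    refine S.tendsto_zero fun i => ?_
    by_cases hi : S.n i y = 0
    · simp [S.n_smul, hi]
    have hR : Tendsto (fun n => S.n i (((J n : K) * (q n * (η n - 1))) • y)) atTop
        (𝓝 (S.n i w)) := ((S.continuous_n i).tendsto w).comp hw
    have hηe : ∀ n, η n = 1 + (η n - 1) := fun n => by ring
    -- Let `R` be the size of the linear term. At an Archimedean place `J * |η - 1|` is `R / |q|` up
    -- to a constant, so it tends to `0`, and the error is at most `R` times it. At a `p`-adic place
    -- the error is at most `2 |η - 1| R`, with no condition on `q`.
    rcases hk : S.kind i with _ | p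
    · have hyp := S.n_pos hi
      have hq' := hq i hk hi
      have hRe : ∀ n, S.n i (((J n : K) * (q n * (η n - 1))) • y) =
          S.a i (q n) * (J n * S.a i (η n - 1)) * S.n i y := fun n => by
        rw [S.n_smul, map_mul, map_mul, S.arch i hk]; ring
      have hJu : Tendsto (fun n => J n * S.a i (η n - 1)) atTop (𝓝 0) := by
        have h1 := (hR.div_atTop hq').div_const (S.n i y)
        rw [zero_div] at h1
        refine h1.congr' ?_
        filter_upwards [hq'.eventually_gt_atTop 0] with n hn
        rw [hRe]
        field_simp
      have hprod := hR.mul hJu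
      rw [mul_zero] at hprod
      refine squeeze_zero' (Eventually.of_forall fun n => S.n_nonneg _ _) ?_ hprod
      filter_upwards [hJu.eventually_le_const one_pos] with n hn
      have := (S.a i).one_add_pow_sub_le_sq hn
      rw [← hηe] at this
      rw [hRe, S.n_smul, map_mul]
      have h0 := apply_nonneg (S.a i) (q n)
      have h2 := S.n_nonneg i y
      calc _ ≤ S.a i (q n) * ((J n * S.a i (η n - 1)) * (J n * S.a i (η n - 1))) * S.n i y := by
            gcongr
        _ = _ := by ring
    · have hprod := ((hη i hi).const_mul 2).mul hR
      rw [mul_zero, zero_mul] at hprod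
      refine squeeze_zero' (Eventually.of_forall fun n => S.n_nonneg _ _) ?_ hprod
      filter_upwards [(hη i hi).eventually_le_const (show (0 : ℝ) < 1 / 2 by norm_num)] with n hn
      have := (S.a i).one_add_pow_sub_le_of_nonarch (S.nonarch i p hk) (S.a_natCast_le_one hk)
        (fun m hm => (S.a_natCast_bounds hk hm).2) hn (J n)
      rw [← hηe] at this
      rw [S.n_smul, S.n_smul, map_mul, map_mul, map_mul]
      have h0 := apply_nonneg (S.a i) (q n)
      have h2 := S.n_nonneg i y
      calc _ ≤ S.a i (q n) * (2 * S.a i (η n - 1) * (S.a i (J n) * S.a i (η n - 1))) *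
            S.n i y := by gcongr
        _ = _ := by ring
  have := hw.add herr
  rw [add_zero] at this
  refine this.congr fun n => ?_
  rw [← add_smul]
  congr 1
  ring

/-- For `J = u * (P n / p ^ v)` one has `q η ^ J y = q y + q (η ^ J - 1) y`. The left side lies over
`D`; after multiplication by `κ` the first term on the right accumulates at `z`, while `q (η ^ J -
1) y` tends to `(u / p ^ v) w` by linearisation. -/
theorem exists_coset_of_limit {G : AddSubgroup V} [CompactSpace (V ⧸ G)] {D : Set (V ⧸ G)}
    (hD : IsClosed D) {H : Submonoid K} {y w : V} (hyD : ∀ κ ∈ H, ((κ • y : V) : V ⧸ G) ∈ D)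
    {q η : ℕ → K} (hqH : ∀ n, q n ∈ H) (hηH : ∀ n, η n ∈ H) {P : ℕ → ℕ} {p : ℕ} (hp : 0 < p)
    (hP : ∀ v, ∀ᶠ n in atTop, p ^ v ∣ P n)
    (hη : ∀ i, S.n i y ≠ 0 → Tendsto (fun n => S.a i (η n - 1)) atTop (𝓝 0))
    (hq : ∀ i, S.kind i = none → S.n i y ≠ 0 → Tendsto (fun n => S.a i (q n)) atTop atTop)
    (hw : Tendsto (fun n => ((P n : K) * (q n * (η n - 1))) • y) atTop (𝓝 w))
    {κ : K} (hκ : κ ∈ H) :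
    ∃ z : V ⧸ G, ∀ u v : ℕ, z + ((κ • ((u : K) / (p : K) ^ v) • w : V) : V ⧸ G) ∈ D := by
  -- The limit `z` along one ultrafilter is fixed before `u` and `v`, so it serves all of them.
  let U : Ultrafilter ℕ := Ultrafilter.of atTop
  have hU : (U : Filter ℕ) ≤ atTop := Ultrafilter.of_le _
  obtain ⟨z, -, hz⟩ := (isCompact_univ (X := V ⧸ G)).ultrafilter_le_nhds
    (U.map fun n => (((κ * q n) • y : V) : V ⧸ G)) (by simp)
  have hz' : Tendsto (fun n => (((κ * q n) • y : V) : V ⧸ G)) U (𝓝 z) := hz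
  refine ⟨z, fun u v => ?_⟩
  have hlin : Tendsto (fun n => (q n * (η n ^ (u * (P n / p ^ v)) - 1)) • y) atTop
      (𝓝 (((u : K) / (p : K) ^ v) • w)) := by
    refine S.tendsto_linearisation hη hq ?_
    refine (((continuous_const_smul ((u : K) / (p : K) ^ v)).tendsto w).comp hw).congr' ?_
    filter_upwards [hP v] with n hn
    obtain ⟨m, hm⟩ := hn
    have hpv : (p : K) ^ v ≠ 0 := pow_ne_zero _ (by exact_mod_cast hp.ne')
    simp only [Function.comp]
    rw [smul_smul, hm, Nat.mul_div_cancel_left _ (by positivity)]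
    congr 1
    push_cast
    field_simp
  have hlim : Tendsto (fun n => (((κ * q n) • y : V) : V ⧸ G) +
      ((κ • (q n * (η n ^ (u * (P n / p ^ v)) - 1)) • y : V) : V ⧸ G)) U
      (𝓝 (z + ((κ • ((u : K) / (p : K) ^ v) • w : V) : V ⧸ G))) := by
    refine hz'.add ?_
    refine (QuotientAddGroup.continuous_mk.tendsto _).comp ?_
    exact ((continuous_const_smul κ).tendsto _).comp (hlin.mono_left hU)
  refine hD.mem_of_tendsto hlim (Eventually.of_forall fun n => ?_)
  rw [← QuotientAddGroup.mk_add, smul_smul, ← add_smul]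
  have e : κ * q n + κ * (q n * (η n ^ (u * (P n / p ^ v)) - 1)) =
      κ * q n * η n ^ (u * (P n / p ^ v)) := by ring
  rw [e]
  exact hyD _ (H.mul_mem (H.mul_mem hκ (hqH n)) (H.pow_mem (hηH n) _))

/-- A prime `p` and a non-zero vector `w` concentrated at `∞` or at `p`, such that `D` contains
cosets of the `ℕ[1/p]`-multiples of all vectors `κ • w`. -/
def HasCosets {G : AddSubgroup V} (D : Set (V ⧸ G)) (H : Submonoid K) (p : ℕ) (w : V) : Prop :=
  ∀ κ ∈ H, ∃ z : V ⧸ G, ∀ u v : ℕ, z + ((κ • ((u : K) / (p : K) ^ v) • w : V) : V ⧸ G) ∈ D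

/-- For the least possible `b` the product is at most `p`, unless `b = 0`, when it equals `A`. -/
theorem exists_pow_mul_bounds {p A : ℝ} (hp : 1 < p) (hA : 0 < A) :
    ∃ b : ℕ, 1 ≤ p ^ b * A ∧ p ^ b * A ≤ p + A := by
  have hex : ∃ b : ℕ, 1 ≤ p ^ b * A := by
    obtain ⟨b, hb⟩ := ((tendsto_pow_atTop_atTop_of_one_lt hp).eventually_ge_atTop (1 / A)).exists
    exact ⟨b, by rwa [div_le_iff₀ hA] at hb⟩
  classical
  refine ⟨Nat.find hex, Nat.find_spec hex, ?_⟩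
  rcases Nat.eq_zero_or_pos (Nat.find hex) with h | h
  · rw [h]; linarith
  · have h1 := not_le.1 (Nat.find_min hex (Nat.sub_lt h one_pos))
    have h2 : p ^ Nat.find hex = p * p ^ (Nat.find hex - 1) := by
      rw [← pow_succ', Nat.sub_add_cancel h]
    rw [h2, mul_assoc]
    nlinarith

/-- Here `q = s ^ n`, and `η n` is so close to `1` that `s ^ n (η n - 1) y` tends to `0`.
Multiplication by `2 ^ b` brings its Archimedean part back to size at least `1` without enlarging
any `p`-adic coordinate, so the limit is non-zero and purely Archimedean. -/
theorem hasCosets_of_arch [ProperSpace V] {G : AddSubgroup V} [CompactSpace (V ⧸ G)]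
    {D : Set (V ⧸ G)} (hD : IsClosed D) {H : Submonoid K} {y : V}
    (hyD : ∀ κ ∈ H, ((κ • y : V) : V ⧸ G) ∈ D) {s : K} (hsH : s ∈ H)
    (hs : ∀ i, S.n i y ≠ 0 → 1 < S.a i s)
    (hη : ∀ ε > 0, ∃ η ∈ H, η ≠ 1 ∧ ∀ i, S.n i y ≠ 0 → S.a i (η - 1) < ε) {i0 : ι}
    (hi0 : S.n i0 y ≠ 0) (hk0 : S.kind i0 = none) :
    ∃ w : V, w ≠ 0 ∧ (∀ i, S.n i w ≠ 0 → S.kind i = none) ∧ HasCosets D H 2 w := by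
  classical
  -- The sum bounds the growth of every coordinate of `y` under `s ^ n`, so this closeness makes all
  -- coordinates of `w n` at most `1 / (n + 1)`.
  have hδ : ∀ n : ℕ, (0 : ℝ) < 1 / ((n + 1) * (1 + ∑ i, S.a i s ^ n * S.n i y)) := by
    intro n
    have : 0 ≤ ∑ i, S.a i s ^ n * S.n i y :=
      Finset.sum_nonneg fun i _ => mul_nonneg (pow_nonneg (apply_nonneg _ _) _) (S.n_nonneg _ _)
    positivity
  choose η hηH hη1 hηs using fun n => hη _ (hδ n)
  have hsum : ∀ i n, S.a i s ^ n * S.n i y ≤ ∑ i, S.a i s ^ n * S.n i y := fun i n =>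
    Finset.single_le_sum (f := fun i => S.a i s ^ n * S.n i y)
      (fun i _ => mul_nonneg (pow_nonneg (apply_nonneg _ _) _) (S.n_nonneg _ _))
      (Finset.mem_univ i)
  have hηle : ∀ i, S.n i y ≠ 0 → ∀ n : ℕ, S.a i (η n - 1) ≤ 1 / (n + 1 : ℝ) := by
    intro i hi n
    refine (hηs n i hi).le.trans ?_
    have h0 : 0 ≤ ∑ i, S.a i s ^ n * S.n i y := (by
      have := mul_nonneg (pow_nonneg (apply_nonneg (S.a i) s) n) (S.n_nonneg i y)
      exact this.trans (hsum i n))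
    gcongr
    nlinarith [(Nat.cast_nonneg n : (0 : ℝ) ≤ n)]
  set w : ℕ → V := fun n => (s ^ n * (η n - 1)) • y with hw
  have hwn : ∀ i n, S.n i (w n) = S.a i s ^ n * S.a i (η n - 1) * S.n i y := fun i n => by
    simp only [hw, S.n_smul, map_mul, map_pow]
  have hwle : ∀ i n, S.n i (w n) ≤ 1 / (n + 1 : ℝ) := by
    intro i n
    rw [hwn]
    by_cases hi : S.n i y = 0
    · rw [hi, mul_zero]; positivity
    · have h1 := hηs n i hi
      have h2 := hsum i n
      have hb := mul_nonneg (pow_nonneg (apply_nonneg (S.a i) s) n) (S.n_nonneg i y)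
      calc S.a i s ^ n * S.a i (η n - 1) * S.n i y
          = S.a i (η n - 1) * (S.a i s ^ n * S.n i y) := by ring
        _ ≤ 1 / ((n + 1) * (1 + ∑ i, S.a i s ^ n * S.n i y)) *
            (1 + ∑ i, S.a i s ^ n * S.n i y) := by
            gcongr
            linarith
        _ = 1 / (n + 1 : ℝ) := by
            have : 1 + ∑ i, S.a i s ^ n * S.n i y ≠ 0 := by linarith
            field_simp
  set U : Finset ι := Finset.univ.filter fun i => S.kind i = none with hU
  set A : V → ℝ := fun x => ∑ i ∈ U, S.n i x with hA
  have hAc : Continuous A := continuous_finsetSum _ fun i _ => S.continuous_n i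
  have hA0 : A 0 = 0 := by simp [hA]
  have hAle : ∀ i, S.kind i = none → ∀ x, S.n i x ≤ A x := fun i hi x =>
    Finset.single_le_sum (f := fun i => S.n i x) (fun i _ => S.n_nonneg _ _) (by simp [hU, hi])
  have hA2 : ∀ (b : ℕ) x, A (((2 ^ b : ℕ) : K) • x) = 2 ^ b * A x := by
    intro b x
    simp only [hA, Finset.mul_sum]
    refine Finset.sum_congr rfl fun i hi => ?_
    rw [S.n_smul, S.arch i (by simpa [hU] using hi)]
    push_cast
    ring
  have hApos : ∀ n, 0 < A (w n) := by
    intro n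
    refine lt_of_lt_of_le ?_ (hAle i0 hk0 _)
    rw [hwn]
    have h1 := (S.a i0).pos (sub_ne_zero.2 (hη1 n))
    have h2 := S.n_pos hi0
    have h3 : 0 < S.a i0 s := one_pos.trans (hs i0 hi0)
    positivity
  have hAsmall : ∀ n, A (w n) ≤ Fintype.card ι * (1 / (n + 1 : ℝ)) := by
    intro n
    calc A (w n) ≤ ∑ i ∈ U, 1 / (n + 1 : ℝ) := Finset.sum_le_sum fun i _ => hwle i n
      _ ≤ ∑ i : ι, 1 / (n + 1 : ℝ) :=
          Finset.sum_le_sum_of_subset_of_nonneg (Finset.subset_univ _)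
            (fun _ _ _ => by positivity)
      _ = _ := by simp
  choose b hb1 hb2 using fun n => exists_pow_mul_bounds (one_lt_two (α := ℝ)) (hApos n)
  have hAcard : ∀ n, A (w n) ≤ Fintype.card ι := fun n => (hAsmall n).trans (by
    refine mul_le_of_le_one_right (Nat.cast_nonneg _) ?_
    rw [div_le_one (by positivity)]
    linarith [(Nat.cast_nonneg n : (0 : ℝ) ≤ n)])
  have hbt : Tendsto b atTop atTop := by
    have h1 : Tendsto (fun n => (2 : ℝ) ^ b n) atTop atTop := by
      refine tendsto_atTop_mono (f := fun n : ℕ => ((n : ℝ) + 1) / Fintype.card ι) ?_ ?_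
      · intro n
        have hc : (0 : ℝ) < Fintype.card ι := by
          exact_mod_cast Fintype.card_pos_iff.2 ⟨i0⟩
        rw [div_le_iff₀ hc]
        have h2 := (hb1 n).trans (mul_le_mul_of_nonneg_left (hAsmall n) (by positivity))
        have h3 : (0 : ℝ) < n + 1 := by positivity
        rw [← mul_assoc, mul_one_div, le_div_iff₀ h3] at h2
        linarith
      · have hc : (0 : ℝ) < Fintype.card ι := by
          exact_mod_cast Fintype.card_pos_iff.2 ⟨i0⟩
        exact (tendsto_atTop_add_const_right _ _ tendsto_natCast_atTop_atTop).atTop_div_const hc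
    rw [tendsto_atTop] at h1 ⊢
    intro B
    filter_upwards [h1 ((2 : ℝ) ^ B)] with n hn
    exact (pow_le_pow_iff_right₀ one_lt_two).1 hn
  have hbd : ∀ i n, S.n i (((2 ^ b n : ℕ) : K) • w n) ≤ 2 + Fintype.card ι := by
    intro i n
    rcases hk : S.kind i with _ | p
    · refine (hAle i hk _).trans ?_
      rw [hA2]
      linarith [hb2 n, hAcard n]
    · rw [S.n_smul]
      have h1 := S.a_natCast_le_one hk (2 ^ b n)
      have h2 := hwle i n
      have h3 : 1 / (n + 1 : ℝ) ≤ 1 := by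
        rw [div_le_one (by positivity)]
        linarith [(Nat.cast_nonneg n : (0 : ℝ) ≤ n)]
      calc _ ≤ 1 * (1 : ℝ) := by
            have := S.n_nonneg i (w n)
            gcongr
            linarith
        _ ≤ _ := by linarith [(Nat.cast_nonneg (Fintype.card ι) : (0 : ℝ) ≤ _)]
  obtain ⟨x, φ, hφ, hx⟩ := S.exists_subseq hbd
  have hφt := hφ.tendsto_atTop
  have hinv : Tendsto (fun k : ℕ => 1 / ((φ k : ℕ) + 1 : ℝ)) atTop (𝓝 0) :=
    (tendsto_one_div_add_atTop_nhds_zero_nat (𝕜 := ℝ)).comp hφt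
  refine ⟨x, ?_, ?_, ?_⟩
  · rintro rfl
    have := ge_of_tendsto ((hAc.tendsto _).comp hx)
      (Eventually.of_forall fun k => by
        simp only [Function.comp]
        rw [hA2]
        exact hb1 (φ k))
    rw [hA0] at this
    linarith
  · intro i hi
    rcases hk : S.kind i with _ | p
    · rfl
    · exfalso
      refine hi (le_antisymm ?_ (S.n_nonneg _ _))
      refine le_of_tendsto_of_tendsto' (((S.continuous_n i).tendsto x).comp hx) hinv fun k => ?_
      simp only [Function.comp]
      rw [S.n_smul]
      refine le_trans ?_ (hwle i (φ k))
      exact mul_le_of_le_one_left (S.n_nonneg _ _) (S.a_natCast_le_one hk _)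
  · intro κ hκ
    refine S.exists_coset_of_limit hD hyD (q := fun k => s ^ φ k) (η := fun k => η (φ k))
      (fun k => H.pow_mem hsH _) (fun k => hηH _) (P := fun k => 2 ^ b (φ k)) two_pos ?_ ?_ ?_ ?_ hκ
    · intro v
      filter_upwards [(hbt.comp hφt).eventually_ge_atTop v] with k hk
      exact pow_dvd_pow _ hk
    · intro i hi
      exact squeeze_zero (fun k => apply_nonneg _ _) (fun k => hηle i hi (φ k)) hinv
    · intro i _ hi
      simp only [map_pow]
      exact (tendsto_pow_atTop_atTop_of_one_lt (hs i hi)).comp hφt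
    · refine hx.congr fun k => ?_
      simp only [Function.comp, hw]
      rw [smul_smul]

/-- Without Archimedean coordinates the power of `s` is free, and it is chosen so that the `p`-part
of `w n` is at least `p ^ n`. The factor `p ^ b` of `P n` then shrinks the `p`-part to size between
`1` and `p`, with `b n ≥ n`, while the factor `Q ^ E`, prime to `p`, makes the coordinates at other
primes tend to `0`. -/
theorem hasCosets_of_nonarch [ProperSpace V] {G : AddSubgroup V} [CompactSpace (V ⧸ G)]
    {D : Set (V ⧸ G)} (hD : IsClosed D) {H : Submonoid K} {y : V}
    (hyD : ∀ κ ∈ H, ((κ • y : V) : V ⧸ G) ∈ D) {s : K} (hsH : s ∈ H)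
    (hs : ∀ i, S.n i y ≠ 0 → 1 < S.a i s)
    (hη : ∀ ε > 0, ∃ η ∈ H, η ≠ 1 ∧ ∀ i, S.n i y ≠ 0 → S.a i (η - 1) < ε) {i0 : ι} {p : ℕ}
    (hi0 : S.n i0 y ≠ 0) (hk0 : S.kind i0 = some p) (hya : ∀ i, S.kind i = none → S.n i y = 0) :
    ∃ w : V, w ≠ 0 ∧ (∀ i, S.n i w ≠ 0 → S.kind i = some p) ∧ HasCosets D H p w := by
  classical
  have hp := S.prime i0 p hk0
  have hp0 : (0 : ℝ) < p := by exact_mod_cast hp.pos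
  have hp1 : (1 : ℝ) < p := by exact_mod_cast hp.one_lt
  have hδ : ∀ n : ℕ, (0 : ℝ) < 1 / (n + 1) := fun n => by positivity
  choose η hηH hη1 hηs using fun n => hη _ (hδ n)
  set U : Finset ι := Finset.univ.filter fun i => S.kind i = some p with hU
  set A : V → ℝ := fun x => ∑ i ∈ U, S.n i x with hA
  have hAc : Continuous A := continuous_finsetSum _ fun i _ => S.continuous_n i
  have hA0 : A 0 = 0 := by simp [hA]
  have hAle : ∀ i, S.kind i = some p → ∀ x, S.n i x ≤ A x := fun i hi x =>
    Finset.single_le_sum (f := fun i => S.n i x) (fun i _ => S.n_nonneg _ _) (by simp [hU, hi])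
  have hm : ∀ n : ℕ, ∃ m : ℕ, (p : ℝ) ^ n ≤ A ((s ^ m * (η n - 1)) • y) := by
    intro n
    have h1 := (S.a i0).pos (sub_ne_zero.2 (hη1 n))
    have h2 := S.n_pos hi0
    have ht : Tendsto (fun m : ℕ => S.a i0 s ^ m * (S.a i0 (η n - 1) * S.n i0 y)) atTop atTop :=
      (tendsto_pow_atTop_atTop_of_one_lt (hs i0 hi0)).atTop_mul_const (mul_pos h1 h2)
    obtain ⟨m, hm⟩ := (ht.eventually_ge_atTop ((p : ℝ) ^ n)).exists
    refine ⟨m, hm.trans (le_trans (le_of_eq ?_) (hAle i0 hk0 _))⟩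
    rw [S.n_smul, map_mul, map_pow]
    ring
  choose m hm using hm
  set w : ℕ → V := fun n => (s ^ m n * (η n - 1)) • y with hw
  -- The primes other than `p` that occur as places; coordinates at `p` or at infinity contribute
  -- the factor `1`.
  set Q : ℕ := ∏ i : ι, (if S.kind i = some p then 1 else (S.kind i).getD 1) with hQ
  have hQp : p.Coprime Q := by
    refine Nat.Coprime.prod_right fun i _ => ?_
    split_ifs with hi
    · exact Nat.coprime_one_right _
    · rcases hk : S.kind i with _ | q
      · exact Nat.coprime_one_right _
      · refine (Nat.coprime_primes hp (S.prime i q hk)).2 ?_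
        rintro rfl
        exact hi hk
  have haQ : ∀ i q, S.kind i = some q → q ≠ p → S.a i Q < 1 := by
    intro i q hk hqp
    have hdvd : q ∣ Q := by
      have := Finset.dvd_prod_of_mem
        (fun i => if S.kind i = some p then 1 else (S.kind i).getD 1) (Finset.mem_univ i)
      simpa [hk, hqp] using this
    obtain ⟨c, hc⟩ := hdvd
    have hq1 : (1 : ℝ) < q := by exact_mod_cast (S.prime i q hk).one_lt
    rw [hc, Nat.cast_mul, map_mul, S.a_prime i q hk]
    calc (q : ℝ)⁻¹ * S.a i c ≤ (q : ℝ)⁻¹ * 1 := by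
          gcongr
          exact S.a_natCast_le_one hk c
      _ < 1 := by rw [mul_one]; exact inv_lt_one_of_one_lt₀ hq1
  have hE : ∀ n : ℕ, ∃ E : ℕ, ∀ i, S.kind i ≠ some p →
      S.n i (((Q ^ E : ℕ) : K) • w n) ≤ 1 / (n + 1 : ℝ) := by
    intro n
    suffices h : ∀ᶠ E : ℕ in atTop, ∀ i, S.kind i ≠ some p →
      S.n i (((Q ^ E : ℕ) : K) • w n) ≤ 1 / (n + 1 : ℝ) from h.exists
    rw [eventually_all]
    intro i
    rcases hk : S.kind i with _ | q
    · refine Eventually.of_forall fun E _ => ?_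
      rw [S.n_smul, hw, S.n_smul, hya i hk, mul_zero, mul_zero]
      positivity
    · by_cases hqp : q = p
      · refine Eventually.of_forall fun E h => ?_
        exact absurd (by rw [hqp]) h
      · have ht : Tendsto (fun E : ℕ => S.a i Q ^ E * S.n i (w n)) atTop (𝓝 0) := by
          simpa using (tendsto_pow_atTop_nhds_zero_of_lt_one (apply_nonneg (S.a i) _)
            (haQ i q hk hqp)).mul_const (S.n i (w n))
        filter_upwards [ht.eventually_le_const (hδ n)] with E hE _
        rw [S.n_smul, Nat.cast_pow, map_pow]
        exact hE
  choose E hE using hE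
  have hAscale : ∀ (e c : ℕ) x, p.Coprime e → A (((p ^ c * e : ℕ) : K) • x) =
      ((p : ℝ) ^ c)⁻¹ * A x := by
    intro e c x he
    simp only [hA, Finset.mul_sum]
    refine Finset.sum_congr rfl fun i hi => ?_
    have hi' : S.kind i = some p := by simpa [hU] using hi
    rw [S.n_smul, Nat.cast_mul, Nat.cast_pow, map_mul, map_pow, S.a_prime i p hi',
      S.a_coprime i p hi' e he, mul_one, inv_pow]
  have hAone : ∀ n, 1 ≤ A (w n) := fun n => (one_le_pow₀ hp1.le).trans (hm n)
  choose b hb1 hb2 using fun n => exists_nat_pow_near (hAone n) hp1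
  have hbn : ∀ n, n ≤ b n := fun n =>
    Nat.lt_succ_iff.1 ((pow_lt_pow_iff_right₀ hp1).1 ((hm n).trans_lt (hb2 n)))
  set P : ℕ → ℕ := fun n => p ^ b n * Q ^ E n with hP
  have hPA : ∀ n, 1 ≤ A ((P n : K) • w n) ∧ A ((P n : K) • w n) ≤ p := by
    intro n
    rw [hAscale _ _ _ (Nat.Coprime.pow_right _ hQp)]
    have hpb : (0 : ℝ) < (p : ℝ) ^ b n := by positivity
    constructor
    · rw [inv_mul_eq_div, le_div_iff₀ hpb, one_mul]
      exact hb1 n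
    · rw [inv_mul_eq_div, div_le_iff₀ hpb, ← pow_succ']
      exact (hb2 n).le
  have hPother : ∀ i, S.kind i ≠ some p → ∀ n, S.n i ((P n : K) • w n) ≤ 1 / (n + 1 : ℝ) := by
    intro i hi n
    rcases hk : S.kind i with _ | q
    · rw [S.n_smul, hw, S.n_smul, hya i hk, mul_zero, mul_zero]
      positivity
    · refine le_trans ?_ (hE n i hi)
      rw [hP, Nat.cast_mul, mul_smul, S.n_smul]
      exact mul_le_of_le_one_left (S.n_nonneg _ _) (S.a_natCast_le_one hk _)
  have hbd : ∀ i n, S.n i ((P n : K) • w n) ≤ p := by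
    intro i n
    by_cases hi : S.kind i = some p
    · exact (hAle i hi _).trans (hPA n).2
    · refine (hPother i hi n).trans (le_trans ?_ hp1.le)
      rw [div_le_one (by positivity)]
      linarith [(Nat.cast_nonneg n : (0 : ℝ) ≤ n)]
  obtain ⟨x, φ, hφ, hx⟩ := S.exists_subseq hbd
  have hφt := hφ.tendsto_atTop
  have hinv : Tendsto (fun k : ℕ => 1 / ((φ k : ℕ) + 1 : ℝ)) atTop (𝓝 0) :=
    (tendsto_one_div_add_atTop_nhds_zero_nat (𝕜 := ℝ)).comp hφt
  refine ⟨x, ?_, ?_, ?_⟩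
  · rintro rfl
    have := ge_of_tendsto ((hAc.tendsto _).comp hx)
      (Eventually.of_forall fun k => (hPA (φ k)).1)
    rw [hA0] at this
    linarith
  · intro i hi
    by_contra hk
    refine hi (le_antisymm ?_ (S.n_nonneg _ _))
    exact le_of_tendsto_of_tendsto' (((S.continuous_n i).tendsto x).comp hx) hinv
      fun k => hPother i hk (φ k)
  · intro κ hκ
    refine S.exists_coset_of_limit hD hyD (q := fun k => s ^ m (φ k)) (η := fun k => η (φ k))
      (fun k => H.pow_mem hsH _) (fun k => hηH _) (P := fun k => P (φ k)) hp.pos ?_ ?_ ?_ ?_ hκ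
    · intro v
      filter_upwards [eventually_ge_atTop v] with k hk
      refine Dvd.dvd.mul_right (pow_dvd_pow _ ?_) _
      exact hk.trans ((hφ.id_le k).trans (hbn _))
    · intro i hi
      exact squeeze_zero (fun k => apply_nonneg _ _) (fun k => (hηs (φ k) i hi).le) hinv
    · intro i hk hi
      exact absurd (hya i hk) hi
    · refine hx.congr fun k => ?_
      simp only [Function.comp, hw]
      rw [smul_smul]

theorem exists_hasCosets [ProperSpace V] {G : AddSubgroup V} [CompactSpace (V ⧸ G)]
    {D : Set (V ⧸ G)} (hD : IsClosed D) {H : Submonoid K} {y : V} (hy : y ≠ 0)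
    (hyD : ∀ κ ∈ H, ((κ • y : V) : V ⧸ G) ∈ D) {s : K} (hsH : s ∈ H)
    (hs : ∀ i, S.n i y ≠ 0 → 1 < S.a i s)
    (hη : ∀ ε > 0, ∃ η ∈ H, η ≠ 1 ∧ ∀ i, S.n i y ≠ 0 → S.a i (η - 1) < ε) :
    ∃ (w : V) (p : ℕ), w ≠ 0 ∧ p.Prime ∧ ((∀ i, S.n i w ≠ 0 → S.kind i = none) ∨
      ∀ i, S.n i w ≠ 0 → S.kind i = some p) ∧ HasCosets D H p w := by
  by_cases h : ∃ i, S.n i y ≠ 0 ∧ S.kind i = none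
  · obtain ⟨i, hi, hk⟩ := h
    obtain ⟨w, hw, hwn, hwD⟩ := S.hasCosets_of_arch hD hyD hsH hs hη hi hk
    exact ⟨w, 2, hw, Nat.prime_two, Or.inl hwn, hwD⟩
  · push Not at h
    obtain ⟨i, hi⟩ := S.exists_n_ne_zero hy
    obtain ⟨p, hp⟩ := Option.ne_none_iff_exists'.1 (h i hi)
    obtain ⟨w, hw, hwn, hwD⟩ := S.hasCosets_of_nonarch hD hyD hsH hs hη hi hp
      fun i hi => by_contra fun h' => h i h' hi
    exact ⟨w, p, hw, S.prime i p hp, Or.inr hwn, hwD⟩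

end AdelicCoordSystem

/-! ### Characters of compact groups and a criterion of Weyl type -/

section Characters

variable {X C : Type*} [AddCommGroup X] [TopologicalSpace X] [AddCommGroup C]

/-- The continuous function `x ↦ exp (2πi ψ(c)(x))`, for a family `ψ` of continuous characters. -/
noncomputable def charExp (ψ : C →+ X →+ UnitAddCircle) (hψ : ∀ c, Continuous (ψ c)) (c : C) :
    C(X, ℂ) where
  toFun x := AddCircle.toCircle (ψ c x)
  continuous_toFun := continuous_induced_dom.comp (AddCircle.continuous_toCircle.comp (hψ c))

variable {ψ : C →+ X →+ UnitAddCircle} {hψ : ∀ c, Continuous (ψ c)}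

theorem charExp_apply (c : C) (x : X) : charExp ψ hψ c x = (AddCircle.toCircle (ψ c x) : ℂ) := rfl

theorem charExp_add_apply (c : C) (x y : X) :
    charExp ψ hψ c (x + y) = charExp ψ hψ c x * charExp ψ hψ c y := by
  simp only [charExp_apply, map_add, AddCircle.toCircle_add, Circle.coe_mul]

theorem charExp_nsmul_apply (c : C) (n : ℕ) (x : X) :
    charExp ψ hψ c (n • x) = charExp ψ hψ c x ^ n := by
  simp only [charExp_apply, map_nsmul, AddCircle.toCircle_nsmul, Circle.coe_pow]

theorem charExp_sum_apply {β : Type*} (c : C) (s : Finset β) (f : β → X) :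
    charExp ψ hψ c (∑ i ∈ s, f i) = ∏ i ∈ s, charExp ψ hψ c (f i) := by
  classical
  induction s using Finset.induction_on with
  | empty => simp [charExp_apply]
  | insert i s hi ih => rw [Finset.sum_insert hi, Finset.prod_insert hi, charExp_add_apply, ih]

theorem norm_charExp_apply (c : C) (x : X) : ‖charExp ψ hψ c x‖ = 1 := Circle.norm_coe _

theorem charExp_apply_ne_one {c : C} {x : X} (h : ψ c x ≠ 0) : charExp ψ hψ c x ≠ 1 := by
  intro h1
  apply h
  have h2 : AddCircle.toCircle (ψ c x) = AddCircle.toCircle (0 : UnitAddCircle) := by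
    rw [AddCircle.toCircle_zero]
    exact Circle.ext h1
  exact AddCircle.injective_toCircle one_ne_zero h2

/-- The star subalgebra spanned by a group of characters. -/
noncomputable def charSubalgebra (ψ : C →+ X →+ UnitAddCircle) (hψ : ∀ c, Continuous (ψ c)) :
    StarSubalgebra ℂ C(X, ℂ) where
  toSubalgebra := Algebra.adjoin ℂ (Set.range (charExp ψ hψ))
  star_mem' := by
    change Algebra.adjoin ℂ (Set.range (charExp ψ hψ)) ≤
      star (Algebra.adjoin ℂ (Set.range (charExp ψ hψ)))
    refine Algebra.adjoin_le ?_
    rintro - ⟨c, rfl⟩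
    refine Algebra.subset_adjoin ⟨-c, ContinuousMap.ext fun x => ?_⟩
    simp only [charExp_apply, map_neg, AddMonoidHom.neg_apply, AddCircle.toCircle_neg,
      ContinuousMap.star_apply, Circle.coe_inv_eq_conj]
    rfl

theorem charSubalgebra_toSubmodule :
    Subalgebra.toSubmodule (charSubalgebra ψ hψ).toSubalgebra =
      Submodule.span ℂ (Set.range (charExp ψ hψ)) := by
  apply Algebra.adjoin_eq_span_of_subset
  refine Set.Subset.trans ?_ Submodule.subset_span
  intro x hx
  refine Submonoid.closure_induction (fun _ => id) ⟨0, ?_⟩ ?_ hx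
  · ext1 z; simp [charExp_apply]
  · rintro - - - - ⟨m, rfl⟩ ⟨n, rfl⟩
    refine ⟨m + n, ?_⟩
    ext1 z
    simp [charExp_apply, AddCircle.toCircle_add]

/-- Stone–Weierstrass: the characters separate points, and they form a group under multiplication,
so the star algebra they generate is their linear span. -/
theorem exists_character_sum_near [CompactSpace X] (hsep : ∀ x, (∀ c, ψ c x = 0) → x = 0)
    (f : C(X, ℂ)) {ε : ℝ} (hε : 0 < ε) :
    ∃ a : C →₀ ℂ, ‖f - a.sum fun c z => z • charExp ψ hψ c‖ < ε := by
  have htop : (charSubalgebra ψ hψ).topologicalClosure = ⊤ := by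
    refine ContinuousMap.starSubalgebra_topologicalClosure_eq_top_of_separatesPoints _ ?_
    intro x y hxy
    have : ∃ c, ψ c (x - y) ≠ 0 := by
      by_contra! h
      exact hxy (sub_eq_zero.1 (hsep _ h))
    obtain ⟨c, hc⟩ := this
    refine ⟨_, ⟨charExp ψ hψ c, Algebra.subset_adjoin ⟨c, rfl⟩, rfl⟩, fun h => ?_⟩
    apply charExp_apply_ne_one (hψ := hψ) hc
    have h1 := charExp_add_apply (ψ := ψ) (hψ := hψ) c (x - y) y
    rw [sub_add_cancel] at h1
    change charExp ψ hψ c x = charExp ψ hψ c y at h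
    rw [h] at h1
    have h0 : charExp ψ hψ c y ≠ 0 := by
      intro h0
      have := norm_charExp_apply (ψ := ψ) (hψ := hψ) c y
      rw [h0, norm_zero] at this
      exact zero_ne_one this
    exact (mul_eq_right₀ h0).1 h1.symm
  have hf : f ∈ closure ((charSubalgebra ψ hψ : Set C(X, ℂ))) := by
    rw [← StarSubalgebra.topologicalClosure_coe, htop]
    trivial
  obtain ⟨g, hg, hfg⟩ := Metric.mem_closure_iff.1 hf ε hε
  have hg' : g ∈ Submodule.span ℂ (Set.range (charExp ψ hψ)) := by
    rw [← charSubalgebra_toSubmodule]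
    exact hg
  obtain ⟨a, rfl⟩ := Finsupp.mem_span_range_iff_exists_finsupp.1 hg'
  exact ⟨a, by rwa [← dist_eq_norm]⟩

theorem norm_geom_average_le {z : ℂ} (hz : ‖z‖ = 1) (hz1 : z ≠ 1) (N : ℕ) :
    ‖∑ j ∈ Finset.range N, z ^ j‖ ≤ 2 / ‖z - 1‖ := by
  rw [geom_sum_eq hz1, norm_div]
  gcongr
  refine (norm_sub_le _ _).trans ?_
  rw [norm_pow, hz, one_pow, norm_one]
  norm_num

open MeasureTheory in
/-- A closed subset of a compact group is everything if it contains arbitrarily long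
multidimensional progressions whose steps are non-trivial for any given finitely many
non-zero characters of a separating group of characters. -/
theorem eq_univ_of_progressions [IsTopologicalAddGroup X] [CompactSpace X] [T2Space X]
    (hψ : ∀ c, Continuous (ψ c))
    (hsep : ∀ x, (∀ c, ψ c x = 0) → x = 0) {E : Set X} (hE : IsClosed E)
    (h : ∀ Φ : Finset C, (∀ c ∈ Φ, c ≠ 0) → ∃ l : C → X, (∀ c ∈ Φ, ψ c (l c) ≠ 0) ∧
      ∃ z, ∀ j : Φ → ℕ, z + ∑ c : Φ, j c • l c ∈ E) : E = Set.univ := by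
  classical
  by_contra hne
  obtain ⟨x0, hx0⟩ := (Set.ne_univ_iff_exists_notMem E).1 hne
  -- The function `f` vanishes on `E` and has Haar integral `I > 0`. A character sum `P` within `I /
  -- 3` of `f` has constant term `a 0` within `I / 3` of `I`. On a progression inside `E` one has
  -- `|P| ≤ I / 3`, and the averages of `P` over growing boxes tend to `a 0`; so `I ≤ 2 I / 3`,
  -- which is absurd.
  obtain ⟨f, hfE, hf0, hf01⟩ := exists_continuous_zero_one_of_isClosed hE isClosed_singleton
    (Set.disjoint_singleton_right.2 hx0)
  let _ : MeasurableSpace X := borel X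
  have : BorelSpace X := ⟨rfl⟩
  let μ : Measure X := Measure.addHaarMeasure ⊤
  have : IsProbabilityMeasure μ := ⟨by
    have := Measure.addHaarMeasure_self (G := X) (K₀ := ⊤)
    simpa using this⟩
  have hI : 0 < ∫ x, f x ∂μ := by
    refine f.continuous.integral_pos_of_hasCompactSupport_nonneg_nonzero
      (HasCompactSupport.of_compactSpace _) (fun x => (hf01 x).1) (x := x0) ?_
    rw [hf0 (Set.mem_singleton x0)]
    simp
  set I := ∫ x, f x ∂μ with hIdef
  let fC : C(X, ℂ) := ⟨fun x => (f x : ℂ), Complex.continuous_ofReal.comp f.continuous⟩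
  obtain ⟨a, ha⟩ := exists_character_sum_near (hψ := hψ) hsep fC (ε := I / 3) (by positivity)
  set P : C(X, ℂ) := a.sum fun c z => z • charExp ψ hψ c with hP
  have hPx : ∀ x, P x = ∑ c ∈ a.support, a c * charExp ψ hψ c x := by
    intro x
    simp [hP, Finsupp.sum, ContinuousMap.sum_apply]
  have hclose : ∀ x, ‖fC x - P x‖ ≤ I / 3 := fun x =>
    ((fC - P).norm_coe_le_norm x).trans ha.le
  have hint : ∀ g : C(X, ℂ), Integrable g μ := fun g =>
    g.continuous.integrable_of_hasCompactSupport (HasCompactSupport.of_compactSpace _)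
  have hchar : ∀ c, c ≠ 0 → ∫ x, charExp ψ hψ c x ∂μ = 0 := by
    intro c hc
    -- The hypothesis on progressions also supplies a point where `c` is non-trivial; translating by
    -- it shows that the integral vanishes.
    obtain ⟨l, hl, -⟩ := h {c} (by simpa using hc)
    have hl := hl c (Finset.mem_singleton_self c)
    have h1 := integral_add_right_eq_self (μ := μ) (fun x => charExp ψ hψ c x) (l c)
    simp only [charExp_add_apply, integral_mul_const] at h1
    by_contra hne0
    exact charExp_apply_ne_one (hψ := hψ) hl ((mul_eq_left₀ hne0).1 h1)
  have hchar0 : ∀ x, charExp ψ hψ 0 x = 1 := fun x => by simp [charExp_apply]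
  have hPint : ∫ x, P x ∂μ = a 0 := by
    simp only [hPx]
    rw [integral_finsetSum _ fun c _ => ((hint (charExp ψ hψ c)).const_mul (a c))]
    simp only [integral_const_mul]
    rw [Finset.sum_eq_single 0]
    · simp [hchar0]
    · intro c _ hc
      rw [hchar c hc, mul_zero]
    · intro h0
      rw [Finsupp.notMem_support_iff.1 h0, zero_mul]
  have ha0 : ‖(I : ℂ) - a 0‖ ≤ I / 3 := by
    have h1 : ∫ x, (fC x - P x) ∂μ = (I : ℂ) - a 0 := by
      rw [integral_sub (hint fC) (hint P), hPint]
      congr 1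
      exact integral_ofReal
    rw [← h1]
    have := norm_integral_le_of_norm_le_const (μ := μ) (Eventually.of_forall hclose)
    simpa using this
  set Φ := a.support.erase 0 with hΦ
  obtain ⟨l, hl, z, hz⟩ := h Φ (fun c hc => Finset.ne_of_mem_erase hc)
  let pt : (Φ → ℕ) → X := fun j => z + ∑ c : Φ, j c • l c
  have hPpt : ∀ j, ‖P (pt j)‖ ≤ I / 3 := by
    intro j
    have h1 := hclose (pt j)
    have h2 : fC (pt j) = 0 := by
      change ((f (pt j) : ℝ) : ℂ) = 0
      rw [hfE (hz j)]
      simp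
    rwa [h2, zero_sub, norm_neg] at h1
  -- The sum over the box is a product of one-dimensional sums: the one in direction `c` is a
  -- geometric sum bounded independently of `N`, the others are at most `N`.
  have hsum : ∀ N : ℕ, ∀ c ∈ Φ,
      ‖∑ j ∈ Fintype.piFinset fun _ : Φ => Finset.range N, charExp ψ hψ c (pt j)‖ ≤
        2 / ‖charExp ψ hψ c (l c) - 1‖ * (N : ℝ) ^ (Fintype.card Φ - 1) := by
    intro N c hc
    have e : ∀ j : Φ → ℕ, charExp ψ hψ c (pt j) =
        charExp ψ hψ c z * ∏ d : Φ, charExp ψ hψ c (l d) ^ j d := by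
      intro j
      simp only [pt, charExp_add_apply, charExp_sum_apply, charExp_nsmul_apply]
    simp only [e]
    rw [← Finset.mul_sum, Finset.sum_prod_piFinset (Finset.range N)
      fun (d : Φ) j => charExp ψ hψ c (l d) ^ j, norm_mul, norm_charExp_apply, one_mul, norm_prod,
      ← Finset.mul_prod_erase _ _ (Finset.mem_univ (⟨c, hc⟩ : Φ))]
    gcongr
    · exact norm_geom_average_le (norm_charExp_apply _ _) (charExp_apply_ne_one (hl c hc)) N
    · rw [← Finset.card_univ, ← Finset.card_erase_of_mem (Finset.mem_univ (⟨c, hc⟩ : Φ))]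
      rw [← Finset.prod_const]
      refine Finset.prod_le_prod (fun _ _ => norm_nonneg _) fun d _ => ?_
      refine (norm_sum_le _ _).trans ?_
      simp [norm_charExp_apply]
  have hbound : ∀ N : ℕ, 0 < N → ‖a 0‖ ≤ I / 3 +
      (∑ c ∈ Φ, ‖a c‖ * (2 / ‖charExp ψ hψ c (l c) - 1‖)) * (1 / (N : ℝ)) := by
    intro N hN
    have hN' : (0 : ℝ) < N := by exact_mod_cast hN
    set T := Fintype.piFinset fun _ : Φ => Finset.range N with hT
    have hcard : T.card = N ^ Fintype.card Φ := by simp [hT]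
    have hsplit : ∀ x, P x = a 0 + ∑ c ∈ Φ, a c * charExp ψ hψ c x := by
      intro x
      rw [hPx]
      by_cases h0 : (0 : C) ∈ a.support
      · rw [← Finset.add_sum_erase _ _ h0, hchar0, mul_one]
      · rw [hΦ, Finset.erase_eq_of_notMem h0, Finsupp.notMem_support_iff.1 h0, zero_add]
    have h1 : ∑ j ∈ T, P (pt j) = (N : ℂ) ^ Fintype.card Φ * a 0 +
        ∑ c ∈ Φ, a c * ∑ j ∈ T, charExp ψ hψ c (pt j) := by
      simp only [hsplit, Finset.sum_add_distrib, Finset.sum_const, hcard]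
      rw [Finset.sum_comm]
      simp [Finset.mul_sum]
    have h2 : ‖∑ j ∈ T, P (pt j)‖ ≤ (N : ℝ) ^ Fintype.card Φ * (I / 3) := by
      refine (norm_sum_le_of_le _ fun j _ => hPpt j).trans ?_
      simp [hcard]
    have h3 : ‖∑ c ∈ Φ, a c * ∑ j ∈ T, charExp ψ hψ c (pt j)‖ ≤
        (∑ c ∈ Φ, ‖a c‖ * (2 / ‖charExp ψ hψ c (l c) - 1‖)) * (N : ℝ) ^ (Fintype.card Φ - 1) := by
      rw [Finset.sum_mul]
      refine norm_sum_le_of_le _ fun c hc => ?_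
      rw [norm_mul, mul_assoc]
      gcongr
      exact hsum N c hc
    have h4 : (N : ℝ) ^ Fintype.card Φ * ‖a 0‖ ≤ (N : ℝ) ^ Fintype.card Φ * (I / 3) +
        (∑ c ∈ Φ, ‖a c‖ * (2 / ‖charExp ψ hψ c (l c) - 1‖)) * (N : ℝ) ^ (Fintype.card Φ - 1) := by
      have e : (N : ℂ) ^ Fintype.card Φ * a 0 = ∑ j ∈ T, P (pt j) -
          ∑ c ∈ Φ, a c * ∑ j ∈ T, charExp ψ hψ c (pt j) := by rw [h1]; ring
      calc (N : ℝ) ^ Fintype.card Φ * ‖a 0‖ = ‖(N : ℂ) ^ Fintype.card Φ * a 0‖ := by simp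
        _ ≤ _ := by
          rw [e]
          exact (norm_sub_le _ _).trans (add_le_add h2 h3)
    -- For empty `Φ` the exponent `Fintype.card Φ - 1` is truncated to `0`, so this case needs its
    -- own argument.
    rcases Nat.eq_zero_or_pos (Fintype.card Φ) with h0 | h0
    · have hΦe : Φ = ∅ := by
        rw [Fintype.card_coe] at h0
        exact Finset.card_eq_zero.1 h0
      rw [hΦe] at h4 ⊢
      simpa using h4
    · obtain ⟨n, hn⟩ := Nat.exists_eq_succ_of_ne_zero h0.ne'
      rw [hn, Nat.succ_eq_add_one, Nat.add_sub_cancel, pow_succ] at h4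
      have hNn : (0 : ℝ) < (N : ℝ) ^ n := by positivity
      have h5 : (N : ℝ) ^ n * ((N : ℝ) * ‖a 0‖) ≤ (N : ℝ) ^ n * ((N : ℝ) * (I / 3) +
          ∑ c ∈ Φ, ‖a c‖ * (2 / ‖charExp ψ hψ c (l c) - 1‖)) := by nlinarith
      have h6 := le_of_mul_le_mul_left h5 hNn
      rw [mul_one_div, ← sub_le_iff_le_add', le_div_iff₀ hN']
      linarith
  have hlim : ‖a 0‖ ≤ I / 3 := by
    have ht : Tendsto (fun N : ℕ => I / 3 +
        (∑ c ∈ Φ, ‖a c‖ * (2 / ‖charExp ψ hψ c (l c) - 1‖)) * (1 / (N : ℝ))) atTop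
        (𝓝 (I / 3)) := by
      simpa using (tendsto_one_div_atTop_nhds_zero_nat (𝕜 := ℝ)).const_mul
        (∑ c ∈ Φ, ‖a c‖ * (2 / ‖charExp ψ hψ c (l c) - 1‖)) |>.const_add (I / 3)
    refine ge_of_tendsto ht ?_
    filter_upwards [eventually_gt_atTop 0] with N hN using hbound N hN
  have h7 : I ≤ ‖(I : ℂ) - a 0‖ + ‖a 0‖ := by
    calc I = ‖(I : ℂ)‖ := by rw [Complex.norm_real, Real.norm_of_nonneg hI.le]
      _ = ‖((I : ℂ) - a 0) + a 0‖ := by rw [sub_add_cancel]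
      _ ≤ _ := norm_add_le _ _
  linarith

end Characters

/-! ### Arithmetic of `ℤ[1/a]` -/

section InvertedIntegers

variable {a : ℕ}

theorem exists_int_div_pow_of_mem_zInv (ha : 0 < a) {q : ℚ} (hq : q ∈ zInv a) :
    ∃ (m : ℤ) (s : ℕ), q = m / (a : ℚ) ^ s := by
  have ha' : (a : ℚ) ≠ 0 := by exact_mod_cast ha.ne'
  induction hq using Subring.closure_induction with
  | mem x hx => exact ⟨1, 1, by rw [Set.mem_singleton_iff.1 hx]; simp⟩
  | zero => exact ⟨0, 0, by simp⟩
  | one => exact ⟨1, 0, by simp⟩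
  | add x y _ _ hx hy =>
    obtain ⟨m, s, rfl⟩ := hx
    obtain ⟨n, t, rfl⟩ := hy
    exact ⟨m * a ^ t + n * a ^ s, s + t, by push_cast; field_simp; ring⟩
  | neg x _ hx =>
    obtain ⟨m, s, rfl⟩ := hx
    exact ⟨-m, s, by push_cast; ring⟩
  | mul x y _ _ hx hy =>
    obtain ⟨m, s, rfl⟩ := hx
    obtain ⟨n, t, rfl⟩ := hy
    exact ⟨m * n, s + t, by push_cast; field_simp; ring⟩

theorem inv_pow_mem_zInv (a s : ℕ) : ((a : ℚ) ^ s)⁻¹ ∈ zInv a := by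
  have h : (a : ℚ)⁻¹ ∈ zInv a := Subring.subset_closure rfl
  rw [← inv_pow]
  exact pow_mem h s

theorem inv_mem_zInv_of_dvd {p : ℕ} (ha : 0 < a) (h : p ∣ a) : (p : ℚ)⁻¹ ∈ zInv a := by
  obtain ⟨c, rfl⟩ := h
  have hp : (p : ℚ) ≠ 0 := by
    have := Nat.pos_of_mul_pos_right ha
    exact_mod_cast this.ne'
  have hc : (c : ℚ) ≠ 0 := by
    have := Nat.pos_of_mul_pos_left ha
    exact_mod_cast this.ne'
  have : (p : ℚ)⁻¹ = (((p * c : ℕ) : ℚ) ^ 1)⁻¹ * (c : ℤ) := by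
    push_cast
    field_simp
  rw [this]
  exact mul_mem (inv_pow_mem_zInv _ _) (intCast_mem _ _)

theorem den_dvd_pow_of_mem_zInv (ha : 0 < a) {q : ℚ} (hq : q ∈ zInv a) :
    ∃ s : ℕ, q.den ∣ a ^ s := by
  obtain ⟨m, s, rfl⟩ := exists_int_div_pow_of_mem_zInv ha hq
  refine ⟨s, ?_⟩
  have := Rat.den_dvd m ((a : ℤ) ^ s)
  rw [Rat.divInt_eq_div] at this
  push_cast at this
  exact_mod_cast this

theorem not_dvd_den_of_padic_norm_le_one {p : ℕ} [Fact p.Prime] {q : ℚ}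
    (h : ‖(q : ℚ_[p])‖ ≤ 1) : ¬ p ∣ q.den := by
  have h1 := PadicInt.isUnit_iff.1 (PadicInt.isUnit_den q h)
  have h2 : ‖((q.den : ℕ) : ℚ_[p])‖ = 1 := by simpa using h1
  rw [Padic.norm_natCast_eq_one_iff] at h2
  exact fun hd => (Fact.out : p.Prime).ne_one (Nat.Coprime.eq_one_of_dvd h2 hd)

theorem exists_int_of_padic_norm_le_one (ha : 0 < a) {q : ℚ} (hq : q ∈ zInv a)
    (h : ∀ p : a.primeFactors, ‖(q : ℚ_[(p : ℕ)])‖ ≤ 1) : ∃ m : ℤ, q = m := by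
  obtain ⟨s, hs⟩ := den_dvd_pow_of_mem_zInv ha hq
  have hden : q.den = 1 := by
    by_contra hne
    obtain ⟨p, hp, hpd⟩ := Nat.exists_prime_and_dvd hne
    have hpa : p ∣ a := hp.dvd_of_dvd_pow (hpd.trans hs)
    obtain ⟨P, rfl⟩ : ∃ P : a.primeFactors, (P : ℕ) = p :=
      ⟨⟨p, Nat.mem_primeFactors.2 ⟨hp, hpa, ha.ne'⟩⟩, rfl⟩
    exact not_dvd_den_of_padic_norm_le_one (h P) hpd
  exact ⟨q.num, (Rat.den_eq_one_iff q).1 hden |>.symm⟩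

/-- Multiply by `p ^ n` to reach `ℤ_p`, approximate there by a natural number to within `p ^ (-n)`,
and divide back. -/
theorem exists_rat_near_padic {p : ℕ} [Fact p.Prime] (x : ℚ_[p]) :
    ∃ (m : ℤ) (n : ℕ), ‖x + ((m / (p : ℚ) ^ n : ℚ) : ℚ_[p])‖ ≤ 1 := by
  have hp0 : (0 : ℝ) < p := by exact_mod_cast (Fact.out : p.Prime).pos
  have hp1 : (1 : ℝ) < p := by exact_mod_cast (Fact.out : p.Prime).one_lt
  have hpp : (p : ℚ_[p]) ≠ 0 := by exact_mod_cast (Fact.out : p.Prime).ne_zero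
  obtain ⟨n, hn⟩ := (((tendsto_pow_atTop_atTop_of_one_lt hp1).eventually_ge_atTop ‖x‖)).exists
  have hy : ‖(p : ℚ_[p]) ^ n * x‖ ≤ 1 := by
    rw [norm_mul, norm_pow, Padic.norm_p, inv_pow, inv_mul_le_iff₀ (by positivity), mul_one]
    exact hn
  let y : ℤ_[p] := ⟨_, hy⟩
  obtain ⟨k, hk⟩ := (PadicInt.denseRange_natCast (p := p)).exists_dist_lt y
    (show (0 : ℝ) < ((p : ℝ) ^ n)⁻¹ by positivity)
  rw [dist_eq_norm] at hk
  have hk' : ‖(p : ℚ_[p]) ^ n * x - k‖ < ((p : ℝ) ^ n)⁻¹ := hk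
  refine ⟨-k, n, ?_⟩
  have e : x + (((-(k : ℤ) : ℤ) / (p : ℚ) ^ n : ℚ) : ℚ_[p]) =
      ((p : ℚ_[p]) ^ n * x - k) / (p : ℚ_[p]) ^ n := by
    push_cast
    field_simp
    ring
  rw [e, norm_div, norm_pow, Padic.norm_p, inv_pow, div_le_one (by positivity)]
  exact hk'.le

/-- Partial fractions: the summand made for `p'` has a power of `p'` as denominator, so it is
integral at every other prime and the summands do not disturb each other. -/
theorem exists_mem_zInv_near (ha : 0 < a) (x : ∀ p : a.primeFactors, ℚ_[(p : ℕ)]) :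
    ∃ q ∈ zInv a, ∀ p : a.primeFactors, ‖x p + (q : ℚ_[(p : ℕ)])‖ ≤ 1 := by
  choose m n hmn using fun p => exists_rat_near_padic (x p)
  refine ⟨∑ p : a.primeFactors, (m p : ℚ) / ((p : ℕ) : ℚ) ^ n p, ?_, fun p => ?_⟩
  · refine sum_mem fun p _ => ?_
    rw [div_eq_mul_inv, ← inv_pow]
    exact mul_mem (intCast_mem _ _)
      (pow_mem (inv_mem_zInv_of_dvd ha (Nat.dvd_of_mem_primeFactors p.2)) _)
  · rw [← Finset.add_sum_erase _ _ (Finset.mem_univ p)]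
    push_cast
    rw [← add_assoc]
    refine (IsUltrametricDist.norm_add_le_max _ _).trans (max_le ?_ ?_)
    · have := hmn p
      push_cast at this
      exact this
    · refine IsUltrametricDist.norm_sum_le_of_forall_le_of_nonneg zero_le_one fun p' hp' => ?_
      have hne : (p' : ℕ) ≠ p := fun h => (Finset.mem_erase.1 hp').1 (Subtype.ext h)
      have h1 : ‖(((p' : ℕ) : ℕ) : ℚ_[(p : ℕ)])‖ = 1 := by
        rw [Padic.norm_natCast_eq_one_iff]
        exact (Nat.coprime_primes (Nat.prime_of_mem_primeFactors p.2)
          (Nat.prime_of_mem_primeFactors p'.2)).2 hne.symm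
      rw [norm_div, norm_pow, h1, one_pow, div_one]
      exact Padic.norm_int_le_one _

end InvertedIntegers

/-! ### The standard character of `ℝ × ∏ ℚ_p` and self-duality -/

section SolenoidCharacter

variable {a : ℕ}

/-- The one-dimensional case `ℝ × ∏_{p ∣ a} ℚ_p` of `PreSolenoid`. -/
abbrev PreLine (a : ℕ) : Type := ℝ × (∀ p : a.primeFactors, ℚ_[(p : ℕ)])

/-- `q` approximates the `p`-adic coordinates of `-x` up to `p`-adic integers. -/
def IsApprox (x : PreLine a) (q : ℚ) : Prop :=
  q ∈ zInv a ∧ ∀ p : a.primeFactors, ‖x.2 p + (q : ℚ_[(p : ℕ)])‖ ≤ 1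

theorem IsApprox.add {x y : PreLine a} {q q' : ℚ} (h : IsApprox x q) (h' : IsApprox y q') :
    IsApprox (x + y) (q + q') := by
  refine ⟨add_mem h.1 h'.1, fun p => ?_⟩
  have : (x + y).2 p + ((q + q' : ℚ) : ℚ_[(p : ℕ)]) = (x.2 p + q) + (y.2 p + q') := by
    push_cast
    simp only [Prod.snd_add, Pi.add_apply]
    ring
  rw [this]
  exact (IsUltrametricDist.norm_add_le_max _ _).trans (max_le (h.2 p) (h'.2 p))

/-- This makes the character independent of the chosen approximation: an element of `ℤ[1/a]` that is
integral at all `p ∣ a` is an integer. -/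
theorem IsApprox.exists_int_sub (ha : 0 < a) {x : PreLine a} {q q' : ℚ} (h : IsApprox x q)
    (h' : IsApprox x q') : ∃ m : ℤ, q - q' = m := by
  refine exists_int_of_padic_norm_le_one ha (sub_mem h.1 h'.1) fun p => ?_
  have : ((q - q' : ℚ) : ℚ_[(p : ℕ)]) = (x.2 p + q) - (x.2 p + q') := by push_cast; ring
  rw [this, sub_eq_add_neg]
  refine (IsUltrametricDist.norm_add_le_max _ _).trans (max_le (h.2 p) ?_)
  rw [norm_neg]
  exact h'.2 p

theorem exists_isApprox (ha : 0 < a) (x : PreLine a) : ∃ q, IsApprox x q :=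
  let ⟨q, h1, h2⟩ := exists_mem_zInv_near ha x.2
  ⟨q, h1, h2⟩

theorem isApprox_int {x : PreLine a} (hx : ∀ p, ‖x.2 p‖ ≤ 1) (m : ℤ) : IsApprox x m := by
  refine ⟨intCast_mem _ _, fun p => ?_⟩
  refine (IsUltrametricDist.norm_add_le_max _ _).trans (max_le (hx p) ?_)
  rw [Rat.cast_intCast]
  exact Padic.norm_int_le_one _

theorem coe_sub_eq_of_isApprox (ha : 0 < a) {x : PreLine a} {q q' : ℚ} (h : IsApprox x q)
    (h' : IsApprox x q') : ((x.1 - q : ℝ) : UnitAddCircle) = ((x.1 - q' : ℝ) : UnitAddCircle) := by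
  obtain ⟨m, hm⟩ := h.exists_int_sub ha h'
  rw [← sub_eq_zero, ← AddCircle.coe_sub, AddCircle.coe_eq_zero_iff]
  refine ⟨-m, ?_⟩
  have : ((q - q' : ℚ) : ℝ) = m := by rw [hm]; simp
  push_cast at this
  simp only [zsmul_eq_mul, mul_one]
  push_cast
  linarith

/-- The standard character of `ℝ × ∏_{p ∣ a} ℚ_p` that is trivial on `ℤ[1/a]`. -/
noncomputable def lineChar (ha : 0 < a) : PreLine a →+ UnitAddCircle :=
  AddMonoidHom.mk' (fun x => ((x.1 - (exists_isApprox ha x).choose : ℝ) : UnitAddCircle)) (by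
    intro x y
    rw [← AddCircle.coe_add, coe_sub_eq_of_isApprox ha (exists_isApprox ha (x + y)).choose_spec
      ((exists_isApprox ha x).choose_spec.add (exists_isApprox ha y).choose_spec)]
    congr 1
    push_cast
    simp only [Prod.fst_add]
    ring)

theorem lineChar_eq (ha : 0 < a) {x : PreLine a} {q : ℚ} (h : IsApprox x q) :
    lineChar ha x = ((x.1 - q : ℝ) : UnitAddCircle) :=
  coe_sub_eq_of_isApprox ha (exists_isApprox ha x).choose_spec h

theorem lineChar_eq_of_integral (ha : 0 < a) {x : PreLine a} (hx : ∀ p, ‖x.2 p‖ ≤ 1) :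
    lineChar ha x = (x.1 : UnitAddCircle) := by
  rw [lineChar_eq ha (isApprox_int hx 0)]
  simp

theorem continuous_lineChar (ha : 0 < a) : Continuous (lineChar ha) := by
  refine continuous_of_continuousAt_zero _ ?_
  have h : (fun x : PreLine a => (x.1 : UnitAddCircle)) =ᶠ[𝓝 0] lineChar ha := by
    have hop : ∀ᶠ x : PreLine a in 𝓝 0, ∀ p, ‖x.2 p‖ < 1 := by
      rw [eventually_all]
      intro p
      have hc : Continuous fun x : PreLine a => ‖x.2 p‖ := by fun_prop
      refine hc.continuousAt.eventually_lt_const ?_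
      simp
    filter_upwards [hop] with x hx
    exact (lineChar_eq_of_integral ha fun p => (hx p).le).symm
  refine ContinuousAt.congr ?_ h
  exact ((AddCircle.continuous_mk' 1).comp continuous_fst).continuousAt

/-- The diagonal embedding `q ↦ (q, -q, …, -q)`. -/
noncomputable def lineEmb (a : ℕ) (q : ℚ) : PreLine a := ((q : ℝ), fun p => -(q : ℚ_[(p : ℕ)]))

theorem isApprox_lineEmb {q : ℚ} (hq : q ∈ zInv a) : IsApprox (lineEmb a q) q :=
  ⟨hq, fun p => by simp [lineEmb]⟩

theorem lineChar_lineEmb (ha : 0 < a) {q : ℚ} (hq : q ∈ zInv a) :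
    lineChar ha (lineEmb a q) = 0 := by
  rw [lineChar_eq ha (isApprox_lineEmb hq)]
  simp [lineEmb]

/-- Multiplication by a rational number on `ℝ × ∏_{p ∣ a} ℚ_p`. -/
noncomputable def lineSMul (q : ℚ) (x : PreLine a) : PreLine a :=
  ((q : ℝ) * x.1, fun p => (q : ℚ_[(p : ℕ)]) * x.2 p)

theorem lineSMul_sub_lineEmb (q q' : ℚ) (x : PreLine a) :
    lineSMul q (x - lineEmb a q') = lineSMul q x - lineEmb a (q * q') := by
  ext <;> simp [lineSMul, lineEmb, mul_sub, mul_add]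

theorem exists_int_of_lineChar_eq_zero (ha : 0 < a) {x : PreLine a} (h1 : x.1 = 0)
    (h : lineChar ha x = 0) (p : a.primeFactors) : ‖x.2 p‖ ≤ 1 := by
  obtain ⟨q, hq⟩ := exists_isApprox ha x
  rw [lineChar_eq ha hq, h1, AddCircle.coe_eq_zero_iff] at h
  obtain ⟨n, hn⟩ := h
  have hqn : q = ((-n : ℤ) : ℚ) := by
    have : (q : ℝ) = ((-n : ℤ) : ℝ) := by
      simp only [zsmul_eq_mul, mul_one, zero_sub] at hn
      push_cast
      linarith
    exact_mod_cast this
  have := hq.2 p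
  have e : x.2 p = (x.2 p + (q : ℚ_[(p : ℕ)])) + ((n : ℤ) : ℚ_[(p : ℕ)]) := by
    rw [hqn]; push_cast; ring
  rw [e]
  exact (IsUltrametricDist.norm_add_le_max _ _).trans (max_le this (Padic.norm_int_le_one _))

theorem norm_natCast_lt_one (p : a.primeFactors) : ‖((a : ℕ) : ℚ_[(p : ℕ)])‖ < 1 :=
  Padic.norm_natCast_lt_one_iff.2 (Nat.dvd_of_mem_primeFactors p.2)

theorem eq_zero_of_forall_inv_pow_mul {p : ℕ} [Fact p.Prime] {c : ℕ} (hc : ‖(c : ℚ_[p])‖ < 1)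
    (hc0 : c ≠ 0) {x : ℚ_[p]} (h : ∀ s : ℕ, ‖((c : ℚ_[p]) ^ s)⁻¹ * x‖ ≤ 1) : x = 0 := by
  rw [← norm_le_zero_iff]
  refine ge_of_tendsto' (tendsto_pow_atTop_nhds_zero_of_lt_one (norm_nonneg _) hc) fun s => ?_
  have hpos : 0 < ‖(c : ℚ_[p])‖ := norm_pos_iff.2 (by exact_mod_cast hc0)
  have := h s
  rw [norm_mul, norm_inv, norm_pow, inv_mul_le_iff₀ (by positivity), mul_one] at this
  exact this

/-- Subtracting an approximation makes the `p`-adic coordinates integral; the test `q = 1` then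
shows that the real coordinate is an integer, which is subtracted as well. With real coordinate `0`,
the tests `q = a ^ (-s)` make each `p`-adic coordinate divisible by all powers of `a`, hence zero.
-/
theorem mem_range_lineEmb_of_lineChar (ha : 0 < a) {x : PreLine a}
    (h : ∀ q ∈ zInv a, lineChar ha (lineSMul q x) = 0) : ∃ q ∈ zInv a, x = lineEmb a q := by
  obtain ⟨q0, hq0⟩ := exists_isApprox ha x
  have hch : ∀ q' ∈ zInv a, ∀ q ∈ zInv a, lineChar ha (lineSMul q (x - lineEmb a q')) = 0 := by
    intro q' hq' q hq
    rw [lineSMul_sub_lineEmb, map_sub, h q hq, lineChar_lineEmb ha (mul_mem hq hq'), sub_zero]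
  have hone : ∀ y : PreLine a, lineSMul 1 y = y := fun y => by ext <;> simp [lineSMul]
  have hint : ∀ p, ‖(x - lineEmb a q0).2 p‖ ≤ 1 := fun p => by
    have := hq0.2 p
    simpa [lineEmb] using this
  have h1 := hch q0 hq0.1 1 (one_mem _)
  rw [hone, lineChar_eq_of_integral ha hint, AddCircle.coe_eq_zero_iff] at h1
  obtain ⟨m, hm⟩ := h1
  have hqm : q0 + m ∈ zInv a := add_mem hq0.1 (intCast_mem _ _)
  refine ⟨q0 + m, hqm, ?_⟩
  have hfst : (x - lineEmb a (q0 + m)).1 = 0 := by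
    simp only [zsmul_eq_mul, mul_one, lineEmb, Prod.fst_sub] at hm ⊢
    push_cast
    linarith
  rw [← sub_eq_zero]
  refine Prod.ext hfst (funext fun p => ?_)
  refine eq_zero_of_forall_inv_pow_mul (norm_natCast_lt_one p) ha.ne' fun s => ?_
  have h2 := exists_int_of_lineChar_eq_zero ha (x := lineSMul ((a : ℚ) ^ s)⁻¹ (x - lineEmb a (q0 + m)))
    (by simp only [lineSMul, hfst, mul_zero]) (hch _ hqm _ (inv_pow_mem_zInv a s)) p
  simpa [lineSMul] using h2

/-- With trivial `p`-adic part the character is the real coordinate modulo `1`, so `x.1 / p ^ v` is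
an integer for every `v`. -/
theorem eq_zero_of_lineChar_real (ha : 0 < a) {x : PreLine a} (hx : x.2 = 0) {p : ℕ} (hp : 1 < p)
    (h : ∀ v : ℕ, lineChar ha (lineSMul ((p : ℚ) ^ v)⁻¹ x) = 0) : x = 0 := by
  have hp' : (1 : ℝ) < p := by exact_mod_cast hp
  have hp0 : (0 : ℝ) < p := by linarith
  refine Prod.ext ?_ hx
  obtain ⟨v, hv⟩ := ((tendsto_pow_atTop_atTop_of_one_lt hp').eventually_gt_atTop |x.1|).exists
  have h1 := h v
  rw [lineChar_eq_of_integral ha (fun p => by simp [lineSMul, hx]),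
    AddCircle.coe_eq_zero_iff] at h1
  obtain ⟨n, hn⟩ := h1
  have hpv : (0 : ℝ) < (p : ℝ) ^ v := by positivity
  simp only [zsmul_eq_mul, mul_one, lineSMul] at hn
  push_cast at hn
  have hx1 : x.1 = n * (p : ℝ) ^ v := by rw [hn]; field_simp
  have hn0 : n = 0 := by
    rw [hx1, abs_mul, abs_of_pos hpv] at hv
    have : |(n : ℝ)| < 1 := by
      by_contra! hge
      nlinarith
    have h2 : |n| < 1 := by exact_mod_cast this
    exact Int.abs_lt_one_iff.1 h2
  rw [hx1, hn0]
  simp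

theorem eq_zero_of_lineChar_padic (ha : 0 < a) {x : PreLine a} (hx : x.1 = 0) {p : ℕ}
    (hx2 : ∀ q : a.primeFactors, (q : ℕ) ≠ p → x.2 q = 0)
    (h : ∀ v : ℕ, lineChar ha (lineSMul ((p : ℚ) ^ v)⁻¹ x) = 0) : x = 0 := by
  refine Prod.ext hx (funext fun q => ?_)
  by_cases hq : (q : ℕ) = p
  · subst hq
    refine eq_zero_of_forall_inv_pow_mul (Padic.norm_p_lt_one)
      (Nat.prime_of_mem_primeFactors q.2).ne_zero fun s => ?_
    have := exists_int_of_lineChar_eq_zero ha (by simp [lineSMul, hx]) (h s) q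
    simpa [lineSMul] using this
  · exact hx2 q hq

end SolenoidCharacter

/-! ### Compactness, discreteness and characters of the solenoid -/

section SolenoidTopology

variable {a r : ℕ}

/-- The `j`-th coordinate of an element of `ℝ^r × ∏_{p ∣ a} ℚ_p^r`. -/
def preCoord (x : PreSolenoid a r) (j : Fin r) : PreLine a := (x.1 j, fun p => x.2 p j)

theorem eq_of_preCoord {x y : PreSolenoid a r} (h : ∀ j, preCoord x j = preCoord y j) : x = y := by
  refine Prod.ext (funext fun j => congrArg Prod.fst (h j)) (funext fun p => funext fun j => ?_)
  exact congrFun (congrArg Prod.snd (h j)) p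

theorem preCoord_solenoidEmb (z : Fin r → zInv a) (j : Fin r) :
    preCoord (solenoidEmb a r z) j = lineEmb a (z j) := rfl

theorem exists_solenoidEmb_eq {x : PreSolenoid a r}
    (h : ∀ j, ∃ q ∈ zInv a, preCoord x j = lineEmb a q) : x ∈ (solenoidEmb a r).range := by
  choose q hq hx using h
  refine ⟨fun j => ⟨q j, hq j⟩, eq_of_preCoord fun j => ?_⟩
  rw [hx, preCoord_solenoidEmb]

/-- Modulo `ℤ[1/a]^r` the `p`-adic coordinates can be made integral and then, by integers, the real
ones brought into `[0, 1)`; so the closed unit ball maps onto the quotient. -/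
theorem compactSpace_solenoid (ha : 0 < a) : CompactSpace (Solenoid a r) := by
  have hc := (isCompact_closedBall (0 : PreSolenoid a r) 1).image
    (QuotientAddGroup.continuous_mk (N := (solenoidEmb a r).range))
  refine ⟨?_⟩
  convert hc
  symm
  rw [Set.eq_univ_iff_forall]
  intro x
  obtain ⟨X, rfl⟩ := QuotientAddGroup.mk_surjective x
  choose q hq hX using fun j => exists_isApprox ha (preCoord X j)
  let z : Fin r → zInv a := fun j =>
    ⟨q j + (⌊X.1 j - q j⌋ : ℤ), add_mem (hq j) (intCast_mem _ _)⟩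
  refine ⟨X - solenoidEmb a r z, ?_, ?_⟩
  · rw [mem_closedBall_zero_iff, Prod.norm_def]
    refine max_le ?_ ?_
    · rw [pi_norm_le_iff_of_nonneg zero_le_one]
      intro j
      have : (X - solenoidEmb a r z).1 j = Int.fract (X.1 j - q j) := by
        simp only [solenoidEmb, z, Prod.fst_sub, Int.fract, AddMonoidHom.coe_mk, ZeroHom.coe_mk,
          Pi.sub_apply]
        push_cast
        ring
      rw [this, Real.norm_of_nonneg (Int.fract_nonneg _)]
      exact (Int.fract_lt_one _).le
    · rw [pi_norm_le_iff_of_nonneg zero_le_one]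
      intro p
      rw [pi_norm_le_iff_of_nonneg zero_le_one]
      intro j
      have : (X - solenoidEmb a r z).2 p j =
          (X.2 p j + q j) + ((⌊X.1 j - q j⌋ : ℤ) : ℚ_[(p : ℕ)]) := by
        simp only [solenoidEmb, z, Prod.snd_sub, AddMonoidHom.coe_mk, ZeroHom.coe_mk,
          Pi.sub_apply]
        push_cast
        ring
      rw [this]
      exact (IsUltrametricDist.norm_add_le_max _ _).trans
        (max_le (hX j p) (Padic.norm_int_le_one _))
  · have hz : solenoidEmb a r z ∈ (solenoidEmb a r).range := ⟨z, rfl⟩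
    rw [QuotientAddGroup.mk_sub, (QuotientAddGroup.eq_zero_iff _).2 hz, sub_zero]

theorem eq_zero_of_mem_range_solenoidEmb (ha : 0 < a) {x : PreSolenoid a r}
    (hx : x ∈ (solenoidEmb a r).range) (hn : ‖x‖ < 1) : x = 0 := by
  obtain ⟨z, rfl⟩ := hx
  suffices h : z = 0 by rw [h, map_zero]
  funext j
  have h1 : |((z j : ℚ) : ℝ)| < 1 := by
    have := (norm_le_pi_norm (solenoidEmb a r z).1 j).trans (norm_fst_le _)
    exact this.trans_lt hn
  have h2 : ∀ p : a.primeFactors, ‖((z j : ℚ) : ℚ_[(p : ℕ)])‖ ≤ 1 := fun p => by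
    have h3 := (norm_le_pi_norm ((solenoidEmb a r z).2 p) j).trans
      ((norm_le_pi_norm (solenoidEmb a r z).2 p).trans (norm_snd_le _))
    have h4 : (solenoidEmb a r z).2 p j = -((z j : ℚ) : ℚ_[(p : ℕ)]) := rfl
    rw [h4, norm_neg] at h3
    exact h3.trans hn.le
  obtain ⟨m, hm⟩ := exists_int_of_padic_norm_le_one ha (z j).2 h2
  rw [hm] at h1
  push_cast at h1
  have hm0 : m = 0 := Int.abs_lt_one_iff.1 (by exact_mod_cast h1)
  exact Subtype.ext (by rw [hm, hm0]; simp)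

/-- The pairing of a rational row vector with an element of `ℝ^r × ∏_{p ∣ a} ℚ_p^r`. -/
noncomputable def rowPair (c : Fin r → ℚ) (x : PreSolenoid a r) : PreLine a :=
  (∑ j, (c j : ℝ) * x.1 j, fun p => ∑ j, (c j : ℚ_[(p : ℕ)]) * x.2 p j)

theorem rowPair_add_left (c d : Fin r → ℚ) (x : PreSolenoid a r) :
    rowPair (c + d) x = rowPair c x + rowPair d x := by
  ext <;> simp [rowPair, add_mul, Finset.sum_add_distrib]

theorem rowPair_add_right (c : Fin r → ℚ) (x y : PreSolenoid a r) :
    rowPair c (x + y) = rowPair c x + rowPair c y := by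
  ext <;> simp [rowPair, mul_add, Finset.sum_add_distrib]

theorem rowPair_solenoidEmb (c z : Fin r → zInv a) :
    rowPair (fun j => (c j : ℚ)) (solenoidEmb a r z) = lineEmb a (∑ j, c j * z j : zInv a) := by
  ext <;> simp [rowPair, lineEmb, solenoidEmb]

theorem continuous_rowPair (c : Fin r → ℚ) :
    Continuous (rowPair c : PreSolenoid a r → PreLine a) := by
  unfold rowPair
  fun_prop

theorem rowPair_single [DecidableEq (Fin r)] (q : ℚ) (j : Fin r) (x : PreSolenoid a r) :
    rowPair (Pi.single j q) x = lineSMul q (preCoord x j) := by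
  refine Prod.ext ?_ (funext fun p => ?_)
  · simp only [rowPair, lineSMul, preCoord]
    rw [Finset.sum_eq_single j (fun i _ hi => by simp [Pi.single_eq_of_ne hi]) (by simp)]
    simp
  · simp only [rowPair, lineSMul, preCoord]
    rw [Finset.sum_eq_single j (fun i _ hi => by simp [Pi.single_eq_of_ne hi]) (by simp)]
    simp

/-- The characters of `Ω_a^r`, parametrised by the row vectors over `ℤ[1/a]`. -/
noncomputable def solenoidChar (ha : 0 < a) (r : ℕ) :
    (Fin r → zInv a) →+ Solenoid a r →+ UnitAddCircle :=
  AddMonoidHom.mk' (fun c => QuotientAddGroup.lift _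
    (AddMonoidHom.mk' (fun x => lineChar ha (rowPair (fun j => (c j : ℚ)) x)) (fun x y => by
      rw [rowPair_add_right, map_add]))
    (by
      rintro _ ⟨z, rfl⟩
      rw [AddMonoidHom.mem_ker, AddMonoidHom.mk'_apply, rowPair_solenoidEmb, lineChar_lineEmb ha (Subtype.prop _)])) (by
    intro c d
    refine AddMonoidHom.ext fun x => ?_
    obtain ⟨X, rfl⟩ := QuotientAddGroup.mk_surjective x
    change lineChar ha (rowPair ((fun j => (c j : ℚ)) + fun j => (d j : ℚ)) X) =
      lineChar ha (rowPair _ X) + lineChar ha (rowPair _ X)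
    rw [rowPair_add_left, map_add])

theorem solenoidChar_mk (ha : 0 < a) (c : Fin r → zInv a) (x : PreSolenoid a r) :
    solenoidChar ha r c (x : Solenoid a r) = lineChar ha (rowPair (fun j => (c j : ℚ)) x) := rfl

theorem continuous_solenoidChar (ha : 0 < a) (c : Fin r → zInv a) :
    Continuous (solenoidChar ha r c) :=
  ((continuous_lineChar ha).comp (continuous_rowPair _)).quotient_lift _

theorem eq_zero_of_solenoidChar (ha : 0 < a) {x : Solenoid a r}
    (h : ∀ c, solenoidChar ha r c x = 0) : x = 0 := by
  classical
  obtain ⟨X, rfl⟩ := QuotientAddGroup.mk_surjective x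
  rw [QuotientAddGroup.eq_zero_iff]
  refine exists_solenoidEmb_eq fun j => mem_range_lineEmb_of_lineChar ha fun q hq => ?_
  have h1 := h (Pi.single j ⟨q, hq⟩)
  rw [solenoidChar_mk] at h1
  have h2 : (fun i => ((Pi.single j ⟨q, hq⟩ : Fin r → zInv a) i : ℚ)) = Pi.single j q := by
    funext i
    by_cases hi : i = j
    · subst hi; simp
    · simp [Pi.single_eq_of_ne hi]
  rwa [h2, rowPair_single] at h1

theorem t2Space_solenoid (ha : 0 < a) : T2Space (Solenoid a r) := by
  refine T2Space.of_injective_continuous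
    (f := fun (x : Solenoid a r) (c : Fin r → zInv a) => solenoidChar ha r c x) ?_
    (continuous_pi fun c => continuous_solenoidChar ha c)
  intro x y hxy
  rw [← sub_eq_zero]
  refine eq_zero_of_solenoidChar ha fun c => ?_
  rw [map_sub, sub_eq_zero]
  exact congrFun hxy c

end SolenoidTopology

/-! ### The action of `K` through the matrices `M(α)` -/

section FieldAction

variable {a r : ℕ}

/-- The diagonal action of a rational matrix on `ℝ^r × ∏_{p ∣ a} ℚ_p^r`. -/
noncomputable def ratAct (M : Matrix (Fin r) (Fin r) ℚ) (x : PreSolenoid a r) : PreSolenoid a r :=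
  ((M.map fun q => (q : ℝ)).mulVec x.1, fun p => (M.map fun q => (q : ℚ_[(p : ℕ)])).mulVec (x.2 p))

theorem continuous_ratAct (M : Matrix (Fin r) (Fin r) ℚ) :
    Continuous (ratAct M : PreSolenoid a r → PreSolenoid a r) := by
  unfold ratAct
  refine Continuous.prodMk ?_ (continuous_pi fun p => ?_)
  · exact continuous_const.matrix_mulVec continuous_fst
  · exact continuous_const.matrix_mulVec ((continuous_apply p).comp continuous_snd)

/-- The ring homomorphism from rational matrices to endomorphisms of `ℝ^r × ∏_{p ∣ a} ℚ_p^r`. -/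
noncomputable def ratActHom (a r : ℕ) :
    Matrix (Fin r) (Fin r) ℚ →+* AddMonoid.End (PreSolenoid a r) where
  toFun M := AddMonoidHom.mk' (ratAct M) fun x y => by
    ext <;> simp [ratAct, Matrix.mulVec_add]
  map_one' := by
    refine AddMonoidHom.ext fun x => ?_
    change ratAct 1 x = x
    simp only [ratAct]
    refine Prod.ext ?_ (funext fun p => ?_)
    · simp [Matrix.map_one]
    · simp [Matrix.map_one]
  map_zero' := by
    refine AddMonoidHom.ext fun x => ?_
    change ratAct 0 x = 0
    simp only [ratAct]
    refine Prod.ext ?_ (funext fun p => ?_)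
    · simp [Matrix.map_zero]
    · simp [Matrix.map_zero]
  map_mul' M N := by
    refine AddMonoidHom.ext fun x => ?_
    change ratAct (M * N) x = ratAct M (ratAct N x)
    simp only [ratAct]
    refine Prod.ext ?_ (funext fun p => ?_)
    · change ((M * N).map (Rat.castHom ℝ)).mulVec x.1 = _
      rw [Matrix.map_mul, ← Matrix.mulVec_mulVec]
      rfl
    · change ((M * N).map (Rat.castHom ℚ_[(p : ℕ)])).mulVec (x.2 p) = _
      rw [Matrix.map_mul, ← Matrix.mulVec_mulVec]
      rfl
  map_add' M N := by
    refine AddMonoidHom.ext fun x => ?_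
    change ratAct (M + N) x = ratAct M x + ratAct N x
    simp only [ratAct]
    refine Prod.ext ?_ (funext fun p => ?_)
    · change ((M + N).map (Rat.castHom ℝ)).mulVec x.1 = _
      rw [Matrix.map_add _ (map_add _), Matrix.add_mulVec]
      rfl
    · change ((M + N).map (Rat.castHom ℚ_[(p : ℕ)])).mulVec (x.2 p) = _
      rw [Matrix.map_add _ (map_add _), Matrix.add_mulVec]
      rfl

variable {K : Type*} [Field K] [Algebra ℚ K] (b : Basis (Fin r) ℚ K)

theorem multMatrix_eq_transpose (α : K) : multMatrix b α = (Algebra.leftMulMatrix b α).transpose := by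
  ext i j
  simp [multMatrix, Algebra.leftMulMatrix_eq_repr_mul]

/-- `α ↦ M(α)` as a ring homomorphism. -/
noncomputable def multMatrixHom : K →+* Matrix (Fin r) (Fin r) ℚ where
  toFun := multMatrix b
  map_one' := by rw [multMatrix_eq_transpose, map_one, Matrix.transpose_one]
  map_zero' := by rw [multMatrix_eq_transpose, map_zero, Matrix.transpose_zero]
  map_mul' α β := by
    -- Transposition reverses products; commutativity of `K` restores the order.
    rw [mul_comm]
    simp only [multMatrix_eq_transpose, map_mul, Matrix.transpose_mul]
  map_add' α β := by
    simp only [multMatrix_eq_transpose, map_add, Matrix.transpose_add]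

/-- `K` acts on `ℝ^r × ∏_{p ∣ a} ℚ_p^r` through the matrices `M(α)`. -/
@[reducible]
noncomputable def preSolenoidModule (a : ℕ) : Module K (PreSolenoid a r) :=
  Module.compHom _ ((ratActHom a r).comp (multMatrixHom b))

theorem preSolenoidModule_smul (α : K) (x : PreSolenoid a r) :
    letI := preSolenoidModule b a
    α • x = ratAct (multMatrix b α) x := rfl

theorem preSolenoidModule_continuousConstSMul (a : ℕ) :
    letI := preSolenoidModule b a
    ContinuousConstSMul K (PreSolenoid a r) :=
  letI := preSolenoidModule b a
  ⟨fun α => continuous_ratAct (multMatrix b α)⟩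

theorem exists_nsmul_ratAct_mem (M : Matrix (Fin r) (Fin r) ℚ) : ∃ m : ℕ, 0 < m ∧
    ∀ γ ∈ (solenoidEmb a r).range, m • ratAct M γ ∈ (solenoidEmb a r).range := by
  refine ⟨∏ x : Fin r × Fin r, (M x.1 x.2).den, Finset.prod_pos fun _ _ => Rat.den_pos _, ?_⟩
  set m := ∏ x : Fin r × Fin r, (M x.1 x.2).den with hm
  have hint : ∀ j l, ∃ n : ℤ, (m : ℚ) * M j l = n := by
    intro j l
    obtain ⟨c, hc⟩ := Finset.dvd_prod_of_mem (fun x : Fin r × Fin r => (M x.1 x.2).den)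
      (Finset.mem_univ (j, l))
    refine ⟨c * (M j l).num, ?_⟩
    rw [hm, hc]
    push_cast
    rw [mul_comm ((M j l).den : ℚ), mul_assoc, Rat.den_mul_eq_num]
  choose n hn using hint
  rintro _ ⟨z, rfl⟩
  refine ⟨fun j => ∑ l, (n j l : zInv a) * z l, ?_⟩
  have key : ∀ (F : Type) [Field F] [CharZero F] (j : Fin r) (w : Fin r → F),
      ∑ l, (n j l : F) * w l = m • ∑ l, (M j l : F) * w l := by
    intro F _ _ j w
    rw [nsmul_eq_mul, Finset.mul_sum]
    refine Finset.sum_congr rfl fun l _ => ?_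
    rw [← mul_assoc]
    congr 1
    have := hn j l
    have h2 : ((m : ℚ) * M j l : ℚ) = ((n j l : ℤ) : ℚ) := this
    have h3 := congrArg (fun q : ℚ => (q : F)) h2
    push_cast at h3
    exact h3.symm
  refine Prod.ext (funext fun j => ?_) (funext fun p => funext fun j => ?_)
  · have := key ℝ j fun l => ((z l : ℚ) : ℝ)
    simp only [solenoidEmb, ratAct, AddMonoidHom.coe_mk, ZeroHom.coe_mk, Prod.smul_fst,
      Pi.smul_apply, Matrix.mulVec, dotProduct, Matrix.map_apply]
    rw [← this]
    push_cast
    rfl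
  · have := key ℚ_[(p : ℕ)] j fun l => -((z l : ℚ) : ℚ_[(p : ℕ)])
    simp only [solenoidEmb, ratAct, AddMonoidHom.coe_mk, ZeroHom.coe_mk, Prod.smul_snd,
      Pi.smul_apply, Matrix.mulVec, dotProduct, Matrix.map_apply]
    rw [← this]
    push_cast
    simp only [mul_neg, Finset.sum_neg_distrib]

end FieldAction

/-! ### Diagonalisation by embeddings -/

section LocalCoordinates

variable {r : ℕ} {K : Type*} [Field K] [Algebra ℚ K] (b : Basis (Fin r) ℚ K)

/-- The columns of the matrix `Q` with entries `e j (b i)` are eigenvectors of every `M(α)`. It is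
invertible since the square of its determinant is the discriminant of the basis, and `L = Q⁻¹`. -/
theorem exists_diagonalisation (k : Type*) [Field k] [CharZero k] [IsAlgClosed k] :
    ∃ (θ : Fin r → K →+* k) (L : Matrix (Fin r) (Fin r) k), IsUnit L.det ∧
      ∀ α, L * (multMatrix b α).map (fun q => (q : k)) =
        Matrix.diagonal (fun i => θ i α) * L := by
  classical
  have : FiniteDimensional ℚ K := b.finiteDimensional_of_finite
  have hcard : Fintype.card (Fin r) = Fintype.card (K →ₐ[ℚ] k) := by
    rw [AlgHom.card, Fintype.card_fin, finrank_eq_card_basis b, Fintype.card_fin]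
  let e : Fin r ≃ (K →ₐ[ℚ] k) := Fintype.equivOfCardEq hcard
  set Q := Algebra.embeddingsMatrixReindex ℚ k b e with hQ
  have hdet : IsUnit Q.det := by
    rw [isUnit_iff_ne_zero]
    intro h0
    have h1 := Algebra.discr_eq_det_embeddingsMatrixReindex_pow_two ℚ k b e
    rw [← hQ, h0, zero_pow two_ne_zero, map_eq_zero] at h1
    exact Algebra.discr_not_zero_of_basis ℚ b h1
  have hQij : ∀ i j, Q i j = e j (b i) := fun i j => by
    simp [hQ, Algebra.embeddingsMatrixReindex]
  have hMQ : ∀ α, (multMatrix b α).map (fun q => (q : k)) * Q =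
      Q * Matrix.diagonal (fun i => e i α) := by
    intro α
    ext i j
    rw [Matrix.mul_diagonal, Matrix.mul_apply]
    simp only [hQij, Matrix.map_apply]
    have h := congrArg (e j) (multMatrix_spec b α i)
    rw [map_mul, map_sum] at h
    rw [mul_comm, h]
    refine Finset.sum_congr rfl fun l _ => ?_
    rw [map_smul, Algebra.smul_def, eq_ratCast]
  refine ⟨fun i => (e i : K →+* k), Q⁻¹, by
    rw [Matrix.det_nonsing_inv]; exact hdet.ringInverse, fun α => ?_⟩
  have h1 : Q⁻¹ * ((multMatrix b α).map (fun q => (q : k)) * Q) * Q⁻¹ =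
      Q⁻¹ * (Q * Matrix.diagonal (fun i => e i α)) * Q⁻¹ := by rw [hMQ]
  rw [← mul_assoc, mul_assoc, Matrix.mul_nonsing_inv _ hdet, mul_one, ← mul_assoc,
    Matrix.nonsing_inv_mul _ hdet, one_mul] at h1
  exact h1

/-- The absolute values `|θ_i|` and the norms of coordinates diagonalising the matrices `M α` over
a normed field extending `F`. -/
structure LocalCoord (F : Type*) [NormedField F] (M : K → Matrix (Fin r) (Fin r) F) where
  a : Fin r → AbsoluteValue K ℝ
  n : Fin r → AddGroupSeminorm (Fin r → F)
  n_smul : ∀ i α x, n i ((M α).mulVec x) = a i α * n i x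
  C : ℝ
  C_pos : 0 < C
  n_le : ∀ i x, n i x ≤ C * ‖x‖
  le_n : ∀ x, ‖x‖ ≤ C * ∑ i, n i x

/-- The absolute value of `K` induced by an embedding into a normed field. -/
noncomputable def embAbs {k : Type*} [NormedField k] (θ : K →+* k) : AbsoluteValue K ℝ where
  toFun α := ‖θ α‖
  map_mul' α β := by rw [map_mul, norm_mul]
  nonneg' α := norm_nonneg _
  eq_zero' α := by rw [norm_eq_zero, map_eq_zero]
  add_le' α β := by rw [map_add]; exact norm_add_le _ _

/-- The seminorm `x ↦ ‖∑ j, l j * x j‖`. -/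
noncomputable def rowSeminorm {F k : Type*} [NormedField F] [NormedField k] [NormedAlgebra F k]
    (l : Fin r → k) : AddGroupSeminorm (Fin r → F) where
  toFun x := ‖∑ j, l j * algebraMap F k (x j)‖
  map_zero' := by simp
  add_le' x y := by
    simp only [Pi.add_apply, map_add, mul_add, Finset.sum_add_distrib]
    exact norm_add_le _ _
  neg' x := by simp

theorem exists_localCoord (F k : Type*) [NormedField F] [CharZero F] [NormedField k] [CharZero k]
    [IsAlgClosed k] [NormedAlgebra F k] :
    ∃ A : LocalCoord F (fun α => (multMatrix b α).map (fun q => (q : F))),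
      ∀ i, ∃ θ : K →+* k, ∀ α, A.a i α = ‖θ α‖ := by
  obtain ⟨θ, L, hL, hLM⟩ := exists_diagonalisation b k
  -- The entries of `L` bound the coordinates by the vector, those of `L⁻¹` the vector by its
  -- coordinates; one constant serves both.
  set C : ℝ := 1 + (∑ i, ∑ j, ‖L i j‖ + ∑ i, ∑ j, ‖L⁻¹ i j‖) with hC
  have hs1 : 0 ≤ ∑ i, ∑ j, ‖L i j‖ :=
    Finset.sum_nonneg fun _ _ => Finset.sum_nonneg fun _ _ => norm_nonneg _
  have hs2 : 0 ≤ ∑ i, ∑ j, ‖L⁻¹ i j‖ :=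
    Finset.sum_nonneg fun _ _ => Finset.sum_nonneg fun _ _ => norm_nonneg _
  have hentry : ∀ (N : Matrix (Fin r) (Fin r) k) i j, ‖N i j‖ ≤ ∑ i, ∑ j, ‖N i j‖ := by
    intro N i j
    refine (Finset.single_le_sum (f := fun j => ‖N i j‖) (fun _ _ => norm_nonneg _)
      (Finset.mem_univ j)).trans ?_
    exact Finset.single_le_sum (f := fun i => ∑ j, ‖N i j‖)
      (fun _ _ => Finset.sum_nonneg fun _ _ => norm_nonneg _) (Finset.mem_univ i)
  have hrow : ∀ (N : Matrix (Fin r) (Fin r) k) i, ∑ j, ‖N i j‖ ≤ ∑ i, ∑ j, ‖N i j‖ := by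
    intro N i
    exact Finset.single_le_sum (f := fun i => ∑ j, ‖N i j‖)
      (fun _ _ => Finset.sum_nonneg fun _ _ => norm_nonneg _) (Finset.mem_univ i)
  refine ⟨⟨fun i => embAbs (θ i), fun i => rowSeminorm (L i), ?_, C, by linarith, ?_, ?_⟩,
    fun i => ⟨θ i, fun α => rfl⟩⟩
  · intro i α x
    change ‖∑ j, L i j * algebraMap F k (((multMatrix b α).map (fun q => (q : F))).mulVec x j)‖ =
      ‖θ i α‖ * ‖∑ j, L i j * algebraMap F k (x j)‖
    rw [← norm_mul]
    congr 1
    have h1 : ∀ j, algebraMap F k (((multMatrix b α).map (fun q => (q : F))).mulVec x j) =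
        (((multMatrix b α).map (fun q => (q : k))).mulVec fun j => algebraMap F k (x j)) j := by
      intro j
      simp [Matrix.mulVec, dotProduct, map_sum, map_mul, map_ratCast]
    simp only [h1]
    have h2 := congrFun (congrArg (fun N => N.mulVec fun j => algebraMap F k (x j)) (hLM α)) i
    simp only [← Matrix.mulVec_mulVec, Matrix.mulVec_diagonal] at h2
    exact h2
  · intro i x
    change ‖∑ j, L i j * algebraMap F k (x j)‖ ≤ C * ‖x‖
    calc _ ≤ ∑ j, ‖L i j‖ * ‖x‖ := by
          refine norm_sum_le_of_le _ fun j _ => ?_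
          rw [norm_mul, norm_algebraMap']
          gcongr
          exact norm_le_pi_norm x j
      _ = (∑ j, ‖L i j‖) * ‖x‖ := by rw [Finset.sum_mul]
      _ ≤ C * ‖x‖ := by
          gcongr
          have := hrow L i
          linarith
  · intro x
    let y : Fin r → k := L.mulVec fun j => algebraMap F k (x j)
    change ‖x‖ ≤ C * ∑ i, ‖y i‖
    have hx : ∀ j, algebraMap F k (x j) = ∑ i, L⁻¹ j i * y i := by
      intro j
      have : L⁻¹.mulVec y = fun j => algebraMap F k (x j) := by
        rw [Matrix.mulVec_mulVec, Matrix.nonsing_inv_mul _ hL, Matrix.one_mulVec]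
      exact (congrFun this j).symm
    have hsum : 0 ≤ ∑ i, ‖y i‖ := Finset.sum_nonneg fun _ _ => norm_nonneg _
    rw [pi_norm_le_iff_of_nonneg (mul_nonneg (by linarith) hsum)]
    intro j
    rw [← norm_algebraMap' k, hx, Finset.mul_sum]
    refine norm_sum_le_of_le _ fun i _ => ?_
    rw [norm_mul]
    change ‖L⁻¹ j i‖ * ‖y i‖ ≤ C * ‖y i‖
    gcongr
    have := hentry L⁻¹ j i
    linarith

end LocalCoordinates

/-! ### All places together -/

section GlobalCoordinates

variable {a r : ℕ} {K : Type*} [Field K] [Algebra ℚ K] (b : Basis (Fin r) ℚ K)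

/-- Coordinates on the Archimedean component and on all `p`-adic components together. -/
noncomputable def globalCoord
    (R : LocalCoord ℝ (fun α => (multMatrix b α).map (fun q => (q : ℝ))))
    (P : ∀ p : a.primeFactors,
      LocalCoord ℚ_[(p : ℕ)] (fun α => (multMatrix b α).map (fun q => (q : ℚ_[(p : ℕ)])))) :
    letI := preSolenoidModule b a
    CoordSystem K (PreSolenoid a r) (Option a.primeFactors × Fin r) :=
  letI := preSolenoidModule b a
  { a := fun i => match i.1 with
      | none => R.a i.2
      | some p => (P p).a i.2
    n := fun i => match i.1 with
      | none => (R.n i.2).comp (AddMonoidHom.fst _ _)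
      | some p => ((P p).n i.2).comp ((Pi.evalAddMonoidHom _ p).comp (AddMonoidHom.snd _ _))
    n_smul := by
      rintro ⟨_ | p, i⟩ α x
      · exact R.n_smul i α x.1
      · exact (P p).n_smul i α (x.2 p)
    C := R.C + ∑ p, (P p).C
    C_pos := add_pos_of_pos_of_nonneg R.C_pos (Finset.sum_nonneg fun p _ => (P p).C_pos.le)
    n_le := by
      have hP : 0 ≤ ∑ p, (P p).C := Finset.sum_nonneg fun p _ => (P p).C_pos.le
      have hR := R.C_pos
      rintro ⟨_ | p, i⟩ x
      · refine (R.n_le i x.1).trans ?_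
        gcongr
        · linarith
        · exact norm_fst_le x
      · refine ((P p).n_le i (x.2 p)).trans ?_
        have h1 : (P p).C ≤ ∑ p, (P p).C :=
          Finset.single_le_sum (f := fun p => (P p).C) (fun p _ => (P p).C_pos.le)
            (Finset.mem_univ p)
        gcongr
        · linarith
        · exact (norm_le_pi_norm x.2 p).trans (norm_snd_le x)
    le_n := by
      intro x
      have hP : 0 ≤ ∑ p, (P p).C := Finset.sum_nonneg fun p _ => (P p).C_pos.le
      have hR := R.C_pos
      have hn1 : ∀ y, 0 ≤ ∑ i, R.n i y := fun y => Finset.sum_nonneg fun i _ => apply_nonneg _ _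
      have hn2 : ∀ p y, 0 ≤ ∑ i, (P p).n i y :=
        fun p y => Finset.sum_nonneg fun i _ => apply_nonneg _ _
      rw [Fintype.sum_prod_type, Fintype.sum_option]
      change ‖x‖ ≤ (R.C + ∑ p, (P p).C) * (∑ i, R.n i x.1 + ∑ p, ∑ i, (P p).n i (x.2 p))
      have hs : 0 ≤ ∑ p, ∑ i, (P p).n i (x.2 p) := Finset.sum_nonneg fun p _ => hn2 p _
      rw [Prod.norm_def]
      refine max_le ?_ ?_
      · refine (R.le_n x.1).trans ?_
        have := hn1 x.1
        gcongr <;> linarith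
      · rw [pi_norm_le_iff_of_nonneg (mul_nonneg (by linarith) (add_nonneg (hn1 _) hs))]
        intro p
        refine ((P p).le_n (x.2 p)).trans ?_
        have h1 : (P p).C ≤ ∑ p, (P p).C :=
          Finset.single_le_sum (f := fun p => (P p).C) (fun p _ => (P p).C_pos.le)
            (Finset.mem_univ p)
        have h2 : ∑ i, (P p).n i (x.2 p) ≤ ∑ p, ∑ i, (P p).n i (x.2 p) :=
          Finset.single_le_sum (f := fun p => ∑ i, (P p).n i (x.2 p)) (fun p _ => hn2 p _)
            (Finset.mem_univ p)
        have h3 := hn1 x.1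
        have h4 := hn2 p (x.2 p)
        gcongr <;> linarith }

theorem LocalCoord.eq_zero {F : Type*} [NormedField F] {M : K → Matrix (Fin r) (Fin r) F}
    (A : LocalCoord F M) {x : Fin r → F} (h : ∀ i, A.n i x = 0) : x = 0 := by
  have := A.le_n x
  simp only [h, Finset.sum_const_zero, mul_zero] at this
  exact norm_le_zero_iff.1 this

theorem norm_ringHom_natCast_of_complex (θ : K →+* ℂ) (m : ℕ) : ‖θ m‖ = m := by
  rw [map_natCast, Complex.norm_natCast]

theorem norm_natCast_padicAlgCl {p : ℕ} [Fact p.Prime] (m : ℕ) :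
    ‖(m : PadicAlgCl p)‖ = ‖(m : ℚ_[p])‖ := by
  rw [← map_natCast (algebraMap ℚ_[p] (PadicAlgCl p)), norm_algebraMap']

/-- The full coordinate system, with absolute values coming from all embeddings of `K` into `ℂ` and
into the algebraic closures of `ℚ_p`, for `p ∣ a`. -/
theorem exists_adelicCoordSystem (a : ℕ) :
    letI := preSolenoidModule b a
    ∃ S : AdelicCoordSystem K (PreSolenoid a r) (Option a.primeFactors × Fin r),
      (∀ i, S.kind (none, i) = none) ∧
      (∀ (p : a.primeFactors) i, S.kind (some p, i) = some (p : ℕ)) ∧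
      (∀ i, ∃ θ : K →+* ℂ, ∀ α, S.a (none, i) α = ‖θ α‖) ∧
      (∀ (p : a.primeFactors) i, ∃ θ : K →+* PadicAlgCl (p : ℕ),
        ∀ α, S.a (some p, i) α = ‖θ α‖) ∧
      (∀ x, (∀ i, S.n (none, i) x = 0) → x.1 = 0) ∧
      (∀ x p, (∀ i, S.n (some p, i) x = 0) → x.2 p = 0) := by
  let _ := preSolenoidModule b a
  obtain ⟨R, hR⟩ := exists_localCoord b ℝ ℂ
  choose P hP using fun p : a.primeFactors => exists_localCoord b ℚ_[(p : ℕ)] (PadicAlgCl (p : ℕ))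
  choose θR hθR using hR
  choose θP hθP using hP
  refine ⟨{ globalCoord b R P with
    kind := fun i => i.1.map fun p => (p : ℕ)
    arch := ?_
    nonarch := ?_
    prime := ?_
    a_prime := ?_
    a_coprime := ?_ }, fun i => rfl, fun p i => rfl, fun i => ⟨θR i, hθR i⟩,
    fun p i => ⟨θP p i, hθP p i⟩, fun x hx => R.eq_zero hx, fun x p hx => (P p).eq_zero hx⟩
  · rintro ⟨_ | p, i⟩ h m
    · exact (hθR i m).trans (norm_ringHom_natCast_of_complex _ _)
    · simp at h
  · rintro ⟨_ | p, i⟩ q h x y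
    · simp at h
    · change (P p).a i (x + y) ≤ max ((P p).a i x) ((P p).a i y)
      simp only [hθP, map_add]
      exact IsUltrametricDist.norm_add_le_max _ _
  · rintro ⟨_ | p, i⟩ q h
    · simp at h
    · obtain rfl : (p : ℕ) = q := by simpa using h
      exact Nat.prime_of_mem_primeFactors p.2
  · rintro ⟨_ | p, i⟩ q h
    · simp at h
    · obtain rfl : (p : ℕ) = q := by simpa using h
      refine (hθP p i _).trans ?_
      rw [map_natCast, norm_natCast_padicAlgCl, Padic.norm_p]
  · rintro ⟨_ | p, i⟩ q h m hm
    · simp at h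
    · obtain rfl : (p : ℕ) = q := by simpa using h
      refine (hθP p i _).trans ?_
      rw [map_natCast, norm_natCast_padicAlgCl, Padic.norm_natCast_eq_one_iff]
      exact hm

end GlobalCoordinates

/-! ### Row vectors as a one-dimensional space over `K`, and Gallai's theorem -/

section RowVectors

variable {a r : ℕ}

theorem rowPair_ratAct (c : Fin r → ℚ) (M : Matrix (Fin r) (Fin r) ℚ) (x : PreSolenoid a r) :
    rowPair c (ratAct M x) = rowPair (Matrix.vecMul c M) x := by
  have key : ∀ (F : Type) [Field F] [CharZero F] (w : Fin r → F),
      ∑ j, (c j : F) * ((M.map fun q => (q : F)).mulVec w) j =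
        ∑ j, ((Matrix.vecMul c M j : ℚ) : F) * w j := by
    intro F _ _ w
    simp only [Matrix.mulVec, Matrix.vecMul, dotProduct, Matrix.map_apply, Finset.mul_sum]
    rw [Finset.sum_comm]
    refine Finset.sum_congr rfl fun j _ => ?_
    push_cast
    rw [Finset.sum_mul]
    exact Finset.sum_congr rfl fun i _ => by ring
  exact Prod.ext (key ℝ _) (funext fun p => key ℚ_[(p : ℕ)] _)

theorem rowPair_smul_left (q : ℚ) (c : Fin r → ℚ) (x : PreSolenoid a r) :
    rowPair (q • c) x = lineSMul q (rowPair c x) := by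
  ext <;> simp [rowPair, lineSMul, Finset.mul_sum, mul_assoc]

theorem eq_zero_of_rowPair {x : PreSolenoid a r} (h : ∀ c : Fin r → ℚ, rowPair c x = 0) :
    x = 0 := by
  classical
  refine eq_of_preCoord fun j => ?_
  have := h (Pi.single j 1)
  rw [rowPair_single] at this
  have e : lineSMul 1 (preCoord x j) = preCoord x j := by ext <;> simp [lineSMul]
  rw [e] at this
  rw [this]
  rfl

variable {K : Type*} [Field K] [Algebra ℚ K] {b : Basis (Fin r) ℚ K}

/-- The map `κ ↦ c M(κ)` is linear between spaces of dimension `r`, and it is injective because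
`M(κ)` is invertible for `κ ≠ 0`. -/
theorem exists_vecMul_multMatrix {c : Fin r → ℚ} (hc : c ≠ 0) (d : Fin r → ℚ) :
    ∃ κ : K, Matrix.vecMul c (multMatrix b κ) = d := by
  have : FiniteDimensional ℚ K := b.finiteDimensional_of_finite
  let φ : K →ₗ[ℚ] (Fin r → ℚ) :=
    { toFun := fun κ => Matrix.vecMul c (multMatrix b κ)
      map_add' := fun κ κ' => by
        change Matrix.vecMul c (multMatrixHom b (κ + κ')) = _
        rw [map_add, Matrix.vecMul_add]
        rfl
      map_smul' := fun q κ => by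
        simp only [multMatrix_eq_transpose, map_smul, Matrix.transpose_smul, Matrix.vecMul_smul,
          RingHom.id_apply] }
  have hinj : Function.Injective φ := by
    rw [← LinearMap.ker_eq_bot, LinearMap.ker_eq_bot']
    intro κ hκ
    by_contra h0
    apply hc
    have h1 : Matrix.vecMul c (multMatrixHom b κ) = 0 := hκ
    have h2 : Matrix.vecMul c (multMatrixHom b (κ * κ⁻¹)) = 0 := by
      rw [map_mul, ← Matrix.vecMul_vecMul, h1, Matrix.zero_vecMul]
    rwa [mul_inv_cancel₀ h0, map_one, Matrix.vecMul_one] at h2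
  have hsurj : Function.Surjective φ :=
    (LinearMap.injective_iff_surjective_of_finrank_eq_finrank (by
      rw [finrank_eq_card_basis b, Module.finrank_pi])).1 hinj
  exact hsurj d

variable [Module K (PreSolenoid a r)]

theorem rowPair_rat_smul (hsmul : ∀ (α : K) (x : PreSolenoid a r), α • x = ratAct (multMatrix b α) x)
    (q : ℚ) (κ : K) (c : Fin r → ℚ) (x : PreSolenoid a r) :
    rowPair c ((q • κ) • x) = lineSMul q (rowPair c (κ • x)) := by
  rw [hsmul, hsmul, rowPair_ratAct, rowPair_ratAct, ← rowPair_smul_left]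
  simp only [multMatrix_eq_transpose, map_smul, Matrix.transpose_smul, Matrix.vecMul_smul]

/-- If the powers of `s ^ d` and `t ^ d` span `K` for all `d ≥ 1`, then no finite number of
hyperplanes contains all the vectors `s ^ i • t ^ j • x`. -/
theorem exists_pow_rowPair_ne_zero
    (hsmul : ∀ (α : K) (x : PreSolenoid a r), α • x = ratAct (multMatrix b α) x) {s t : K}
    (hs0 : s ≠ 0) (ht0 : t ≠ 0) {N : ℕ}
    (hspan : ∀ d : ℕ, 0 < d → Submodule.span ℚ
      (Set.range fun ij : Fin N × Fin N => s ^ (d * (ij.1 : ℕ)) * t ^ (d * (ij.2 : ℕ))) = ⊤)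
    {x : PreSolenoid a r} (hx : x ≠ 0) (Φ : Finset (Fin r → ℚ)) (hΦ : ∀ c ∈ Φ, c ≠ 0) :
    ∃ i j : ℕ, ∀ c ∈ Φ, rowPair c ((s ^ i * t ^ j) • x) ≠ 0 := by
  by_contra! hcon
  choose col hcolΦ hcol using hcon
  -- The colour of `(i, j)` is some `c ∈ Φ` that annihilates `s ^ i t ^ j x`. On a monochromatic
  -- copy of the `N × N` box, dilated by `d`, a single `c` annihilates all `s ^ (d i) t ^ (d j) x'`.
  -- These scalars span `K`, so `c`, and with it every row vector, annihilates `K x'`; this forces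
  -- `x' = 0`.
  obtain ⟨d, hd, ⟨i0, j0⟩, ⟨c, hc⟩, hmono⟩ := Combinatorics.exists_mono_homothetic_copy
    (Finset.range N ×ˢ Finset.range N)
    (fun ij : ℕ × ℕ => (⟨col ij.1 ij.2, hcolΦ _ _⟩ : Φ))
  set x' := (s ^ i0 * t ^ j0) • x with hx'
  have hvan : ∀ ij : Fin N × Fin N,
      rowPair c ((s ^ (d * (ij.1 : ℕ)) * t ^ (d * (ij.2 : ℕ))) • x') = 0 := by
    rintro ⟨i, j⟩
    have h1 := hmono (i, j) (by simp)
    have h2 := hcol (d * i + i0) (d * j + j0)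
    have h3 : col (d * i + i0) (d * j + j0) = c := by
      have := congrArg Subtype.val h1
      simpa using this
    rw [h3] at h2
    rw [hx', smul_smul]
    convert h2 using 2
    ring_nf
  have hall : ∀ κ : K, rowPair c (κ • x') = 0 := by
    intro κ
    have hmem : κ ∈ Submodule.span ℚ (Set.range fun ij : Fin N × Fin N =>
        s ^ (d * (ij.1 : ℕ)) * t ^ (d * (ij.2 : ℕ))) := by rw [hspan d hd]; trivial
    induction hmem using Submodule.span_induction with
    | mem y hy => obtain ⟨ij, rfl⟩ := hy; exact hvan ij
    | zero => rw [zero_smul]; ext <;> simp [rowPair]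
    | add y z _ _ hy hz => rw [add_smul, rowPair_add_right, hy, hz, add_zero]
    | smul q y _ hy => rw [rowPair_rat_smul hsmul, hy]; ext <;> simp [lineSMul]
  have hx0 : x' = 0 := by
    refine eq_zero_of_rowPair fun e => ?_
    obtain ⟨κ, hκ⟩ := exists_vecMul_multMatrix (b := b) (hΦ c hc) e
    rw [← hκ, ← rowPair_ratAct, ← hsmul]
    exact hall κ
  rw [hx', smul_eq_zero] at hx0
  rcases hx0 with h | h
  · exact mul_ne_zero (pow_ne_zero _ hs0) (pow_ne_zero _ ht0) h
  · exact hx h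

end RowVectors

/-! ### Good pairs, and why differences fill the solenoid -/

/-- The conditions on a pair `(s, t)` under which closed sets invariant under multiplication by `s`
and `t` contain torsion points. -/
structure GoodPair {K V ι : Type*} [Field K] [Algebra ℚ K] [NormedAddCommGroup V] [Module K V]
    [Fintype ι] (S : AdelicCoordSystem K V ι) (s t : K) : Prop where
  left_ne_zero : s ≠ 0
  right_ne_zero : t ≠ 0
  indep : ∀ j k : ℤ, s ^ j * t ^ k = 1 → j = 0 ∧ k = 0
  hyp : ∀ i, S.a i s ≠ 1 ∨ S.a i t ≠ 1
  span : ∃ N : ℕ, ∀ d : ℕ, 0 < d → Submodule.span ℚ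
    (Set.range fun ij : Fin N × Fin N => s ^ (d * (ij.1 : ℕ)) * t ^ (d * (ij.2 : ℕ))) = ⊤

/-- Torsion points are fixed only by powers of the pair, so the theory must apply to these. The span
condition is required for all `d` in order to survive here. -/
theorem GoodPair.pow {K V ι : Type*} [Field K] [Algebra ℚ K] [NormedAddCommGroup V] [Module K V]
    [Fintype ι] {S : AdelicCoordSystem K V ι} {s t : K} (h : GoodPair S s t) {u : ℕ} (hu : 0 < u) :
    GoodPair S (s ^ u) (t ^ u) where
  left_ne_zero := pow_ne_zero _ h.left_ne_zero
  right_ne_zero := pow_ne_zero _ h.right_ne_zero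
  indep j k hjk := by
    rw [← zpow_natCast, ← zpow_natCast, ← zpow_mul, ← zpow_mul] at hjk
    obtain ⟨h1, h2⟩ := h.indep _ _ hjk
    have hu' : (u : ℤ) ≠ 0 := by exact_mod_cast hu.ne'
    exact ⟨(mul_eq_zero.1 h1).resolve_left hu', (mul_eq_zero.1 h2).resolve_left hu'⟩
  hyp i := by
    simp only [map_pow, ne_eq, pow_eq_one_iff_of_nonneg (apply_nonneg _ _) hu.ne']
    exact h.hyp i
  span := by
    obtain ⟨N, hN⟩ := h.span
    refine ⟨N, fun d hd => ?_⟩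
    simp only [← pow_mul, ← mul_assoc]
    exact hN (u * d) (Nat.mul_pos hu hd)

section FullDifference

variable {a r : ℕ} {K : Type*} [Field K] [Algebra ℚ K] {b : Basis (Fin r) ℚ K}
  [Module K (PreSolenoid a r)] [ContinuousConstSMul K (PreSolenoid a r)]
  {ι : Type*} [Fintype ι] {S : AdelicCoordSystem K (PreSolenoid a r) ι}

/-- Like `w`, the pairing of `c` with `κ • w` lives at a single place, and there the values of the
character on all `p ^ (-v)`-multiples determine whether it vanishes. -/
theorem exists_lineChar_ne_zero (ha : 0 < a)
    (hsmul : ∀ (α : K) (x : PreSolenoid a r), α • x = ratAct (multMatrix b α) x)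
    (hS1 : ∀ x, (∀ i, S.kind i = none → S.n i x = 0) → x.1 = 0)
    (hS2 : ∀ x (p : a.primeFactors), (∀ i, S.kind i = some (p : ℕ) → S.n i x = 0) → x.2 p = 0)
    {w : PreSolenoid a r} {p : ℕ} (hp : p.Prime)
    (hw : (∀ i, S.n i w ≠ 0 → S.kind i = none) ∨ ∀ i, S.n i w ≠ 0 → S.kind i = some p)
    {c : Fin r → ℚ} {κ : K} (hc : rowPair c (κ • w) ≠ 0) :
    ∃ v : ℕ, lineChar ha (lineSMul ((p : ℚ) ^ v)⁻¹ (rowPair c (κ • w))) ≠ 0 := by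
  by_contra! hcon
  apply hc
  rcases hw with hw | hw
  · have hw2 : w.2 = 0 := by
      funext q
      refine hS2 w q fun i hi => ?_
      by_contra h
      simp [hw i h] at hi
    refine eq_zero_of_lineChar_real ha ?_ hp.one_lt hcon
    rw [hsmul]
    funext q
    simp [rowPair, ratAct, hw2]
  · have hw1 : w.1 = 0 := by
      refine hS1 w fun i hi => ?_
      by_contra h
      simp [hw i h] at hi
    have hw2 : ∀ q : a.primeFactors, (q : ℕ) ≠ p → w.2 q = 0 := by
      intro q hq
      refine hS2 w q fun i hi => ?_
      by_contra h
      rw [hw i h] at hi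
      exact hq (Option.some.inj hi).symm
    refine eq_zero_of_lineChar_padic ha (p := p) ?_ ?_ hcon
    · rw [hsmul]
      simp [rowPair, ratAct, hw1]
    · intro q hq
      rw [hsmul]
      simp [rowPair, ratAct, hw2 q hq]

/-- The differences of the points of a closed invariant set without torsion fill the solenoid. -/
theorem exists_sub_eq_of_no_torsion (ha : 0 < a)
    (hsmul : ∀ (α : K) (x : PreSolenoid a r), α • x = ratAct (multMatrix b α) x)
    (hS1 : ∀ x, (∀ i, S.kind i = none → S.n i x = 0) → x.1 = 0)
    (hS2 : ∀ x (p : a.primeFactors), (∀ i, S.kind i = some (p : ℕ) → S.n i x = 0) → x.2 p = 0)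
    {s t : K} (hst : GoodPair S s t) {f g : Solenoid a r →+ Solenoid a r}
    (hf : ∀ x : PreSolenoid a r, f (x : Solenoid a r) = ((s • x : PreSolenoid a r) : Solenoid a r))
    (hg : ∀ x : PreSolenoid a r, g (x : Solenoid a r) = ((t • x : PreSolenoid a r) : Solenoid a r))
    {E : Set (Solenoid a r)} (hE : IsClosed E) (hne : E.Nonempty) (hfE : Set.MapsTo f E E)
    (hgE : Set.MapsTo g E E) (htors : ∀ x ∈ E, ¬ IsOfFinAddOrder x) (x : Solenoid a r) :
    ∃ e ∈ E, ∃ e' ∈ E, x = e - e' := by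
  classical
  have : CharZero K := algebraRat.charZero K
  have : CompactSpace (Solenoid a r) := compactSpace_solenoid ha
  have : T2Space (Solenoid a r) := t2Space_solenoid ha
  have hG : ∀ κ : K, ∃ m : ℕ, 0 < m ∧ ∀ γ ∈ (solenoidEmb a r).range,
      m • κ • γ ∈ (solenoidEmb a r).range := by
    intro κ
    obtain ⟨m, hm, h⟩ := exists_nsmul_ratAct_mem (a := a) (multMatrix b κ)
    exact ⟨m, hm, fun γ hγ => by rw [hsmul]; exact h γ hγ⟩
  set D : Set (Solenoid a r) := (fun y : Solenoid a r × Solenoid a r => y.1 - y.2) '' (E ×ˢ E)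
    with hD
  have hDc : IsClosed D :=
    ((hE.isCompact.prod hE.isCompact).image (continuous_fst.sub continuous_snd)).isClosed
  have hDf : ∀ y ∈ D, f y ∈ D := by
    rintro _ ⟨⟨e, e'⟩, ⟨he, he'⟩, rfl⟩
    exact ⟨(f e, f e'), ⟨hfE he, hfE he'⟩, (map_sub f e e').symm⟩
  have hDg : ∀ y ∈ D, g y ∈ D := by
    rintro _ ⟨⟨e, e'⟩, ⟨he, he'⟩, rfl⟩
    exact ⟨(g e, g e'), ⟨hgE he, hgE he'⟩, (map_sub g e e').symm⟩
  suffices h : D = Set.univ by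
    obtain ⟨⟨e, e'⟩, ⟨he, he'⟩, h'⟩ : x ∈ D := by rw [h]; trivial
    exact ⟨e, he, e', he', h'.symm⟩
  set Dt : Set (PreSolenoid a r) := {y | (y : Solenoid a r) ∈ D} with hDt
  have hDtc : IsClosed Dt := hDc.preimage QuotientAddGroup.continuous_mk
  obtain ⟨y, s', hy0, ⟨j', k', hs'⟩, hys, hyD, hyη⟩ := exists_proportional_orbit S.toCoordSystem hDtc
    hst.left_ne_zero hst.right_ne_zero
    (fun y hy => by
      change _ ∈ D
      rw [← hf]
      exact hDf _ hy)
    (fun y hy => by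
      change _ ∈ D
      rw [← hg]
      exact hDg _ hy) hst.indep (fun ε hε => by
      obtain ⟨d, ⟨e, he, e', he', hd⟩, hdε, hi⟩ := exists_expanding_difference S.toCoordSystem hG
        hst.indep hst.hyp hf hg hE hne hfE hgE htors hε
      exact ⟨d, ⟨(e, e'), ⟨he, he'⟩, hd.symm⟩, hdε, hi⟩)
  let H : Submonoid K :=
    { carrier := {κ | ∃ j k : ℤ, κ = s ^ j * t ^ k}
      mul_mem' := by
        rintro _ _ ⟨j, k, rfl⟩ ⟨j', k', rfl⟩
        refine ⟨j + j', k + k', ?_⟩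
        rw [zpow_add₀ hst.left_ne_zero, zpow_add₀ hst.right_ne_zero]
        ring
      one_mem' := ⟨0, 0, by simp⟩ }
  obtain ⟨w, p, hw0, hp, hw, hwD⟩ := S.exists_hasCosets hDc (H := H) hy0
    (by rintro _ ⟨j, k, rfl⟩; exact hyD j k) (s := s') ⟨j', k', hs'⟩ hys (fun ε hε => by
      obtain ⟨j, k, h1, h2⟩ := hyη ε hε
      exact ⟨_, ⟨j, k, rfl⟩, h1, h2⟩)
  have hpK : (p : K) ≠ 0 := by exact_mod_cast hp.ne_zero
  obtain ⟨N, hN⟩ := hst.span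
  refine eq_univ_of_progressions (ψ := solenoidChar ha r) (continuous_solenoidChar ha)
    (fun x hx => eq_zero_of_solenoidChar ha hx) hDc fun Φ hΦ => ?_
  obtain ⟨i, j, hij⟩ := exists_pow_rowPair_ne_zero hsmul hst.left_ne_zero hst.right_ne_zero hN hw0
    (Φ.image fun c j => (c j : ℚ)) (by
      intro c' hc'
      obtain ⟨c, hc, rfl⟩ := Finset.mem_image.1 hc'
      intro h0
      refine hΦ c hc (funext fun j => Subtype.ext ?_)
      exact congrFun h0 j)
  have hv : ∀ c : Fin r → zInv a, ∃ v : ℕ, c ∈ Φ → lineChar ha (lineSMul ((p : ℚ) ^ v)⁻¹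
      (rowPair (fun j => (c j : ℚ)) ((s ^ i * t ^ j) • w))) ≠ 0 := by
    intro c
    by_cases hc : c ∈ Φ
    · obtain ⟨v, hv⟩ := exists_lineChar_ne_zero ha hsmul hS1 hS2 hp hw
        (hij _ (Finset.mem_image_of_mem _ hc))
      exact ⟨v, fun _ => hv⟩
    · exact ⟨0, fun h => absurd h hc⟩
  choose v hv using hv
  have hκH : s ^ i * t ^ j ∈ H := ⟨i, j, by simp⟩
  obtain ⟨z, hz⟩ := hwD _ hκH
  have hsm : ∀ v : ℕ, ((p : ℚ) ^ v)⁻¹ • (s ^ i * t ^ j) = ((p : K) ^ v)⁻¹ * (s ^ i * t ^ j) := by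
    intro v
    rw [Algebra.smul_def]
    simp
  refine ⟨fun c => (((((p : K) ^ v c)⁻¹ * (s ^ i * t ^ j)) • w : PreSolenoid a r) : Solenoid a r),
    fun c hc => ?_, z, fun n => ?_⟩
  · rw [solenoidChar_mk, ← hsm, rowPair_rat_smul hsmul]
    exact hv c hc
  -- Over the common denominator `p ^ V` all points of the multidimensional progression are
  -- `ℕ[1/p]`-multiples of the one vector `κ • w`.
  · set V : ℕ := ∑ c ∈ Φ, v c with hV
    have hvV : ∀ c : Φ, v c ≤ V := fun c =>
      Finset.single_le_sum (f := v) (fun _ _ => Nat.zero_le _) c.2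
    have key : ∑ c : Φ, n c • (((((p : K) ^ v c)⁻¹ * (s ^ i * t ^ j)) • w : PreSolenoid a r) :
        Solenoid a r) = (((s ^ i * t ^ j) • (((∑ c : Φ, n c * p ^ (V - v c) : ℕ) : K) /
          (p : K) ^ V) • w : PreSolenoid a r) : Solenoid a r) := by
      simp only [← QuotientAddGroup.mk_nsmul]
      rw [← QuotientAddGroup.mk_sum]
      congr 1
      simp only [← Nat.cast_smul_eq_nsmul K, smul_smul]
      rw [← Finset.sum_smul]
      congr 1
      push_cast
      rw [Finset.sum_div, Finset.mul_sum]
      refine Finset.sum_congr rfl fun c _ => ?_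
      have h1 : (p : K) ^ V = (p : K) ^ (V - v c) * (p : K) ^ v c := by
        rw [← pow_add, Nat.sub_add_cancel (hvV c)]
      rw [h1]
      field_simp
    rw [key]
    exact hz _ _

end FullDifference

/-! ### Translates by fixed points, and periodicity of torsion -/

section TorsionTranslates

variable {X : Type*} [AddCommGroup X] [TopologicalSpace X] [ContinuousAdd X]

/-- If the differences of every closed invariant set without torsion fill the group, then such a set
contains all translates of one of its points by given fixed points. -/
theorem exists_forall_add_mem {f g : X →+ X}
    (hdiff : ∀ E : Set X, IsClosed E → E.Nonempty → Set.MapsTo f E E → Set.MapsTo g E E →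
      (∀ x ∈ E, ¬ IsOfFinAddOrder x) → ∀ x, ∃ e ∈ E, ∃ e' ∈ E, x = e - e')
    (T : Finset X) (hT : ∀ t ∈ T, f t = t ∧ g t = t) (E : Set X) (hE : IsClosed E)
    (hne : E.Nonempty) (hf : Set.MapsTo f E E) (hg : Set.MapsTo g E E)
    (htors : ∀ x ∈ E, ¬ IsOfFinAddOrder x) : ∃ x ∈ E, ∀ t ∈ T, x + t ∈ E := by
  classical
  induction T using Finset.induction_on generalizing E with
  | empty => exact hne.imp fun x hx => ⟨hx, by simp⟩
  | insert t T _ ih =>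
    obtain ⟨hft, hgt⟩ := hT t (Finset.mem_insert_self _ _)
    obtain ⟨e, he, e', he', h⟩ := hdiff E hE hne hf hg htors t
    -- The induction continues inside `E ∩ (E - t)`: it contains `e'` because `t = e - e'`, and it
    -- is invariant because `f` and `g` fix `t`.
    obtain ⟨x, ⟨hx, hxt⟩, hxT⟩ := ih (fun t ht => hT t (Finset.mem_insert_of_mem ht))
      {x | x ∈ E ∧ x + t ∈ E} (hE.inter (hE.preimage (continuous_add_const t)))
      ⟨e', he', by rwa [h, add_sub_cancel]⟩
      (fun x hx => ⟨hf hx.1, by have := hf hx.2; rwa [map_add, hft] at this⟩)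
      (fun x hx => ⟨hg hx.1, by have := hg hx.2; rwa [map_add, hgt] at this⟩)
      (fun x hx => htors x hx.1)
    refine ⟨x, hx, fun t' ht' => ?_⟩
    rcases Finset.mem_insert.1 ht' with rfl | ht'
    · exact hxt
    · exact (hxT t' ht').1

end TorsionTranslates

/-- Injectivity on the `N`-torsion allows cancelling `f^[i]`, which turns preperiodic into periodic.
-/
theorem exists_isPeriodicPt_of_iterate_eq {X : Type*} [AddCommGroup X] {f : X →+ X} {N : ℕ}
    (hinj : ∀ y, N • y = 0 → f y = 0 → y = 0) {x : X} (hx : N • x = 0) {i j : ℕ} (hij : i < j)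
    (h : f^[j] x = f^[i] x) : ∃ u : ℕ, 0 < u ∧ Function.IsPeriodicPt f u x := by
  refine ⟨j - i, Nat.sub_pos_of_lt hij, ?_⟩
  have hN : ∀ n, N • f^[n] x = 0 := by
    intro n
    induction n with
    | zero => exact hx
    | succ n ih => rw [Function.iterate_succ_apply', ← map_nsmul, ih, map_zero]
  have key : ∀ n m, f^[n + m] x = f^[n] x → f^[m] x = x := by
    intro n
    induction n with
    | zero => intro m hm; simpa using hm
    | succ n ih =>
      intro m hm
      refine ih m (sub_eq_zero.1 (hinj _ ?_ ?_))
      · rw [smul_sub, hN, hN, sub_zero]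
      · rw [map_sub, ← Function.iterate_succ_apply' f, ← Function.iterate_succ_apply' f, sub_eq_zero,
          ← hm]
        congr 2
        omega
  refine key i (j - i) ?_
  rwa [Nat.add_sub_cancel' hij.le]

/-! ### The theorem for one solenoid -/

section SingleSolenoid

variable {a r : ℕ}

/-- Were the value zero, `q / N` would lie in `ℤ[1/a]`; then `N` would divide `q.num * a ^ v`,
although it divides neither `a` nor the smaller non-zero numerator. -/
theorem lineChar_lineEmb_eq (ha : 0 < a) {N : ℕ} (hN : N.Prime) (hNa : ¬ N ∣ a) {q : ℚ}
    (hq0 : q ≠ 0) (hqN : q.num.natAbs < N) :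
    lineChar ha (lineEmb a (q * (N : ℚ)⁻¹)) ≠ 0 := by
  intro h
  have hN0 : (N : ℚ) ≠ 0 := by exact_mod_cast hN.ne_zero
  have ha0 : (a : ℚ) ≠ 0 := by exact_mod_cast ha.ne'
  obtain ⟨q', hq'⟩ := exists_isApprox ha (lineEmb a (q * (N : ℚ)⁻¹))
  rw [lineChar_eq ha hq', AddCircle.coe_eq_zero_iff] at h
  obtain ⟨n, hn⟩ := h
  have hmem : q * (N : ℚ)⁻¹ ∈ zInv a := by
    have : q * (N : ℚ)⁻¹ = n + q' := by
      have h2 : ((q * (N : ℚ)⁻¹ : ℚ) : ℝ) = ((n + q' : ℚ) : ℝ) := by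
        simp only [lineEmb] at hn
        push_cast at hn ⊢
        simp only [zsmul_eq_mul, mul_one] at hn
        linarith
      exact_mod_cast h2
    rw [this]
    exact add_mem (intCast_mem _ _) hq'.1
  obtain ⟨m, v, hm⟩ := exists_int_div_pow_of_mem_zInv ha hmem
  have h3 : (q.num : ℚ) * a ^ v = N * (m * q.den) := by
    have h4 : q * a ^ v = N * m := by
      field_simp at hm
      linarith
    rw [← mul_assoc, ← h4, ← Rat.mul_den_eq_num q]
    ring
  have h5 : q.num * (a : ℤ) ^ v = N * (m * q.den) := by exact_mod_cast h3
  have h6 : (N : ℤ) ∣ q.num * (a : ℤ) ^ v := ⟨_, h5⟩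
  rcases (Nat.prime_iff_prime_int.1 hN).dvd_or_dvd h6 with h7 | h7
  · have := Nat.le_of_dvd (Int.natAbs_pos.2 (Rat.num_ne_zero.2 hq0)) (Int.natCast_dvd.1 h7)
    omega
  · have := (Nat.prime_iff_prime_int.1 hN).dvd_of_dvd_pow h7
    exact hNa (by exact_mod_cast this)

/-- A nontrivial character is nontrivial on the `N`-torsion for all large primes `N`. -/
theorem exists_torsion_solenoidChar_ne_zero (ha : 0 < a) {c : Fin r → zInv a} (hc : c ≠ 0) :
    ∃ B : ℕ, ∀ N : ℕ, N.Prime → B < N → ∃ x : Solenoid a r, N • x = 0 ∧ solenoidChar ha r c x ≠ 0 := by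
  classical
  obtain ⟨j, hj⟩ := Function.ne_iff.1 hc
  refine ⟨a + (c j : ℚ).num.natAbs, fun N hN hB => ?_⟩
  have hN0 : (N : ℚ) ≠ 0 := by exact_mod_cast hN.ne_zero
  -- The diagonal image of `e_j / N`, which becomes a lattice point after multiplication by `N`.
  let X : PreSolenoid a r := (fun i => if i = j then ((N : ℚ)⁻¹ : ℚ) else 0,
    fun p i => if i = j then -(((N : ℚ)⁻¹ : ℚ) : ℚ_[(p : ℕ)]) else 0)
  refine ⟨X, ?_, ?_⟩
  · rw [← QuotientAddGroup.mk_nsmul, QuotientAddGroup.eq_zero_iff]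
    refine exists_solenoidEmb_eq fun i => ?_
    by_cases hi : i = j
    · refine ⟨1, one_mem _, Prod.ext ?_ (funext fun p => ?_)⟩
      · have : (N : ℝ) ≠ 0 := by exact_mod_cast hN.ne_zero
        simp [preCoord, X, hi, lineEmb, this]
      · have : (N : ℚ_[(p : ℕ)]) ≠ 0 := by exact_mod_cast hN.ne_zero
        simp [preCoord, X, hi, lineEmb, this]
    · refine ⟨0, zero_mem _, Prod.ext ?_ (funext fun p => ?_)⟩
      · simp [preCoord, X, hi, lineEmb]
      · simp [preCoord, X, hi, lineEmb]
  · have : rowPair (fun j => (c j : ℚ)) X = lineEmb a ((c j : ℚ) * (N : ℚ)⁻¹) := by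
      refine Prod.ext ?_ (funext fun p => ?_)
      · simp [rowPair, X, lineEmb]
      · simp [rowPair, X, lineEmb]
    rw [solenoidChar_mk, this]
    refine lineChar_lineEmb_eq ha hN (fun h => ?_) (fun h => hj (Subtype.ext h)) (by omega)
    have := Nat.le_of_dvd ha h
    omega

variable {K : Type*} [Field K] [Algebra ℚ K] {b : Basis (Fin r) ℚ K}
  [Module K (PreSolenoid a r)]

theorem exists_nsmul_smul_mem (hsmul : ∀ (α : K) (x : PreSolenoid a r), α • x = ratAct (multMatrix b α) x)
    (κ : K) : ∃ m : ℕ, 0 < m ∧ ∀ γ ∈ (solenoidEmb a r).range, m • κ • γ ∈ (solenoidEmb a r).range := by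
  obtain ⟨m, hm, h⟩ := exists_nsmul_ratAct_mem (a := a) (multMatrix b κ)
  exact ⟨m, hm, fun γ hγ => by rw [hsmul]; exact h γ hγ⟩

/-- For all large primes `N`, the points of the `N`-torsion are periodic under a nonzero scalar. -/
theorem exists_isPeriodicPt_of_torsion (ha : 0 < a)
    (hsmul : ∀ (α : K) (x : PreSolenoid a r), α • x = ratAct (multMatrix b α) x) {s : K}
    (hs : s ≠ 0) {f : Solenoid a r →+ Solenoid a r}
    (hf : ∀ x : PreSolenoid a r, f (x : Solenoid a r) = ((s • x : PreSolenoid a r) : Solenoid a r)) :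
    ∃ B : ℕ, ∀ N : ℕ, N.Prime → B < N → ∀ x : Solenoid a r, N • x = 0 →
      ∃ u : ℕ, 0 < u ∧ Function.IsPeriodicPt f u x := by
  have : CharZero K := algebraRat.charZero K
  have : CompactSpace (Solenoid a r) := compactSpace_solenoid ha
  obtain ⟨m, hm, hmG⟩ := exists_nsmul_smul_mem hsmul s⁻¹
  refine ⟨m, fun N hN hB x hx => ?_⟩
  obtain ⟨i, j, hij, h⟩ := exists_iterate_eq_of_isOfFinAddOrder (K := K)
    ⟨1, one_pos, fun γ hγ h => eq_zero_of_mem_range_solenoidEmb ha hγ h⟩ f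
    (isOfFinAddOrder_iff_nsmul_eq_zero.2 ⟨N, hN.pos, hx⟩)
  -- The kernel of `f` is killed by `m`, since `m • s⁻¹ • G` lies in `G`. As the prime `N` exceeds
  -- `m`, the kernel meets the `N`-torsion only in zero.
  refine exists_isPeriodicPt_of_iterate_eq (fun y hy hfy => ?_) hx hij h
  obtain ⟨Y, rfl⟩ := QuotientAddGroup.mk_surjective y
  rw [hf, QuotientAddGroup.eq_zero_iff] at hfy
  have h1 := hmG _ hfy
  rw [inv_smul_smul₀ hs, ← QuotientAddGroup.eq_zero_iff, QuotientAddGroup.mk_nsmul] at h1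
  have hcop : Nat.Coprime N m := (Nat.Prime.coprime_iff_not_dvd hN).2 (fun h => (Nat.le_of_dvd hm h).not_gt hB)
  rw [← AddMonoid.addOrderOf_eq_one_iff]
  exact Nat.eq_one_of_dvd_coprimes hcop (addOrderOf_dvd_of_nsmul_eq_zero hy)
    (addOrderOf_dvd_of_nsmul_eq_zero h1)

variable [ContinuousConstSMul K (PreSolenoid a r)]
  {ι : Type*} [Fintype ι] {S : AdelicCoordSystem K (PreSolenoid a r) ι}

/-- A non-empty closed subset of the solenoid `Ω_a^r` that is invariant under a good pair contains a
torsion element. -/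
theorem exists_isOfFinAddOrder_mem (ha : 0 < a)
    (hsmul : ∀ (α : K) (x : PreSolenoid a r), α • x = ratAct (multMatrix b α) x)
    (hS1 : ∀ x, (∀ i, S.kind i = none → S.n i x = 0) → x.1 = 0)
    (hS2 : ∀ x (p : a.primeFactors), (∀ i, S.kind i = some (p : ℕ) → S.n i x = 0) → x.2 p = 0)
    {s t : K} (hst : GoodPair S s t) {f g : Solenoid a r →+ Solenoid a r}
    (hf : ∀ x : PreSolenoid a r, f (x : Solenoid a r) = ((s • x : PreSolenoid a r) : Solenoid a r))
    (hg : ∀ x : PreSolenoid a r, g (x : Solenoid a r) = ((t • x : PreSolenoid a r) : Solenoid a r))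
    {E : Set (Solenoid a r)} (hE : IsClosed E) (hne : E.Nonempty) (hfE : Set.MapsTo f E E)
    (hgE : Set.MapsTo g E E) : ∃ x ∈ E, IsOfFinAddOrder x := by
  classical
  by_contra! htors
  suffices h : E = Set.univ from htors 0 (h ▸ Set.mem_univ _) .zero
  have : CompactSpace (Solenoid a r) := compactSpace_solenoid ha
  have : T2Space (Solenoid a r) := t2Space_solenoid ha
  refine eq_univ_of_progressions (ψ := solenoidChar ha r) (continuous_solenoidChar ha)
    (fun x hx => eq_zero_of_solenoidChar ha hx) hE fun Φ hΦ => ?_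
  obtain ⟨B₁, hB₁⟩ := exists_isPeriodicPt_of_torsion ha hsmul hst.left_ne_zero hf
  obtain ⟨B₂, hB₂⟩ := exists_isPeriodicPt_of_torsion ha hsmul hst.right_ne_zero hg
  have hB : ∀ c : Fin r → zInv a, ∃ B : ℕ, c ∈ Φ → ∀ N : ℕ, N.Prime → B < N →
      ∃ x : Solenoid a r, N • x = 0 ∧ solenoidChar ha r c x ≠ 0 := fun c => by
    by_cases hc : c ∈ Φ
    · obtain ⟨B, hB⟩ := exists_torsion_solenoidChar_ne_zero ha (hΦ c hc)
      exact ⟨B, fun _ => hB⟩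
    · exact ⟨0, fun h => absurd h hc⟩
  choose B hB using hB
  -- One prime beyond all bounds: its torsion points are periodic under both maps and detect every
  -- character in `Φ`.
  obtain ⟨N, hNB, hN⟩ := Nat.exists_infinite_primes (B₁ + B₂ + ∑ c ∈ Φ, B c + 1)
  have hl : ∀ c : Fin r → zInv a, ∃ x : Solenoid a r, N • x = 0 ∧
      (c ∈ Φ → solenoidChar ha r c x ≠ 0) := fun c => by
    by_cases hc : c ∈ Φ
    · have := Finset.single_le_sum (f := B) (fun _ _ => Nat.zero_le _) hc
      obtain ⟨x, h1, h2⟩ := hB c hc N hN (by omega)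
      exact ⟨x, h1, fun _ => h2⟩
    · exact ⟨0, smul_zero _, fun h => absurd h hc⟩
  choose l hlN hl using hl
  refine ⟨l, hl, ?_⟩
  choose u hu hfu using fun c => hB₁ N hN (by omega) (l c) (hlN c)
  choose v hv hgv using fun c => hB₂ N hN (by omega) (l c) (hlN c)
  -- A common multiple of all periods, so that `f^[w]` and `g^[w]` fix every `l c` with `c ∈ Φ`.
  set w : ℕ := ∏ c ∈ Φ, u c * v c with hw
  have hw0 : 0 < w := Finset.prod_pos fun c _ => Nat.mul_pos (hu c) (hv c)
  have hdvd : ∀ c ∈ Φ, u c * v c ∣ w := fun c hc =>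
    Finset.dvd_prod_of_mem (fun c => u c * v c) hc
  let f' : Solenoid a r →+ Solenoid a r := AddMonoidHom.mk' f^[w] (iterate_map_add f w)
  let g' : Solenoid a r →+ Solenoid a r := AddMonoidHom.mk' g^[w] (iterate_map_add g w)
  have hf' : ∀ x, f' x = f^[w] x := fun _ => rfl
  have hg' : ∀ x, g' x = g^[w] x := fun _ => rfl
  obtain ⟨z, -, hz⟩ := exists_forall_add_mem (f := f') (g := g')
    (fun E hE hne hfE hgE htors x => exists_sub_eq_of_no_torsion ha hsmul hS1 hS2 (hst.pow hw0)
      (fun x => by rw [hf', iterate_quotient hf])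
      (fun x => by rw [hg', iterate_quotient hg]) hE hne hfE hgE htors x)
    (Finset.univ.image fun n : Φ → Fin N => ∑ c : Φ, (n c : ℕ) • l c) (by
      intro x hx
      obtain ⟨n, -, rfl⟩ := Finset.mem_image.1 hx
      rw [map_sum f', map_sum g']
      constructor
      · refine Finset.sum_congr rfl fun c _ => ?_
        rw [map_nsmul, hf']
        congr 1
        exact (hfu c).trans_dvd ((Dvd.intro _ rfl).trans (hdvd c c.2))
      · refine Finset.sum_congr rfl fun c _ => ?_
        rw [map_nsmul, hg']
        congr 1
        exact (hgv c).trans_dvd ((Dvd.intro_left _ rfl).trans (hdvd c c.2)))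
    E hE hne (fun x hx => by rw [hf']; exact hfE.iterate w hx)
    (fun x hx => by rw [hg']; exact hgE.iterate w hx) htors
  -- Coefficients of the `N`-torsion points `l c` matter only modulo `N`, so finitely many
  -- translates cover the whole progression.
  refine ⟨z, fun n => hz _ (Finset.mem_image.2
    ⟨fun c => ⟨n c % N, Nat.mod_lt _ hN.pos⟩, Finset.mem_univ _, ?_⟩)⟩
  refine Finset.sum_congr rfl fun c _ => ?_
  conv_rhs => rw [← Nat.mod_add_div (n c) N, add_smul, mul_comm, mul_smul, hlN, smul_zero, add_zero]

end SingleSolenoid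

/-! ### Primes dividing `a` are genuine denominators -/

section Denominators

theorem norm_coeff_prod_X_sub_C_le_one {L : Type*} [NormedField L] [IsUltrametricDist L]
    (s : Multiset L) (hs : ∀ x ∈ s, ‖x‖ ≤ 1) (n : ℕ) :
    ‖((s.map fun x => Polynomial.X - Polynomial.C x).prod).coeff n‖ ≤ 1 := by
  induction s using Multiset.induction_on generalizing n with
  | empty =>
    rw [Multiset.map_zero, Multiset.prod_zero, Polynomial.coeff_one]
    split_ifs <;> simp
  | cons x s ih =>
    have hx := hs x (Multiset.mem_cons_self x s)
    have ih' := ih fun y hy => hs y (Multiset.mem_cons_of_mem hy)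
    rw [Multiset.map_cons, Multiset.prod_cons, sub_mul, Polynomial.coeff_sub, Polynomial.coeff_C_mul,
      sub_eq_add_neg]
    refine (IsUltrametricDist.norm_add_le_max _ _).trans (max_le ?_ ?_)
    · cases n with
      | zero => simp
      | succ n => rw [Polynomial.coeff_X_mul]; exact ih' n
    · rw [norm_neg, norm_mul]
      exact mul_le_one₀ hx (norm_nonneg _) (ih' n)

variable {K : Type*} [Field K] [Algebra ℚ K]

/-- The coefficients are polynomials with integer coefficients in the conjugates, which are the
values `θ x` and therefore `p`-adically integral. -/
theorem not_dvd_den_coeff_minpoly [FiniteDimensional ℚ K] {p : ℕ} [Fact p.Prime] {x : K}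
    (hx : ∀ θ : K →+* PadicAlgCl p, ‖θ x‖ ≤ 1) (n : ℕ) : ¬ p ∣ ((minpoly ℚ x).coeff n).den := by
  classical
  have hint : IsIntegral ℚ x := Algebra.IsIntegral.isIntegral x
  refine not_dvd_den_of_padic_norm_le_one ?_
  have hsplit := (IsAlgClosed.splits ((minpoly ℚ x).map (algebraMap ℚ (PadicAlgCl p))))
  have hprod := hsplit.eq_prod_roots_of_monic ((minpoly.monic hint).map _)
  have h1 := norm_coeff_prod_X_sub_C_le_one
    ((minpoly ℚ x).map (algebraMap ℚ (PadicAlgCl p))).roots (fun y hy => by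
      have hy' : y ∈ (minpoly ℚ x).rootSet (PadicAlgCl p) := by
        rw [Polynomial.rootSet_def, Polynomial.aroots_def]
        simpa using hy
      rw [← Algebra.IsAlgebraic.range_eval_eq_rootSet_minpoly] at hy'
      obtain ⟨ψ, rfl⟩ := hy'
      exact hx ψ) n
  rw [← hprod, Polynomial.coeff_map, eq_ratCast] at h1
  rwa [← map_ratCast (algebraMap ℚ_[p] (PadicAlgCl p)), norm_algebraMap'] at h1

/-- Multiplying the roots of the minimal polynomial by the product `m` of its denominators makes all
coefficients integral, and `p` divides none of the factors of `m`. -/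
theorem exists_isIntegral_nsmul [FiniteDimensional ℚ K] {p : ℕ} [Fact p.Prime] {x : K}
    (hx : ∀ θ : K →+* PadicAlgCl p, ‖θ x‖ ≤ 1) : ∃ m : ℕ, ¬ p ∣ m ∧ IsIntegral ℤ (m • x) := by
  have hint : IsIntegral ℚ x := Algebra.IsIntegral.isIntegral x
  have hp : p.Prime := Fact.out
  set P := minpoly ℚ x with hP
  set m : ℕ := ∏ n ∈ Finset.range P.natDegree, (P.coeff n).den with hm
  refine ⟨m, fun h => ?_, ?_⟩
  · obtain ⟨n, -, hn⟩ := (Prime.dvd_finsetProd_iff hp.prime _).1 h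
    exact not_dvd_den_coeff_minpoly hx n hn
  · have hmon : P.Monic := minpoly.monic hint
    have hlift : P.scaleRoots (m : ℚ) ∈ Polynomial.lifts (algebraMap ℤ ℚ) := by
      rw [Polynomial.lifts_iff_coeff_lifts]
      intro n
      rw [Polynomial.coeff_scaleRoots]
      rcases lt_trichotomy n P.natDegree with hn | hn | hn
      · obtain ⟨c, hc⟩ := Finset.dvd_prod_of_mem (fun n => (P.coeff n).den)
          (Finset.mem_range.2 hn)
        refine ⟨(P.coeff n).num * c * m ^ (P.natDegree - n - 1), ?_⟩
        obtain ⟨e, he⟩ := Nat.exists_eq_add_of_lt hn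
        have h1 : P.natDegree - n = e + 1 := by omega
        rw [h1, Nat.add_sub_cancel, pow_succ']
        simp only [eq_intCast]
        push_cast
        rw [← Rat.mul_den_eq_num]
        have h2 : (m : ℚ) = (P.coeff n).den * c := by rw [hm, hc]; push_cast; rfl
        conv_rhs => rw [h2]
        conv_lhs => rw [h2]
        ring
      · rw [hn, hmon.coeff_natDegree]
        exact ⟨1, by simp⟩
      · rw [Polynomial.coeff_eq_zero_of_natDegree_lt hn]
        exact ⟨0, by simp⟩
    obtain ⟨Q, hQ, -, hQm⟩ := Polynomial.lifts_and_natDegree_eq_and_monic hlift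
      ((Polynomial.monic_scaleRoots_iff _).2 hmon)
    refine ⟨Q, hQm, ?_⟩
    have h1 := Polynomial.scaleRoots_aeval_eq_zero (r := (m : ℚ)) (minpoly.aeval ℚ x)
    rw [← hP, ← hQ, Polynomial.aeval_map_algebraMap] at h1
    rw [nsmul_eq_mul]
    simpa [Polynomial.aeval_def] using h1

/-- With `m` prime to `p` and `m x` integral, `m x β_j` is an algebraic integer, so its coordinates
in the integral basis are integers and the denominators divide `m`. -/
theorem not_dvd_den_multMatrix {r : ℕ} {b : Basis (Fin r) ℚ K} (hb : IsIntegralBasis b) {p : ℕ}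
    [Fact p.Prime] {x : K} (hx : ∀ θ : K →+* PadicAlgCl p, ‖θ x‖ ≤ 1) (j l : Fin r) :
    ¬ p ∣ (multMatrix b x j l).den := by
  have : FiniteDimensional ℚ K := b.finiteDimensional_of_finite
  obtain ⟨m, hpm, hm⟩ := exists_isIntegral_nsmul hx
  have hbj : IsIntegral ℤ (b j) := (hb _).2 (Submodule.subset_span ⟨j, rfl⟩)
  have h1 := (b.mem_span_iff_repr_mem ℤ _).1 ((hb _).1 (hm.mul hbj)) l
  obtain ⟨c, hc⟩ := h1
  have h2 : (m : ℚ) * multMatrix b x j l = c := by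
    rw [smul_mul_assoc, map_nsmul, Finsupp.smul_apply, nsmul_eq_mul, eq_intCast] at hc
    exact hc.symm
  intro hp
  set q := multMatrix b x j l
  have hq : (m : ℤ) * q.num = c * q.den := by
    have : (m : ℚ) * q.num = c * q.den := by rw [← h2, ← Rat.mul_den_eq_num q]; ring
    exact_mod_cast this
  have h3 : (q.den : ℤ) ∣ m * q.num := ⟨c, by rw [hq]; ring⟩
  have h4 : (q.den : ℤ) ∣ m := by
    refine IsCoprime.dvd_of_dvd_mul_right ?_ h3
    exact (Int.isCoprime_iff_gcd_eq_one.2 (by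
      have := q.reduced
      rwa [Int.gcd_comm])).symm.symm
  exact hpm (hp.trans (by exact_mod_cast h4))

theorem mem_zInv_of_den_dvd_pow {a : ℕ} (ha : 0 < a) {q : ℚ} {s : ℕ} (h : q.den ∣ a ^ s) :
    q ∈ zInv a := by
  obtain ⟨c, hc⟩ := h
  have ha0 : (a : ℚ) ^ s ≠ 0 := pow_ne_zero _ (by exact_mod_cast ha.ne')
  have h1 : q = ((q.num * c : ℤ) : ℚ) * ((a : ℚ) ^ s)⁻¹ := by
    rw [eq_mul_inv_iff_mul_eq₀ ha0]
    have : (a : ℚ) ^ s = q.den * c := by exact_mod_cast hc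
    rw [this]
    push_cast
    rw [← Rat.mul_den_eq_num q]
    ring
  rw [h1]
  exact mul_mem (intCast_mem _ _) (inv_pow_mem_zInv a s)

theorem mem_zInv_ordCompl {a p : ℕ} (ha : 0 < a) (hp : p.Prime) {q : ℚ} (hq : q ∈ zInv a)
    (hpq : ¬ p ∣ q.den) : q ∈ zInv (a / p ^ a.factorization p) := by
  obtain ⟨s, hs⟩ := den_dvd_pow_of_mem_zInv ha hq
  refine mem_zInv_of_den_dvd_pow (Nat.ordCompl_pos p ha.ne') (s := s) ?_
  rw [← Nat.ordProj_mul_ordCompl_eq_self a p, mul_pow, ← pow_mul] at hs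
  exact (Nat.Coprime.pow_right _ ((Nat.Prime.coprime_iff_not_dvd hp).2 hpq).symm).dvd_of_dvd_mul_left hs

/-- Every prime dividing the least common denominator is a denominator of `x` or `y` at some place
above it. -/
theorem exists_one_lt_norm_of_dvd_leastDen {r : ℕ} {b : Basis (Fin r) ℚ K} (hb : IsIntegralBasis b)
    {x y : K} {p : ℕ} [hp : Fact p.Prime] (h : p ∣ leastDen (multMatrix b x) (multMatrix b y)) :
    ∃ θ : K →+* PadicAlgCl p, 1 < ‖θ x‖ ∨ 1 < ‖θ y‖ := by
  by_contra! hcon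
  obtain ⟨ha, hmem⟩ := leastDen_mem (multMatrix b x) (multMatrix b y)
  set a := leastDen (multMatrix b x) (multMatrix b y) with haa
  -- If `x` and `y` were integral at all places above `p`, the `p`-part of `a` could be dropped,
  -- against minimality.
  have h1 : a / p ^ a.factorization p ∈ denominators (multMatrix b x) (multMatrix b y) :=
    ⟨Nat.ordCompl_pos p ha.ne', fun j l =>
      ⟨mem_zInv_ordCompl ha hp.out (hmem j l).1 (not_dvd_den_multMatrix hb (fun θ => (hcon θ).1) j l),
        mem_zInv_ordCompl ha hp.out (hmem j l).2
          (not_dvd_den_multMatrix hb (fun θ => (hcon θ).2) j l)⟩⟩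
  have h2 : a ≤ a / p ^ a.factorization p := Nat.sInf_le h1
  have h3 : 1 < p ^ a.factorization p :=
    Nat.one_lt_pow (hp.out.factorization_pos_of_dvd ha.ne' h).ne' hp.out.one_lt
  exact absurd (Nat.div_lt_self ha h3) (not_lt.2 h2)

end Denominators

/-! ### Hyperbolicity in terms of the two generators -/

section Hyperbolic

variable {x y : ℝ}

theorem exists_norm_eq_one_of_mem_closure {L : Type*} [NormedField L] {θ : pairField x y →+* L}
    (hx : ‖θ (pairFst x y)‖ = 1) (hy : ‖θ (pairSnd x y)‖ = 1) {z : ℝ}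
    (hz : z ∈ Subsemigroup.closure {x, y}) : ∃ s : pairField x y, (s : ℝ) = z ∧ ‖θ s‖ = 1 := by
  induction hz using Subsemigroup.closure_induction with
  | mem z hz =>
    rcases hz with rfl | rfl
    · exact ⟨_, rfl, hx⟩
    · exact ⟨_, rfl, hy⟩
  | mul z w _ _ hz hw =>
    obtain ⟨s, rfl, hs⟩ := hz
    obtain ⟨t, rfl, ht⟩ := hw
    exact ⟨s * t, rfl, by rw [map_mul, norm_mul, hs, ht, one_mul]⟩

theorem norm_ne_one_of_exists_mem_closure {L : Type*} [NormedField L] {θ : pairField x y →+* L}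
    (h : ∃ s : pairField x y, (s : ℝ) ∈ Subsemigroup.closure {x, y} ∧ ‖θ s‖ ≠ 1) :
    ‖θ (pairFst x y)‖ ≠ 1 ∨ ‖θ (pairSnd x y)‖ ≠ 1 := by
  by_contra! hcon
  obtain ⟨s, hs, hne⟩ := h
  obtain ⟨t, ht, h1⟩ := exists_norm_eq_one_of_mem_closure hcon.1 hcon.2 hs
  exact hne (Subtype.ext ht ▸ h1)

theorem exists_mem_closure_of_one_lt_norm {L : Type*} [NormedField L] {θ : pairField x y →+* L}
    (h : 1 < ‖θ (pairFst x y)‖ ∨ 1 < ‖θ (pairSnd x y)‖) :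
    ∃ s : pairField x y, (s : ℝ) ∈ Subsemigroup.closure {x, y} ∧ ¬ ‖θ s‖ ≤ 1 := by
  rcases h with h | h
  · exact ⟨pairFst x y, Subsemigroup.subset_closure (Set.mem_insert x {y}), not_le.2 h⟩
  · exact ⟨pairSnd x y, Subsemigroup.subset_closure (Set.mem_insert_of_mem x rfl), not_le.2 h⟩

/-- Hyperbolicity speaks of the field generated by the semigroup; this transfers it to embeddings of
`pairField x y`. -/
theorem adjoin_closure_eq_pairField :
    IntermediateField.adjoin ℚ (Subsemigroup.closure {x, y} : Set ℝ) = pairField x y := by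
  refine le_antisymm (IntermediateField.adjoin_le_iff.2 fun z hz => ?_)
    (IntermediateField.adjoin.mono _ _ _ Subsemigroup.subset_closure)
  induction hz using Subsemigroup.closure_induction with
  | mem z hz => exact IntermediateField.subset_adjoin ℚ _ hz
  | mul z w _ _ hz hw => exact mul_mem hz hw

theorem IsHyperbolic.norm_complex_ne_one (h : IsHyperbolic (Subsemigroup.closure {x, y}))
    (h1 : ∃ θ : pairField x y →+* ℂ, 1 < ‖θ (pairFst x y)‖ ∨ 1 < ‖θ (pairSnd x y)‖)
    (θ : pairField x y →+* ℂ) : ‖θ (pairFst x y)‖ ≠ 1 ∨ ‖θ (pairSnd x y)‖ ≠ 1 := by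
  unfold IsHyperbolic at h
  rw [adjoin_closure_eq_pairField] at h
  obtain ⟨θ', hθ'⟩ := h1
  exact norm_ne_one_of_exists_mem_closure
    (h.1 ⟨θ', exists_mem_closure_of_one_lt_norm hθ'⟩ θ)

theorem IsHyperbolic.norm_padic_ne_one (h : IsHyperbolic (Subsemigroup.closure {x, y}))
    {p : ℕ} [Fact p.Prime]
    (h1 : ∃ θ : pairField x y →+* PadicAlgCl p, 1 < ‖θ (pairFst x y)‖ ∨ 1 < ‖θ (pairSnd x y)‖)
    (θ : pairField x y →+* PadicAlgCl p) : ‖θ (pairFst x y)‖ ≠ 1 ∨ ‖θ (pairSnd x y)‖ ≠ 1 := by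
  unfold IsHyperbolic at h
  rw [adjoin_closure_eq_pairField] at h
  obtain ⟨θ', hθ'⟩ := h1
  exact norm_ne_one_of_exists_mem_closure
    (h.2 p ⟨θ', exists_mem_closure_of_one_lt_norm hθ'⟩ θ)

end Hyperbolic

/-! ### Spanning `K` by monomials in powers of the generators -/

section Generation

theorem pow_mem_span_pow_lt_finrank {K : Type*} [Field K] [Algebra ℚ K] [FiniteDimensional ℚ K]
    (u : K) (n : ℕ) :
    u ^ n ∈ Submodule.span ℚ (Set.range fun i : Fin (finrank ℚ K) => u ^ (i : ℕ)) := by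
  have hint : IsIntegral ℚ u := Algebra.IsIntegral.isIntegral u
  have hdeg : ((Polynomial.X ^ n : Polynomial ℚ) %ₘ minpoly ℚ u).natDegree < finrank ℚ K :=
    (Polynomial.natDegree_modByMonic_lt _ (minpoly.monic hint) (minpoly.ne_one ℚ u)).trans_le
      (minpoly.natDegree_le u)
  have h := Polynomial.aeval_modByMonic_eq_self_of_root (p := Polynomial.X ^ n) (minpoly.aeval ℚ u)
  rw [map_pow, Polynomial.aeval_X, Polynomial.aeval_eq_sum_range' hdeg] at h
  rw [← h]
  exact Submodule.sum_mem _ fun i hi => Submodule.smul_mem _ _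
    (Submodule.subset_span ⟨⟨i, Finset.mem_range.1 hi⟩, rfl⟩)

/-- By algebraicity the generated field is the generated ring, and division by the minimal
polynomials reduces exponents below `[K : ℚ]`, a bound that does not depend on `u` and `v`. -/
theorem span_pow_mul_pow_eq_top {K : Type*} [Field K] [Algebra ℚ K] [FiniteDimensional ℚ K]
    {u v : K} (h : IntermediateField.adjoin ℚ {u, v} = ⊤) :
    Submodule.span ℚ (Set.range fun ij : Fin (finrank ℚ K) × Fin (finrank ℚ K) =>
      u ^ (ij.1 : ℕ) * v ^ (ij.2 : ℕ)) = ⊤ := by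
  have halg : Algebra.adjoin ℚ {u, v} = ⊤ := by
    rw [← IntermediateField.adjoin_toSubalgebra_of_isAlgebraic
      (fun x _ => Algebra.IsAlgebraic.isAlgebraic x), h, IntermediateField.top_toSubalgebra]
  rw [eq_top_iff, ← Algebra.top_toSubmodule, ← halg, Algebra.adjoin_eq_span, Submodule.span_le]
  intro z hz
  obtain ⟨m, n, rfl⟩ := (Submonoid.mem_closure_pair _ _ _).1 hz
  have hmul := Submodule.mul_mem_mul (pow_mem_span_pow_lt_finrank u m)
    (pow_mem_span_pow_lt_finrank v n)
  rw [Submodule.span_mul_span] at hmul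
  refine Submodule.span_mono ?_ hmul
  rintro _ ⟨_, ⟨i, rfl⟩, _, ⟨j, rfl⟩, rfl⟩
  exact ⟨(i, j), rfl⟩

theorem exists_span_pow_mul_pow_eq_top {K : Type*} [Field K] [Algebra ℚ K] [FiniteDimensional ℚ K]
    {s t : K} (h : ∀ d : ℕ, 0 < d → IntermediateField.adjoin ℚ {s ^ d, t ^ d} = ⊤) :
    ∃ N : ℕ, ∀ d : ℕ, 0 < d → Submodule.span ℚ
      (Set.range fun ij : Fin N × Fin N => s ^ (d * (ij.1 : ℕ)) * t ^ (d * (ij.2 : ℕ))) = ⊤ := by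
  refine ⟨finrank ℚ K, fun d hd => ?_⟩
  simpa only [← pow_mul] using span_pow_mul_pow_eq_top (h d hd)

theorem adjoin_pow_eq_top {x y : ℝ} {d : ℕ}
    (h : pairField (x ^ d) (y ^ d) = pairField x y) :
    IntermediateField.adjoin ℚ {pairFst x y ^ d, pairSnd x y ^ d} = ⊤ := by
  have key : @IntermediateField.adjoin ℚ _ (pairField x y) _ (pairField x y).algebra'
      {pairFst x y ^ d, pairSnd x y ^ d} = ⊤ := by
    apply IntermediateField.lift_injective
    rw [IntermediateField.lift_adjoin, IntermediateField.lift_top, Set.image_pair]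
    exact h
  exact key

end Generation

/-! ### The pair `(λ, μ)` is good -/

section GoodPairs

variable {x y : ℝ} {r : ℕ} {b : Basis (Fin r) ℚ (pairField x y)}

theorem pairDen_pos (b : Basis (Fin r) ℚ (pairField x y)) : 0 < pairDen b := (leastDen_mem _ _).1

theorem goodPair_pairFst_pairSnd [Module (pairField x y) (PreSolenoid (pairDen b) r)]
    (hx : 1 < |x|) (hy : 1 < |y|) (hindep : MultIndep x y)
    (hhyp : IsHyperbolic (Subsemigroup.closure {x, y}))
    (hpow : ∀ l : ℕ, 1 ≤ l → pairField (x ^ l) (y ^ l) = pairField x y) (hb : IsIntegralBasis b)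
    {S : AdelicCoordSystem (pairField x y) (PreSolenoid (pairDen b) r)
      (Option (pairDen b).primeFactors × Fin r)}
    (h1 : ∀ i, ∃ θ : pairField x y →+* ℂ, ∀ α, S.a (none, i) α = ‖θ α‖)
    (h2 : ∀ (p : (pairDen b).primeFactors) i, ∃ θ : pairField x y →+* PadicAlgCl (p : ℕ),
      ∀ α, S.a (some p, i) α = ‖θ α‖) : GoodPair S (pairFst x y) (pairSnd x y) where
  left_ne_zero h := by
    have : x = 0 := congrArg Subtype.val h
    norm_num [this] at hx
  right_ne_zero h := by
    have : y = 0 := congrArg Subtype.val h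
    norm_num [this] at hy
  indep j k hjk := by
    have hy0 : y ≠ 0 := by rintro rfl; norm_num at hy
    have h3 : x ^ j * y ^ k = 1 := by
      have := congrArg (algebraMap (pairField x y) ℝ) hjk
      rwa [map_mul, map_zpow₀, map_zpow₀, map_one] at this
    by_contra hne
    refine hindep j (-k) (fun h => hne ?_) ?_
    · simpa using h
    · rw [zpow_neg]
      exact eq_inv_of_mul_eq_one_left h3
  -- At infinity the premise of hyperbolicity holds through the given real embedding, since `|x| >
  -- 1`. At `p ∣ a` it holds by minimality of the denominator `a`.
  hyp := by
    rintro ⟨_ | p, i⟩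
    · obtain ⟨θ, hθ⟩ := h1 i
      rw [hθ, hθ]
      refine hhyp.norm_complex_ne_one
        ⟨(algebraMap ℝ ℂ).comp (algebraMap (pairField x y) ℝ), Or.inl ?_⟩ θ
      change 1 < ‖((x : ℝ) : ℂ)‖
      rwa [Complex.norm_real]
    · obtain ⟨θ, hθ⟩ := h2 p i
      rw [hθ, hθ]
      exact hhyp.norm_padic_ne_one
        (exists_one_lt_norm_of_dvd_leastDen hb (Nat.dvd_of_mem_primeFactors p.2)) θ
  span := by
    have : FiniteDimensional ℚ (pairField x y) := b.finiteDimensional_of_finite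
    exact exists_span_pow_mul_pow_eq_top fun d hd => adjoin_pow_eq_top (hpow d hd)

end GoodPairs

/-! ### From matrices over `ℤ[1/a]` to scalars in `K` -/

section MatrixAction

variable {a r : ℕ}

theorem preAct_eq_ratAct (M : Matrix (Fin r) (Fin r) (zInv a)) (x : PreSolenoid a r) :
    preAct M x = ratAct (M.map (zInv a).subtype) x := rfl

theorem solenoidAct_coe (M : Matrix (Fin r) (Fin r) (zInv a)) (x : PreSolenoid a r) :
    solenoidAct M (x : Solenoid a r) = ((preAct M x : PreSolenoid a r) : Solenoid a r) := rfl

theorem solenoidAct_one (x : Solenoid a r) :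
    solenoidAct (1 : Matrix (Fin r) (Fin r) (zInv a)) x = x := by
  obtain ⟨x, rfl⟩ := QuotientAddGroup.mk_surjective x
  rw [solenoidAct_coe, preAct_eq_ratAct, Matrix.map_one _ (map_zero _) (map_one _)]
  exact congrArg _ (DFunLike.congr_fun (map_one (ratActHom a r)) x)

theorem solenoidAct_mul (M N : Matrix (Fin r) (Fin r) (zInv a)) (x : Solenoid a r) :
    solenoidAct (M * N) x = solenoidAct M (solenoidAct N x) := by
  obtain ⟨x, rfl⟩ := QuotientAddGroup.mk_surjective x
  rw [solenoidAct_coe, solenoidAct_coe, solenoidAct_coe, preAct_eq_ratAct, preAct_eq_ratAct,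
    preAct_eq_ratAct, Matrix.map_mul]
  exact congrArg _ (DFunLike.congr_fun (map_mul (ratActHom a r) _ _) x)

theorem solenoidAct_pow (M : Matrix (Fin r) (Fin r) (zInv a)) (n : ℕ) (x : Solenoid a r) :
    solenoidAct (M ^ n) x = (solenoidAct M)^[n] x := by
  induction n with
  | zero => rw [pow_zero, solenoidAct_one, Function.iterate_zero, id]
  | succ n ih => rw [pow_succ', solenoidAct_mul, ih, Function.iterate_succ_apply']

end MatrixAction

section PairSolenoid

variable {x y : ℝ} {r : ℕ} {b : Basis (Fin r) ℚ (pairField x y)}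

theorem matFst_map (b : Basis (Fin r) ℚ (pairField x y)) :
    (matFst b).map (zInv (pairDen b)).subtype = multMatrix b (pairFst x y) := rfl

theorem matSnd_map (b : Basis (Fin r) ℚ (pairField x y)) :
    (matSnd b).map (zInv (pairDen b)).subtype = multMatrix b (pairSnd x y) := rfl

theorem commute_solenoidAct_matFst_matSnd (b : Basis (Fin r) ℚ (pairField x y)) :
    Function.Commute (solenoidAct (matFst b)) (solenoidAct (matSnd b)) := by
  intro X
  have h : matFst b * matSnd b = matSnd b * matFst b := by
    refine Matrix.map_injective (Subring.subtype_injective (zInv (pairDen b))) ?_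
    beta_reduce
    rw [Matrix.map_mul, Matrix.map_mul, matFst_map, matSnd_map]
    have := map_mul (multMatrixHom b) (pairFst x y) (pairSnd x y)
    rw [mul_comm, map_mul] at this
    exact this.symm
  rw [← solenoidAct_mul, h, solenoidAct_mul]

/-- The one-factor case, for all powers of the two matrices. -/
theorem exists_isOfFinAddOrder_mem_of_pair
    (hx : 1 < |x|) (hy : 1 < |y|) (hindep : MultIndep x y)
    (hhyp : IsHyperbolic (Subsemigroup.closure {x, y}))
    (hpow : ∀ l : ℕ, 1 ≤ l → pairField (x ^ l) (y ^ l) = pairField x y) (hb : IsIntegralBasis b)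
    {u : ℕ} (hu : 0 < u) {E : Set (Solenoid (pairDen b) r)} (hE : IsClosed E) (hne : E.Nonempty)
    (hf : Set.MapsTo (solenoidAct (matFst b))^[u] E E)
    (hg : Set.MapsTo (solenoidAct (matSnd b))^[u] E E) : ∃ z ∈ E, IsOfFinAddOrder z := by
  let _ := preSolenoidModule b (pairDen b)
  have := preSolenoidModule_continuousConstSMul b (pairDen b)
  obtain ⟨S, hk1, hk2, ha1, ha2, hn1, hn2⟩ := exists_adelicCoordSystem b (pairDen b)
  have hgood := (goodPair_pairFst_pairSnd hx hy hindep hhyp hpow hb ha1 ha2).pow hu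
  refine exists_isOfFinAddOrder_mem (S := S) (pairDen_pos b) (preSolenoidModule_smul b)
    (fun X hX => hn1 X fun i => hX _ (hk1 i)) (fun X p hX => hn2 X p fun i => hX _ (hk2 p i)) hgood
    (f := solenoidAct (matFst b ^ u)) (g := solenoidAct (matSnd b ^ u)) (fun X => ?_) (fun X => ?_)
    hE hne (fun z hz => ?_) (fun z hz => ?_)
  · rw [solenoidAct_pow]
    exact iterate_quotient (K := pairField x y) (fun X => rfl) u X
  · rw [solenoidAct_pow]
    exact iterate_quotient (K := pairField x y) (fun X => rfl) u X
  · rw [solenoidAct_pow]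
    exact hf hz
  · rw [solenoidAct_pow]
    exact hg hz

theorem exists_iterate_eq_of_isOfFinAddOrder_solenoid (b : Basis (Fin r) ℚ (pairField x y))
    (f : Solenoid (pairDen b) r →+ Solenoid (pairDen b) r) {z : Solenoid (pairDen b) r}
    (hz : IsOfFinAddOrder z) : ∃ i j : ℕ, i < j ∧ f^[j] z = f^[i] z := by
  let _ := preSolenoidModule b (pairDen b)
  have : CompactSpace (Solenoid (pairDen b) r) := compactSpace_solenoid (pairDen_pos b)
  exact exists_iterate_eq_of_isOfFinAddOrder (K := pairField x y)
    ⟨1, one_pos, fun γ hγ h => eq_zero_of_mem_range_solenoidEmb (pairDen_pos b) hγ h⟩ f hz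

end PairSolenoid

/-! ### Induction over the factors, and the theorem -/

section FiniteProducts

theorem iterate_pi_apply {ι : Type*} {X : ι → Type*} (f : ∀ i, X i → X i) (n : ℕ) (ω : ∀ i, X i) :
    (fun (ω : ∀ i, X i) i => f i (ω i))^[n] ω = fun i => (f i)^[n] (ω i) := by
  induction n with
  | zero => rfl
  | succ n ih => rw [Function.iterate_succ_apply', ih]; simp only [Function.iterate_succ_apply']

/-- If in each factor of a product all closed sets invariant under powers of two commuting
endomorphisms contain torsion points, and torsion points are preperiodic, then the same holds in the
product. -/
theorem exists_forall_isOfFinAddOrder {ι : Type*} {X : ι → Type*} [∀ i, AddCommGroup (X i)]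
    [∀ i, TopologicalSpace (X i)] [∀ i, CompactSpace (X i)] [∀ i, T2Space (X i)]
    {f g : ∀ i, X i →+ X i} (hcomm : ∀ i, Function.Commute (f i) (g i))
    (hper : ∀ i (h : X i →+ X i) (x : X i), IsOfFinAddOrder x → ∃ m n : ℕ, m < n ∧ h^[n] x = h^[m] x)
    (hone : ∀ i (u : ℕ), 0 < u → ∀ E : Set (X i), IsClosed E → E.Nonempty →
      Set.MapsTo (f i)^[u] E E → Set.MapsTo (g i)^[u] E E → ∃ x ∈ E, IsOfFinAddOrder x)
    (s : Finset ι) {u : ℕ} (hu : 0 < u) {F : Set (∀ i, X i)} (hF : IsClosed F) (hne : F.Nonempty)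
    (hf : Set.MapsTo (fun ω i => (f i)^[u] (ω i)) F F)
    (hg : Set.MapsTo (fun ω i => (g i)^[u] (ω i)) F F) :
    ∃ ω ∈ F, ∀ i ∈ s, IsOfFinAddOrder (ω i) := by
  classical
  induction s using Finset.induction_on generalizing u F with
  | empty => exact hne.imp fun ω hω => ⟨hω, by simp⟩
  | insert i s _ ih =>
    have hfn : ∀ n, Set.MapsTo (fun ω i => (f i)^[u * n] (ω i)) F F := fun n ω hω => by
      have := hf.iterate n hω
      rw [iterate_pi_apply fun i => (f i)^[u]] at this
      simpa only [Function.iterate_mul] using this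
    have hgn : ∀ n, Set.MapsTo (fun ω i => (g i)^[u * n] (ω i)) F F := fun n ω hω => by
      have := hg.iterate n hω
      rw [iterate_pi_apply fun i => (g i)^[u]] at this
      simpa only [Function.iterate_mul] using this
    obtain ⟨_, ⟨ω, hω, rfl⟩, hx⟩ := hone i u hu ((fun ω : ∀ i, X i => ω i) '' F)
      (hF.isCompact.image (continuous_apply i)).isClosed (hne.image _)
      (by rintro _ ⟨ω, hω, rfl⟩; exact ⟨_, hf hω, rfl⟩)
      (by rintro _ ⟨ω, hω, rfl⟩; exact ⟨_, hg hω, rfl⟩)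
    have hit : ∀ (h : X i →+ X i) (n : ℕ) (x : X i), IsOfFinAddOrder x → IsOfFinAddOrder (h^[n] x) := by
      intro h n x hx
      induction n with
      | zero => exact hx
      | succ n ih => rw [Function.iterate_succ_apply']; exact h.isOfFinAddOrder ih
    obtain ⟨m, n, hmn, hfx⟩ := hper i (AddMonoidHom.mk' (f i)^[u] (iterate_map_add (f i) u)) _ hx
    obtain ⟨m', n', hmn', hgx⟩ := hper i (AddMonoidHom.mk' (g i)^[u] (iterate_map_add (g i) u)) _
      (hit (f i) (u * m) _ hx)
    replace hfx : (f i)^[u * n] (ω i) = (f i)^[u * m] (ω i) := by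
      rw [Function.iterate_mul, Function.iterate_mul]
      exact hfx
    replace hgx : (g i)^[u * n'] ((f i)^[u * m] (ω i)) = (g i)^[u * m'] ((f i)^[u * m] (ω i)) := by
      rw [Function.iterate_mul (g i) u n', Function.iterate_mul (g i) u m']
      exact hgx
    -- Far enough along the orbit the torsion point is periodic under both maps; periodicity under
    -- `f i` survives applying `g i` because they commute.
    set x := (g i)^[u * m'] ((f i)^[u * m] (ω i)) with hxdef
    have hfp : Function.IsPeriodicPt (f i) (u * (n - m)) x := by
      rw [hxdef, Function.IsPeriodicPt, Function.IsFixedPt,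
        ((hcomm i).iterate_iterate (u * (n - m)) (u * m')).eq, ← Function.iterate_add_apply,
        ← mul_add, Nat.sub_add_cancel hmn.le, hfx]
    have hgp : Function.IsPeriodicPt (g i) (u * (n' - m')) x := by
      rw [hxdef, Function.IsPeriodicPt, Function.IsFixedPt, ← Function.iterate_add_apply,
        ← mul_add, Nat.sub_add_cancel hmn'.le, hgx]
    set w := (n - m) * (n' - m') with hw
    have hw0 : 0 < w := Nat.mul_pos (Nat.sub_pos_of_lt hmn) (Nat.sub_pos_of_lt hmn')
    have hfw : (f i)^[u * w] x = x := hfp.trans_dvd (Nat.mul_dvd_mul_left u (Dvd.intro _ rfl))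
    have hgw : (g i)^[u * w] x = x := hgp.trans_dvd (Nat.mul_dvd_mul_left u (Dvd.intro_left _ rfl))
    -- The fibre of `F` over `x` is invariant only under the powers with exponent `u * w`, which is
    -- why the induction runs over all `u`.
    obtain ⟨η, ⟨hη, hηi⟩, hηs⟩ := ih (u := u * w) (Nat.mul_pos hu hw0)
      (F := {η | η ∈ F ∧ η i = x})
      (hF.inter (isClosed_singleton.preimage (continuous_apply i)))
      ⟨_, hgn m' (hfn m hω), rfl⟩
      (fun η hη => ⟨hfn w hη.1, by change (f i)^[u * w] (η i) = x; rw [hη.2, hfw]⟩)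
      (fun η hη => ⟨hgn w hη.1, by change (g i)^[u * w] (η i) = x; rw [hη.2, hgw]⟩)
    refine ⟨η, hη, fun j hj => ?_⟩
    rcases Finset.mem_insert.1 hj with rfl | hj
    · rw [hηi]
      exact hit _ _ _ (hit _ _ _ hx)
    · exact hηs j hj

end FiniteProducts

theorem proposition3p1 (k : ℕ) (lam mu : Fin k → ℝ)
    (hlam_alg : ∀ i, IsAlgebraic ℚ (lam i)) (hmu_alg : ∀ i, IsAlgebraic ℚ (mu i))
    (hlam : ∀ i, 1 < |lam i|) (hmu : ∀ i, 1 < |mu i|)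
    (hindep : ∀ i, MultIndep (lam i) (mu i))
    (hhyp : ∀ i, IsHyperbolic (Subsemigroup.closure {lam i, mu i}))
    (hpow : ∀ i, ∀ l : ℕ, 1 ≤ l →
      pairField (lam i ^ l) (mu i ^ l) = pairField (lam i) (mu i))
    (r : Fin k → ℕ) (b : ∀ i, Module.Basis (Fin (r i)) ℚ (pairField (lam i) (mu i)))
    (hb : ∀ i, IsIntegralBasis (b i))
    (F : Set (Omega b)) (hF_closed : IsClosed F) (hF_nonempty : F.Nonempty)
    (hF_inv : ∀ D ∈ SigmaAct b, Set.MapsTo D F F) :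
    ∃ ω ∈ F, IsOfFinAddOrder ω := by
  have : ∀ i, CompactSpace (Solenoid (pairDen (b i)) (r i)) := fun i =>
    compactSpace_solenoid (pairDen_pos (b i))
  have : ∀ i, T2Space (Solenoid (pairDen (b i)) (r i)) := fun i =>
    t2Space_solenoid (pairDen_pos (b i))
  obtain ⟨ω, hω, htors⟩ := exists_forall_isOfFinAddOrder
    (f := fun i => solenoidAct (matFst (b i))) (g := fun i => solenoidAct (matSnd (b i)))
    (fun i => commute_solenoidAct_matFst_matSnd (b i))
    (fun i h x hx => exists_iterate_eq_of_isOfFinAddOrder_solenoid (b i) h hx)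
    (fun i u hu E hE hne hf hg => exists_isOfFinAddOrder_mem_of_pair (hlam i) (hmu i) (hindep i)
      (hhyp i) (hpow i) (hb i) hu hE hne hf hg)
    Finset.univ one_pos hF_closed hF_nonempty
    (hF_inv _ ⟨1, 0, by simp⟩) (hF_inv _ ⟨0, 1, by simp⟩)
  choose n hn hn0 using fun i => isOfFinAddOrder_iff_nsmul_eq_zero.1 (htors i (Finset.mem_univ i))
  refine ⟨ω, hω, isOfFinAddOrder_iff_nsmul_eq_zero.2
    ⟨∏ i, n i, Finset.prod_pos fun i _ => hn i, funext fun i => ?_⟩⟩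
  obtain ⟨c, hc⟩ := Finset.dvd_prod_of_mem n (Finset.mem_univ i)
  rw [Pi.smul_apply, hc, mul_comm, mul_smul, hn0, smul_zero, Pi.zero_apply]
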